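/- Let $n\ge 1$, let $\Omega\subset\mathbb R^n$ be a bounded open set, and let $u\in W^{1,n-1}(\Omega,\mathbb R^n)\cap L^\infty(\Omega,\mathbb R^n)$ with $\det Du\in L^1(\Omega)$ (for $n=1$, "$u\in W^{1,0}$" is understood as: $u$ has a locally integrable weak derivative). For $f\in C^1_c(\Omega\times\mathbb R^n,\mathbb R^n)$, $f=f(x,y)$, put $$\mathcal E_u(f)=\int_\Omega\Big[D_xf(x,u(x))\cdot\operatorname{cof}Du(x)+\operatorname{div}_yf(x,u(x))\,\det Du(x)\Big]dx,$$ where $\cdot$ is the entrywise inner product of matrices, and define the surface energy $$\mathcal E(u)=\sup\{\mathcal E_u(f): f\in C^1_c(\Omega\times\mathbb R^n,\mathbb R^n),\ \|f\|_{L^\infty}\le 1\}\in[0,\infty].$$ A $k$-dimensional current in $U=\Omega\times\mathbb R^n$ is a linear form on the space $\mathcal D^k(U)$ of $C^\infty$ $k$-forms with compact support in $U$; its boundary (for $k\ge1$) is $\langle\partial T,\omega\rangle=\langle T,d\omega\rangle$, and its mass is $\mathbb M(T)=\sup\{\langle T,\omega\rangle:\omega\in\mathcal D^k(U),\ |\omega|\le1\}$,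 where $|\omega|$ is the pointwise Euclidean norm. Let $$\mathcal G_u=\{(x,u(x)):x\in\Omega,\ u\text{ approximately differentiable at }x\},\qquad M(Du)=(e_1,Du\,e_1)\wedge\dots\wedge(e_n,Du\,e_n)$$ (here $Du$ is the approximate differential), and let $G_u$ be the $n$-dimensional current in $\Omega\times\mathbb R^n$ of integration over the graph, $$\langle G_u,\omega\rangle=\int_{\mathcal G_u}\langle\xi,\omega\rangle\,d\mathcal H^n,\qquad \xi(x,u(x))=\frac{M(Du(x))}{|M(Du(x))|}.$$ Then every $\omega\in\mathcal D^n(\Omega\times\mathbb R^n)$ is integrable over $\mathcal G_u$, so that $G_u$ is well defined, and the following hold. 1. For every $f\in C^1_c(\Omega\times\mathbb R^n,\mathbb R^n)$, with the vertical $(n-1)$-form $$\omega_f(x,y)=\sum_{j=1}^n(-1)^{j-1}f^j(x,y)\,dy^1\wedge\dots\wedge dy^{j-1}\wedge dy^{j+1}\wedge\dots\wedge dy^n,$$ the integrals defining $\mathcal E_u(f)$ and $\langle\partial G_u,\omega_f\rangle=\langle G_u,d\omega_f\rangle=\int_{\mathcal G_u}\langle\xi,d\omega_f\rangle\,d\mathcal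 H^n$ converge absolutely, and $$\mathcal E_u(f)=\langle\partial G_u,\omega_f\rangle .$$ 2. $\mathcal E(u)=\mathbb M(\partial G_u)$, as an equality in $[0,\infty]$. -/

import Mathlib

open MeasureTheory Filter Topology
open scoped ENNReal ContDiff

noncomputable section

namespace GraphCurrents

/-- Euclidean space `ℝⁿ`. -/
abbrev Space (n : ℕ) := EuclideanSpace ℝ (Fin n)

/-- The product `ℝⁿ_x × ℝⁿ_y` of reference and deformed configuration, with its Euclidean
structure. The coordinates `x_i` have index `Sum.inl i`, the coordinates `y_j` index `Sum.inr j`. -/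
abbrev Prd (n : ℕ) := EuclideanSpace ℝ (Fin n ⊕ Fin n)

/-- The point `(x, y)` of `ℝⁿ_x × ℝⁿ_y`. -/
def pt {n : ℕ} (x y : Space n) : Prd n := WithLp.toLp 2 (Sum.elim x y)

/-- The component `x` of a point `(x, y)`. -/
def xPart {n : ℕ} (p : Prd n) : Space n := WithLp.toLp 2 (fun i => p (Sum.inl i))

/-- The component `y` of a point `(x, y)`. -/
def yPart {n : ℕ} (p : Prd n) : Space n := WithLp.toLp 2 (fun j => p (Sum.inr j))

/-- The standard basis vector `eᵢ` of `ℝⁿ`. -/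
abbrev stdVec {n : ℕ} (i : Fin n) : Space n := EuclideanSpace.single i 1

/-- The cylinder `Ω × ℝⁿ`. -/
def cylinder {n : ℕ} (Ω : Set (Space n)) : Set (Prd n) := {p | xPart p ∈ Ω}

/-! ### Sobolev maps -/

/-- `Du` is the weak gradient of `u : Ω → ℝⁿ`; the entry `Du x j i` is `∂u_j / ∂x_i`. -/
def HasWeakGradient {n : ℕ} (Ω : Set (Space n)) (u : Space n → Space n)
    (Du : Space n → Matrix (Fin n) (Fin n) ℝ) : Prop :=
  ∀ i j : Fin n,
    LocallyIntegrableOn (fun x => u x j) Ω ∧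
    LocallyIntegrableOn (fun x => Du x j i) Ω ∧
    ∀ φ : Space n → ℝ, ContDiff ℝ ∞ φ → HasCompactSupport φ → tsupport φ ⊆ Ω →
      ∫ x in Ω, u x j * fderiv ℝ φ x (stdVec i) = - ∫ x in Ω, Du x j i * φ x

/-- `u ∈ W^{1,p}(Ω, ℝⁿ)` with weak gradient `Du`. -/
def MemSobolev {n : ℕ} (p : ℝ≥0∞) (Ω : Set (Space n)) (u : Space n → Space n)
    (Du : Space n → Matrix (Fin n) (Fin n) ℝ) : Prop :=
  HasWeakGradient Ω u Du ∧ MemLp u p (volume.restrict Ω) ∧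
    ∀ i j : Fin n, MemLp (fun x => Du x j i) p (volume.restrict Ω)

/-! ### The surface energy -/

/-- The cofactor matrix, the transpose of the adjugate. -/
def cof {n : ℕ} (A : Matrix (Fin n) (Fin n) ℝ) : Matrix (Fin n) (Fin n) ℝ :=
  A.adjugate.transpose

/-- `D_x f (p)`, a matrix with entries `∂f^j / ∂x_i`. -/
def gradX {n : ℕ} (f : Prd n → Space n) (p : Prd n) : Matrix (Fin n) (Fin n) ℝ :=
  Matrix.of fun j i => fderiv ℝ f p (pt (stdVec i) 0) j

/-- `div_y f (p)`. -/
def divY {n : ℕ} (f : Prd n → Space n) (p : Prd n) : ℝ :=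
  ∑ j, fderiv ℝ f p (pt 0 (stdVec j)) j

/-- `D_x f(x,u(x)) · cof Du(x) + div_y f(x,u(x)) det Du(x)`, with the entrywise (Frobenius) inner
product of matrices. -/
def energyDensity {n : ℕ} (u : Space n → Space n) (Du : Space n → Matrix (Fin n) (Fin n) ℝ)
    (f : Prd n → Space n) (x : Space n) : ℝ :=
  (∑ j, ∑ i, gradX f (pt x (u x)) j i * cof (Du x) j i)
    + divY f (pt x (u x)) * (Du x).det

/-- `E_u(f)`. -/
def energyFunctional {n : ℕ} (Ω : Set (Space n)) (u : Space n → Space n)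
    (Du : Space n → Matrix (Fin n) (Fin n) ℝ) (f : Prd n → Space n) : ℝ :=
  ∫ x in Ω, energyDensity u Du f x

/-- `f ∈ C¹_c(Ω × ℝⁿ, ℝⁿ)`. -/
def IsTestField {n : ℕ} (Ω : Set (Space n)) (f : Prd n → Space n) : Prop :=
  ContDiff ℝ 1 f ∧ HasCompactSupport f ∧ tsupport f ⊆ cylinder Ω

/-- The surface energy `E(u)`, the supremum of `E_u(f)` over `f ∈ C¹_c(Ω × ℝⁿ, ℝⁿ)` with
`‖f‖_∞ ≤ 1`. -/
def surfaceEnergy {n : ℕ} (Ω : Set (Space n)) (u : Space n → Space n)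
    (Du : Space n → Matrix (Fin n) (Fin n) ℝ) : EReal :=
  ⨆ (f : Prd n → Space n) (_ : IsTestField Ω f) (_ : ∀ p, ‖f p‖ ≤ 1),
    ((energyFunctional Ω u Du f : ℝ) : EReal)

/-! ### Currents in open subsets of `ℝⁿ_x × ℝⁿ_y` -/

/-- The space `𝓓ᵏ(U)` of smooth `k`-forms with compact support in `U`. -/
def testForms {n : ℕ} (U : Set (Prd n)) (k : ℕ) :
    Submodule ℝ (Prd n → Prd n [⋀^Fin k]→L[ℝ] ℝ) where
  carrier := {η | ContDiff ℝ ∞ η ∧ HasCompactSupport η ∧ tsupport η ⊆ U}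
  zero_mem' := by
    refine ⟨contDiff_const, HasCompactSupport.zero, ?_⟩
    simp [tsupport]
  add_mem' := by
    rintro a b ⟨ha, ha', ha''⟩ ⟨hb, hb', hb''⟩
    exact ⟨ha.add hb, ha'.add hb', (tsupport_add a b).trans (Set.union_subset ha'' hb'')⟩
  smul_mem' := by
    rintro c a ⟨ha, ha', ha''⟩
    refine ⟨contDiff_const.smul ha, ?_, ?_⟩
    · exact ha'.mono (Function.support_const_smul_subset c a)
    · exact (closure_mono (Function.support_const_smul_subset c a)).trans ha''

/-- A `k`-dimensional current in `U` is a linear form on `𝓓ᵏ(U)`. -/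
abbrev Current {n : ℕ} (U : Set (Prd n)) (k : ℕ) := Module.Dual ℝ (testForms U k)

theorem support_extDeriv_subset {n k : ℕ} (η : Prd n → Prd n [⋀^Fin k]→L[ℝ] ℝ) :
    Function.support (extDeriv η) ⊆ tsupport η := by
  intro x hx
  by_contra hc
  apply hx
  have h : fderiv ℝ η x = 0 := by
    by_contra h
    exact hc (support_fderiv_subset ℝ h)
  change ContinuousAlternatingMap.alternatizeUncurryFin (fderiv ℝ η x) = 0
  rw [h]
  exact (ContinuousAlternatingMap.alternatizeUncurryFinCLM ℝ (Prd n) ℝ (n := k)).map_zero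

theorem extDeriv_mem_testForms {n k : ℕ} {U : Set (Prd n)} {η : Prd n → Prd n [⋀^Fin k]→L[ℝ] ℝ}
    (hη : η ∈ testForms U k) : extDeriv η ∈ testForms U (k + 1) := by
  obtain ⟨h1, h2, h3⟩ := hη
  have hs : tsupport (extDeriv η) ⊆ tsupport η :=
    closure_minimal (support_extDeriv_subset η) (isClosed_tsupport η)
  refine ⟨?_, ?_, hs.trans h3⟩
  · have hd : ContDiff ℝ ∞ (fderiv ℝ η) := h1.fderiv_right (m := ∞) (by simp)
    exact (ContinuousAlternatingMap.alternatizeUncurryFinCLM ℝ (Prd n) ℝ (n := k)).contDiff.comp hd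
  · exact h2.mono' (support_extDeriv_subset η)

/-- The exterior derivative `d : 𝓓ᵏ(U) → 𝓓ᵏ⁺¹(U)`. -/
def extDerivTest {n : ℕ} (U : Set (Prd n)) (k : ℕ) : testForms U k →ₗ[ℝ] testForms U (k + 1) where
  toFun η := ⟨extDeriv (η : Prd n → Prd n [⋀^Fin k]→L[ℝ] ℝ), extDeriv_mem_testForms η.2⟩
  map_add' a b := by
    ext1
    funext x
    exact extDeriv_add (a.2.1.differentiable (by simp) x) (b.2.1.differentiable (by simp) x)
  map_smul' c a := by
    ext1
    funext x
    exact extDeriv_smul c (a : Prd n → Prd n [⋀^Fin k]→L[ℝ] ℝ)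

/-- The boundary of a current, `⟨∂T, η⟩ = ⟨T, dη⟩`. -/
def Current.boundary {n : ℕ} {U : Set (Prd n)} {k : ℕ} (T : Current U (k + 1)) : Current U k :=
  T ∘ₗ extDerivTest U k

/-- The Euclidean norm of a `k`-covector: `|φ|²` is the sum of the squares of the coefficients of
`φ` in the standard basis `dx_α ∧ dy_β`, `|α| + |β| = k`. The sum here runs over all ordered
`k`-tuples of basis vectors, so that each coefficient appears `k!` times. -/
def covectorNorm {n k : ℕ} (φ : Prd n [⋀^Fin k]→L[ℝ] ℝ) : ℝ :=
  Real.sqrt ((∑ I : Fin k → Fin n ⊕ Fin n, φ (fun a => EuclideanSpace.single (I a) 1) ^ 2) / (k.factorial : ℝ))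

/-- The mass of a current, `𝕄(T) = sup {⟨T, η⟩ : η ∈ 𝓓ᵏ(U), |η| ≤ 1}`. -/
def Current.mass {n : ℕ} {U : Set (Prd n)} {k : ℕ} (T : Current U k) : EReal :=
  ⨆ (η : testForms U k)
    (_ : ∀ p, covectorNorm ((η : Prd n → Prd n [⋀^Fin k]→L[ℝ] ℝ) p) ≤ 1), ((T η : ℝ) : EReal)

/-! ### The graph current -/

/-- `u` is approximately differentiable at `x` with approximate differential `L`: for every `ε > 0`
the set of `y` with `|u(y) - u(x) - L(y - x)| > ε |y - x|` has density `0` at `x`. -/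
def HasApproxDerivAt {n : ℕ} (u : Space n → Space n) (L : Space n →L[ℝ] Space n)
    (x : Space n) : Prop :=
  ∀ ε : ℝ, 0 < ε →
    Tendsto (fun r : ℝ =>
      volume ({y | ε * ‖y - x‖ < ‖u y - u x - L (y - x)‖} ∩ Metric.ball x r)
        / volume (Metric.ball x r)) (𝓝[>] 0) (𝓝 0)

open Classical in
/-- The approximate differential of `u` at `x` (`0` if there is none). -/
def approxDeriv {n : ℕ} (u : Space n → Space n) (x : Space n) : Space n →L[ℝ] Space n :=
  if h : ∃ L, HasApproxDerivAt u L x then h.choose else 0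

/-- The graph `𝒢_u = {(x, u(x)) : x ∈ Ω, u approximately differentiable at x}`. -/
def graphSet {n : ℕ} (Ω : Set (Space n)) (u : Space n → Space n) : Set (Prd n) :=
  {p | xPart p ∈ Ω ∧ (∃ L, HasApproxDerivAt u L (xPart p)) ∧ yPart p = u (xPart p)}

/-- The vectors `(eᵢ, Du(x) eᵢ)`, whose exterior product is `M(Du(x))`. -/
def graphTangent {n : ℕ} (u : Space n → Space n) (x : Space n) (i : Fin n) : Prd n :=
  pt (stdVec i) (approxDeriv u x (stdVec i))

/-- The Euclidean norm `|v₁ ∧ ⋯ ∧ v_k|` of a simple `k`-vector, the square root of the Gram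
determinant of `v₁, …, v_k`. -/
def simpleVectorNorm {n k : ℕ} (v : Fin k → Prd n) : ℝ :=
  Real.sqrt (Matrix.gram ℝ v).det

/-- `⟨ξ, η⟩` at the point `p` of the graph, where `ξ = M(Du(x)) / |M(Du(x))|`. -/
def graphDensity {n : ℕ} (u : Space n → Space n) (η : Prd n → Prd n [⋀^Fin n]→L[ℝ] ℝ)
    (p : Prd n) : ℝ :=
  η p (graphTangent u (xPart p)) / simpleVectorNorm (graphTangent u (xPart p))

/-- The measure `𝓗ⁿ` restricted to the graph of `u`; `𝓗ⁿ` is normalized so that it is Lebesgue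
measure on `ℝⁿ`. -/
def graphMeasure {n : ℕ} (Ω : Set (Space n)) (u : Space n → Space n) : Measure (Prd n) :=
  (Measure.euclideanHausdorffMeasure n : Measure (Prd n)).restrict (graphSet Ω u)

/-- The integral of an `n`-form over the graph of `u`. -/
def graphPairing {n : ℕ} (Ω : Set (Space n)) (u : Space n → Space n)
    (η : Prd n → Prd n [⋀^Fin n]→L[ℝ] ℝ) : ℝ :=
  ∫ p, graphDensity u η p ∂(graphMeasure Ω u)

/-- All forms in `𝓓ⁿ(Ω × ℝⁿ)` are integrable over the graph of `u`. -/
def GraphIntegrable {n : ℕ} (Ω : Set (Space n)) (u : Space n → Space n) : Prop :=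
  ∀ η : testForms (cylinder Ω) n,
    Integrable (graphDensity u (η : Prd n → Prd n [⋀^Fin n]→L[ℝ] ℝ)) (graphMeasure Ω u)

open Classical in
/-- The graph current `G_u`, i.e. integration over the graph of `u` oriented by `ξ`. It is the
zero current if some form in `𝓓ⁿ(Ω × ℝⁿ)` fails to be integrable over the graph. -/
def graphCurrent {n : ℕ} (Ω : Set (Space n)) (u : Space n → Space n) : Current (cylinder Ω) n :=
  if h : GraphIntegrable Ω u then
    { toFun := fun η => graphPairing Ω u (η : Prd n → Prd n [⋀^Fin n]→L[ℝ] ℝ)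
      map_add' := fun a b => by
        simp only [graphPairing]
        rw [← integral_add (h a) (h b)]
        congr 1
        funext p
        simp [graphDensity, add_div]
      map_smul' := fun c a => by
        simp only [graphPairing, RingHom.id_apply, smul_eq_mul]
        rw [← integral_const_mul]
        congr 1
        funext p
        simp [graphDensity, mul_div_assoc] }
  else 0

/-! ### The vertical form of a vector field -/

/-- The coordinates `(y_k)_{k ≠ j}`, in increasing order of `k`. -/
def coordsHat {m : ℕ} (j : Fin (m + 1)) : Prd (m + 1) →L[ℝ] (Fin m → ℝ) :=
  ContinuousLinearMap.pi fun a =>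
    (EuclideanSpace.proj (Sum.inr (j.succAbove a)) : Prd (m + 1) →L[ℝ] ℝ)

/-- The determinant of `m` vectors of `ℝᵐ`, i.e. the form `dy¹ ∧ ⋯ ∧ dyᵐ`. -/
def detForm (m : ℕ) : (Fin m → ℝ) [⋀^Fin m]→L[ℝ] ℝ :=
  { (Matrix.detRowAlternating : (Fin m → ℝ) [⋀^Fin m]→ₗ[ℝ] ℝ) with
    cont := Continuous.matrix_det continuous_id }

/-- The constant `m`-form `dy¹ ∧ ⋯ ∧ dyʲ⁻¹ ∧ dyʲ⁺¹ ∧ ⋯ ∧ dyᵐ⁺¹`; its value on `v₁, …, v_m` is the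
determinant of the matrix of the coordinates `(y_k)_{k ≠ j}` of the `v_b`. -/
def dyHat {m : ℕ} (j : Fin (m + 1)) : Prd (m + 1) [⋀^Fin m]→L[ℝ] ℝ :=
  (detForm m).compContinuousLinearMap (coordsHat j)

/-- `ω_f = ∑_j (-1)^{j-1} f^j dy¹ ∧ ⋯ ∧ dyʲ⁻¹ ∧ dyʲ⁺¹ ∧ ⋯ ∧ dyᵐ⁺¹` (here `j` is counted from
`0`). -/
def verticalForm {m : ℕ} (f : Prd (m + 1) → Space (m + 1)) (p : Prd (m + 1)) :
    Prd (m + 1) [⋀^Fin m]→L[ℝ] ℝ :=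
  ∑ j : Fin (m + 1), ((-1 : ℝ) ^ (j : ℕ) * f p j) • dyHat j

end GraphCurrents

end

/-!
Put `ν = m + 1`. Everything is pulled back to `Ω` along `x ↦ (x, u(x))`: a Sobolev map is
approximately differentiable almost everywhere with approximate differential `Du`
(`HasWeakGradient.ae_hasApproxDerivAt`), and for such a map the measure `𝓗^ν` on the graph is the
image of Lebesgue measure with the Jacobian `|M(Du)|` as density (`graphMeasure_eq_map`). The
Jacobian cancels the normalization of `ξ`, so that the pairing of the graph with a form `θ` is
`∫_Ω θ(x, u)((e₁, Du e₁), …, (e_ν, Du e_ν)) dx`. Expanded by multilinearity, this integrand consists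
of minors of `Du`. The minor of order `ν` is `det Du`, the others are bounded by
`C (1 + |Du|)^(ν - 1)`, and all are integrable (`Admissible.integrableOn_form_tangents`). The image
formula rests on the area formula for graphs over sets of differentiability and on the fact that
the points of approximate differentiability are covered by countably many sets on which `u` is
Lipschitz (`exists_lipschitz_cover`).

For `θ = dω_f` the minors of order `ν - 1` combine to `D_x f · cof Du` and the one of order `ν` to
`div_y f det Du` (`extDeriv_verticalForm_tangents`), which gives the identity of `E_u(f)` and
`⟨∂G_u, ω_f⟩`.

For the mass, the coefficients of `ω_f` are, up to sign, the components of `f`, so that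
`|ω_f| = |f|`; approximating a `C¹` field by smooth ones yields `E(u) ≤ 𝕄(∂G_u)`. Conversely, the
purely vertical coefficients of a form `η` define a field `f` with `|f| ≤ |η|`, and `η - ω_f`
vanishes on vertical vectors. It remains to see that `∂G_u` annihilates every form `η` that vanishes
on vertical vectors (`Admissible.integral_extDeriv_eq_zero`). For the graph of a smooth map this is
Stokes' theorem. For `u` one passes to the limit along mollifications `u_k`: since `η` vanishes on
vertical vectors, so does `dη`, and `det Du_k`, which need not converge in `L¹`, does not occur.
What remains is dominated by `C (1 + |Du_k|^(ν - 1))`, and Jensen's inequality bounds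
`|Du_k|^(ν - 1)` by the mollification of `|Du|^(ν - 1)`, whose integral does not depend on `k`.
-/

noncomputable section

namespace GraphCurrents

section

/-! ### The splitting `ℝⁿ_x × ℝⁿ_y` -/

/-- The inclusion `x ↦ (x, 0)`. -/
def xEmb (n : ℕ) : Space n →L[ℝ] Prd n :=
  LinearMap.toContinuousLinearMap
    { toFun := fun x => pt x 0
      map_add' := fun x y => by ext (i | i) <;> simp [pt]
      map_smul' := fun c x => by ext (i | i) <;> simp [pt] }

/-- The inclusion `y ↦ (0, y)`. -/
def yEmb (n : ℕ) : Space n →L[ℝ] Prd n :=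
  LinearMap.toContinuousLinearMap
    { toFun := fun y => pt 0 y
      map_add' := fun x y => by ext (i | i) <;> simp [pt]
      map_smul' := fun c x => by ext (i | i) <;> simp [pt] }

/-- The projection `(x, y) ↦ x`. -/
def xProj (n : ℕ) : Prd n →L[ℝ] Space n :=
  LinearMap.toContinuousLinearMap
    { toFun := xPart
      map_add' := fun x y => by ext i; simp [xPart]
      map_smul' := fun c x => by ext i; simp [xPart] }

/-- The projection `(x, y) ↦ y`. -/
def yProj (n : ℕ) : Prd n →L[ℝ] Space n :=
  LinearMap.toContinuousLinearMap
    { toFun := yPart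
      map_add' := fun x y => by ext i; simp [yPart]
      map_smul' := fun c x => by ext i; simp [yPart] }

variable {n : ℕ}

@[simp] theorem yEmb_apply (y : Space n) : yEmb n y = pt 0 y := rfl

@[simp] theorem pt_inl (x y : Space n) (i : Fin n) : pt x y (Sum.inl i) = x i := rfl
@[simp] theorem pt_inr (x y : Space n) (i : Fin n) : pt x y (Sum.inr i) = y i := rfl
@[simp] theorem xPart_pt (x y : Space n) : xPart (pt x y) = x := rfl
@[simp] theorem yPart_pt (x y : Space n) : yPart (pt x y) = y := rfl

theorem pt_xPart_yPart (p : Prd n) : pt (xPart p) (yPart p) = p := by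
  ext (i | i) <;> rfl

theorem pt_eq_add (x y : Space n) : pt x y = pt x 0 + pt 0 y := by
  ext (i | i) <;> simp [pt]

theorem pt_sub_pt (x y x' y' : Space n) : pt x y - pt x' y' = pt (x - x') (y - y') := by
  ext (i | i) <;> simp [pt]

theorem inner_pt (x y x' y' : Space n) :
    inner ℝ (pt x y) (pt x' y') = inner ℝ x x' + inner ℝ y y' := by
  simp [PiLp.inner_apply, pt]

theorem norm_pt_sq (x y : Space n) : ‖pt x y‖ ^ 2 = ‖x‖ ^ 2 + ‖y‖ ^ 2 := by
  rw [← real_inner_self_eq_norm_sq, ← real_inner_self_eq_norm_sq, ← real_inner_self_eq_norm_sq,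
    inner_pt]

theorem norm_pt_zero_right (x : Space n) : ‖pt x 0‖ = ‖x‖ := by
  have := norm_pt_sq x 0
  rw [norm_zero, zero_pow two_ne_zero, add_zero] at this
  exact (pow_left_inj₀ (norm_nonneg _) (norm_nonneg _) two_ne_zero).1 this

theorem norm_pt_zero_left (y : Space n) : ‖pt 0 y‖ = ‖y‖ := by
  have := norm_pt_sq 0 y
  rw [norm_zero, zero_pow two_ne_zero, zero_add] at this
  exact (pow_left_inj₀ (norm_nonneg _) (norm_nonneg _) two_ne_zero).1 this

theorem norm_le_norm_pt_left (x y : Space n) : ‖x‖ ≤ ‖pt x y‖ :=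
  (sq_le_sq₀ (norm_nonneg _) (norm_nonneg _)).1 (by rw [norm_pt_sq]; nlinarith [sq_nonneg ‖y‖])

theorem norm_pt_le (x y : Space n) : ‖pt x y‖ ≤ ‖x‖ + ‖y‖ := by
  rw [pt_eq_add]
  exact (norm_add_le _ _).trans (by rw [norm_pt_zero_left, norm_pt_zero_right])

theorem continuous_pt : Continuous fun q : Space n × Space n => pt q.1 q.2 := by
  have : (fun q : Space n × Space n => pt q.1 q.2) = fun q => xEmb n q.1 + yEmb n q.2 :=
    funext fun q => pt_eq_add _ _
  rw [this]
  fun_prop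

theorem continuous_xPart : Continuous (xPart : Prd n → Space n) := (xProj n).continuous

theorem continuous_yPart : Continuous (yPart : Prd n → Space n) := (yProj n).continuous

theorem isOpen_cylinder {Ω : Set (Space n)} (hΩ : IsOpen Ω) : IsOpen (cylinder Ω) :=
  hΩ.preimage continuous_xPart

/-- The linear map `v ↦ (v, A v)`, the differential of `x ↦ (x, u(x))` when `A = Du(x)`. -/
def graphLin (A : Space n →L[ℝ] Space n) : Space n →L[ℝ] Prd n := xEmb n + (yEmb n).comp A

theorem graphLin_apply (A : Space n →L[ℝ] Space n) (v : Space n) :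
    graphLin A v = pt v (A v) := by
  rw [pt_eq_add]; rfl

theorem norm_le_norm_graphLin (A : Space n →L[ℝ] Space n) (v : Space n) :
    ‖v‖ ≤ ‖graphLin A v‖ := by
  rw [graphLin_apply]; exact norm_le_norm_pt_left _ _

/-- The vectors `(eᵢ, A eᵢ)`. -/
def tangents (A : Space n →L[ℝ] Space n) (i : Fin n) : Prd n := pt (stdVec i) (A (stdVec i))

theorem graphTangent_eq (u : Space n → Space n) (x : Space n) :
    graphTangent u x = tangents (approxDeriv u x) := rfl

/-! ### Forms evaluated on graph tangents -/

/-- The linear map with a given matrix in the standard basis. -/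
def matCLM (M : Matrix (Fin n) (Fin n) ℝ) : Space n →L[ℝ] Space n :=
  Matrix.toEuclideanCLM (𝕜 := ℝ) M

theorem matCLM_stdVec (M : Matrix (Fin n) (Fin n) ℝ) (i j : Fin n) :
    matCLM M (stdVec i) j = M j i := by
  simp [matCLM, Matrix.ofLp_toEuclideanCLM]

theorem det_matCLM (M : Matrix (Fin n) (Fin n) ℝ) : (matCLM M).det = M.det := by
  rw [ContinuousLinearMap.det]
  have : ((matCLM M : Space n →L[ℝ] Space n) : Space n →ₗ[ℝ] Space n)
      = Matrix.toLin (EuclideanSpace.basisFun (Fin n) ℝ).toBasis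
        (EuclideanSpace.basisFun (Fin n) ℝ).toBasis M := by
    apply (EuclideanSpace.basisFun (Fin n) ℝ).toBasis.ext
    intro i
    ext j
    rw [Matrix.toLin_self]
    simp [matCLM, Matrix.ofLp_toEuclideanCLM, Pi.single_apply]
  rw [this, LinearMap.det_toLin]

/-- An `n`-form on the vertical vectors `(0, A eᵢ)` only sees the determinant of `A`. -/
theorem form_vertical_eq_det_mul (θ : Prd n [⋀^Fin n]→L[ℝ] ℝ) (A : Space n →L[ℝ] Space n) :
    θ (fun i => pt 0 (A (stdVec i))) = A.det * θ (fun i => pt 0 (stdVec i)) := by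
  let e := (EuclideanSpace.basisFun (Fin n) ℝ).toBasis
  let g := (θ.compContinuousLinearMap (yEmb n)).toAlternatingMap
  have h1 := g.eq_smul_basis_det e
  have he : ∀ i, e i = stdVec i := fun i => by simp [e]
  have h2 : g (fun i => A (stdVec i)) = A.det * g e := by
    rw [h1]
    simp only [AlternatingMap.smul_apply, smul_eq_mul, Module.Basis.det_self, mul_one]
    have : (fun i => A (stdVec i)) = ⇑(A : Space n →ₗ[ℝ] Space n) ∘ e := by
      funext i; simp [he]
    rw [this, Module.Basis.det_comp, Module.Basis.det_self, mul_one, mul_comm]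
  have h3 : (e : Fin n → Space n) = fun i => stdVec i := funext he
  rw [h3] at h2
  exact h2

/-- Expanding `θ((eᵢ + A eᵢ)ᵢ)` by multilinearity, each term other than the purely vertical one
has at most `m` factors `A eᵢ`. -/
theorem abs_form_tangents_sub_le {m : ℕ} (θ : Prd (m + 1) [⋀^Fin (m + 1)]→L[ℝ] ℝ)
    (A : Space (m + 1) →L[ℝ] Space (m + 1)) :
    |θ (tangents A) - A.det * θ (fun i => pt 0 (stdVec i))|
      ≤ 2 ^ (m + 1) * ‖θ‖ * (1 + ‖A‖) ^ m := by
  classical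
  rw [← form_vertical_eq_det_mul]
  set a : Fin (m + 1) → Prd (m + 1) := fun i => pt (stdVec i) 0
  set b : Fin (m + 1) → Prd (m + 1) := fun i => pt 0 (A (stdVec i))
  have hab : tangents A = a + b := by
    funext i; exact pt_eq_add _ _
  have hexp : θ (a + b) = ∑ S : Finset (Fin (m + 1)), θ (S.piecewise a b) :=
    θ.toMultilinearMap.map_add_univ a b
  rw [hab, hexp, ← Finset.sum_erase_add _ _ (Finset.mem_univ (∅ : Finset (Fin (m + 1)))),
    Finset.piecewise_empty, add_sub_cancel_right]
  have h1 : (1 : ℝ) ≤ 1 + ‖A‖ := by linarith [norm_nonneg A]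
  have ha : ∀ i, ‖a i‖ ≤ 1 := fun i => by
    simp [a, norm_pt_zero_right]
  have hb : ∀ i, ‖b i‖ ≤ 1 + ‖A‖ := fun i => by
    simp only [b, norm_pt_zero_left]
    refine (A.le_opNorm _).trans ?_
    simp
  refine (Finset.abs_sum_le_sum_abs _ _).trans ?_
  have key : ∀ S ∈ Finset.univ.erase (∅ : Finset (Fin (m + 1))),
      |θ (S.piecewise a b)| ≤ ‖θ‖ * (1 + ‖A‖) ^ m := by
    intro S hS
    obtain ⟨k, hk⟩ := Finset.nonempty_iff_ne_empty.2 (Finset.ne_of_mem_erase hS)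
    refine (θ.le_opNorm _).trans (mul_le_mul_of_nonneg_left ?_ (norm_nonneg _))
    rw [← Finset.mul_prod_erase _ _ (Finset.mem_univ k)]
    have hk1 : ‖S.piecewise a b k‖ ≤ 1 := by
      rw [Finset.piecewise_eq_of_mem _ _ _ hk]; exact ha k
    have hrest : ∏ i ∈ Finset.univ.erase k, ‖S.piecewise a b i‖ ≤ (1 + ‖A‖) ^ m := by
      have hc : (Finset.univ.erase k : Finset (Fin (m + 1))).card = m := by
        simp [Finset.card_erase_of_mem]
      refine (Finset.prod_le_prod (g := fun _ => 1 + ‖A‖) (fun _ _ => norm_nonneg _)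
        fun i _ => ?_).trans_eq (by rw [Finset.prod_const, hc])
      by_cases hi : i ∈ S
      · rw [Finset.piecewise_eq_of_mem _ _ _ hi]; exact (ha i).trans h1
      · rw [Finset.piecewise_eq_of_notMem _ _ _ hi]; exact hb i
    calc _ ≤ 1 * (1 + ‖A‖) ^ m :=
          mul_le_mul hk1 hrest (Finset.prod_nonneg fun _ _ => norm_nonneg _) zero_le_one
      _ = _ := one_mul _
  refine (Finset.sum_le_sum key).trans ?_
  rw [Finset.sum_const, nsmul_eq_mul, mul_assoc]
  gcongr
  have : (Finset.univ.erase (∅ : Finset (Fin (m + 1)))).card ≤ 2 ^ (m + 1) := by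
    refine (Finset.card_erase_le).trans ?_
    simp
  exact_mod_cast this

/-! ### The exterior derivative of a vertical form -/

variable {m : ℕ}

theorem dyHat_apply (j : Fin (m + 1)) (v : Fin m → Prd (m + 1)) :
    dyHat j v = Matrix.det (Matrix.of fun a b => v a (Sum.inr (j.succAbove b))) := rfl

theorem hasFDerivAt_verticalForm {f : Prd (m + 1) → Space (m + 1)} {p : Prd (m + 1)}
    (hf : DifferentiableAt ℝ f p) :
    HasFDerivAt (verticalForm f)
      (∑ j : Fin (m + 1), ((-1 : ℝ) ^ (j : ℕ) •
        ((EuclideanSpace.proj j : Space (m + 1) →L[ℝ] ℝ).comp (fderiv ℝ f p))).smulRight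
          (dyHat j)) p := by
  unfold verticalForm
  refine HasFDerivAt.fun_sum fun j _ => ?_
  refine HasFDerivAt.smul_const ?_ (dyHat j)
  refine HasFDerivAt.const_mul ?_ _
  exact (EuclideanSpace.proj j : Space (m + 1) →L[ℝ] ℝ).hasFDerivAt.comp p hf.hasFDerivAt

theorem dyHat_removeNth_tangents (M : Matrix (Fin (m + 1)) (Fin (m + 1)) ℝ)
    (i j : Fin (m + 1)) :
    (-1 : ℝ) ^ (i : ℕ) * ((-1) ^ (j : ℕ) * dyHat j (i.removeNth (tangents (matCLM M))))
      = cof M j i := by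
  rw [cof, Matrix.transpose_apply, Matrix.adjugate_fin_succ_eq_det_submatrix, dyHat_apply,
    ← Matrix.det_transpose, ← mul_assoc, ← pow_add, add_comm (i : ℕ)]
  congr 2
  ext a b
  simp [Fin.removeNth, tangents, matCLM_stdVec]

/-- The integrand of `E_u(f)` is `dω_f` evaluated on the tangent vectors of the graph. -/
theorem extDeriv_verticalForm_tangents {f : Prd (m + 1) → Space (m + 1)}
    (u : Space (m + 1) → Space (m + 1))
    (Du : Space (m + 1) → Matrix (Fin (m + 1)) (Fin (m + 1)) ℝ) (x : Space (m + 1))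
    (hf : DifferentiableAt ℝ f (pt x (u x))) :
    extDeriv (verticalForm f) (pt x (u x)) (tangents (matCLM (Du x)))
      = energyDensity u Du f x := by
  have hd := hasFDerivAt_verticalForm hf
  rw [extDeriv, ContinuousAlternatingMap.alternatizeUncurryFin_apply, hd.fderiv]
  set p := pt x (u x)
  set M := Du x with hM
  have hv : ∀ i j, fderiv ℝ f p (tangents (matCLM M) i) j
      = gradX f p j i + ∑ k, fderiv ℝ f p (pt 0 (stdVec k)) j * M k i := by
    intro i j
    rw [tangents, pt_eq_add, map_add, PiLp.add_apply]
    congr 1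
    have h0 : (pt 0 (matCLM M (stdVec i)) : Prd (m + 1))
        = ∑ k, M k i • (pt 0 (stdVec k) : Prd (m + 1)) := by
      ext (a | a)
      · simp
      · simp only [pt_inr, matCLM_stdVec, PiLp.smul_apply, WithLp.ofLp_sum, Finset.sum_apply,
          smul_eq_mul]
        rw [Finset.sum_eq_single a]
        · simp
        · intro b _ hb; simp [hb.symm]
        · simp
    rw [h0, map_sum]
    simp [map_smul, mul_comm]
  have hterm : ∀ i : Fin (m + 1), (-1 : ℤ) ^ (i : ℕ) •
      ((∑ j : Fin (m + 1), ((-1 : ℝ) ^ (j : ℕ) •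
        ((EuclideanSpace.proj j : Space (m + 1) →L[ℝ] ℝ).comp (fderiv ℝ f p))).smulRight
          (dyHat j)) (tangents (matCLM M) i)) (i.removeNth (tangents (matCLM M)))
      = ∑ j, (gradX f p j i * cof M j i
          + ∑ k, fderiv ℝ f p (pt 0 (stdVec k)) j * (M k i * cof M j i)) := by
    intro i
    have : ∀ y : ℝ, (-1 : ℤ) ^ (i : ℕ) • y = (-1 : ℝ) ^ (i : ℕ) * y := by
      intro y; simp [zsmul_eq_mul]
    rw [this]
    simp only [_root_.sum_apply, ContinuousLinearMap.smulRight_apply,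
      ContinuousAlternatingMap.sum_apply, ContinuousAlternatingMap.smul_apply,
      _root_.smul_apply, ContinuousLinearMap.comp_apply, PiLp.proj_apply,
      Finset.mul_sum, smul_eq_mul]
    refine Finset.sum_congr rfl fun j _ => ?_
    rw [← dyHat_removeNth_tangents M i j, hv]
    simp only [add_mul, mul_add, Finset.sum_mul, Finset.mul_sum]
    congr 1
    · ring
    · exact Finset.sum_congr rfl fun k _ => by ring
  rw [Finset.sum_congr rfl fun i _ => hterm i, energyDensity]
  simp only [Finset.sum_add_distrib]
  congr 1
  · exact Finset.sum_comm
  · have hadj : ∀ k j, ∑ i, M k i * cof M j i = if k = j then M.det else 0 := by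
      intro k j
      have := congrFun (congrFun (Matrix.mul_adjugate M) k) j
      simpa [Matrix.mul_apply, cof, Matrix.one_apply] using this
    rw [Finset.sum_comm, divY, Finset.sum_mul]
    refine Finset.sum_congr rfl fun j _ => ?_
    rw [Finset.sum_comm]
    simp_rw [← Finset.mul_sum, hadj]
    simp [p, hM]

end

section

variable {n : ℕ}

/-! ### The area formula for graphs -/

open scoped NNReal in
/-- If `f` spreads the points of `s` at most `K` times as far apart as `g` does, then `f '' s` is a
`K`-Lipschitz image of `g '' s`. -/
theorem euclideanHausdorffMeasure_image_le {X Y Z : Type*} [EMetricSpace Y] [EMetricSpace Z]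
    [MeasurableSpace Y] [BorelSpace Y] [MeasurableSpace Z] [BorelSpace Z] [Nonempty X]
    (d : ℕ) {f : X → Z} {g : X → Y} {s : Set X} {K : ℝ≥0}
    (h : ∀ x ∈ s, ∀ y ∈ s, edist (f x) (f y) ≤ K * edist (g x) (g y)) :
    Measure.euclideanHausdorffMeasure d (f '' s)
      ≤ (K : ℝ≥0∞) ^ d * Measure.euclideanHausdorffMeasure d (g '' s) := by
  set k : Y → Z := fun y => f (Function.invFunOn g s y)
  have hk : ∀ x ∈ s, k (g x) = f x := by
    intro x hx
    have h1 := Function.invFunOn_mem (f := g) ⟨x, hx, rfl⟩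
    have h2 := Function.invFunOn_eq (f := g) ⟨x, hx, rfl⟩
    have := h _ h1 _ hx
    rw [h2, edist_self, mul_zero, nonpos_iff_eq_zero, edist_eq_zero] at this
    exact this
  have hL : LipschitzOnWith K k (g '' s) := by
    rintro _ ⟨x, hx, rfl⟩ _ ⟨y, hy, rfl⟩
    rw [hk x hx, hk y hy]
    exact h x hx y hy
  have himg : f '' s = k '' (g '' s) := by
    rw [Set.image_image]
    exact Set.image_congr fun x hx => (hk x hx).symm
  rw [himg, Measure.euclideanHausdorffMeasure_def, Measure.euclideanHausdorffMeasure_def,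
    Measure.smul_apply, Measure.smul_apply, ENNReal.smul_def, ENNReal.smul_def, smul_eq_mul,
    smul_eq_mul, mul_left_comm]
  gcongr
  have := hL.hausdorffMeasure_image_le (d := (d : ℝ)) (Nat.cast_nonneg d)
  rwa [ENNReal.rpow_natCast] at this

/-- The Jacobian of `x ↦ (x, A x)`. -/
def jac (A : Space n →L[ℝ] Space n) : ℝ := simpleVectorNorm (tangents A)

theorem gram_tangents_apply (A : Space n →L[ℝ] Space n) (i j : Fin n) :
    Matrix.gram ℝ (tangents A) i j
      = (if i = j then 1 else 0) + inner ℝ (A (stdVec i)) (A (stdVec j)) := by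
  rw [Matrix.gram_apply, tangents, tangents, inner_pt]
  congr 1
  simp [EuclideanSpace.inner_single_left]

theorem continuous_jac : Continuous (jac (n := n)) := by
  unfold jac simpleVectorNorm
  refine Real.continuous_sqrt.comp (Continuous.matrix_det ?_)
  refine continuous_matrix fun i j => ?_
  simp_rw [gram_tangents_apply]
  fun_prop

/-- The range of `v ↦ (v, A v)` is isometric to `ℝⁿ`, so this map is a linear isometry after a
linear map of `ℝⁿ`. -/
theorem exists_isometry_comp_eq_graphLin (A : Space n →L[ℝ] Space n) :
    ∃ (S : Space n →ₗ[ℝ] Space n) (ι : Space n →ₗᵢ[ℝ] Prd n), ∀ v, ι (S v) = graphLin A v := by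
  set L : Space n →ₗ[ℝ] Prd n := (graphLin A : Space n →ₗ[ℝ] Prd n) with hLdef
  have hinj : Function.Injective L := by
    refine (injective_iff_map_eq_zero L).2 fun v hv => ?_
    have := norm_le_norm_graphLin A v
    rw [show graphLin A v = 0 from hv, norm_zero] at this
    exact norm_le_zero_iff.1 this
  have hrank : Module.finrank ℝ (LinearMap.range L) = n := by
    rw [LinearMap.finrank_range_of_inj hinj]; simp
  let φ : LinearMap.range L ≃ₗᵢ[ℝ] Space n :=
    ((stdOrthonormalBasis ℝ (LinearMap.range L)).reindex (finCongr hrank)).repr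
  let S : Space n →ₗ[ℝ] Space n := φ.toLinearEquiv.toLinearMap ∘ₗ L.rangeRestrict
  let ι : Space n →ₗᵢ[ℝ] Prd n := (LinearMap.range L).subtypeₗᵢ.comp φ.symm.toLinearIsometry
  refine ⟨S, ι, fun v => ?_⟩
  simp [ι, S, hLdef]

/-- The area formula for the linear map `v ↦ (v, A v)`: it is a linear isometry after a linear map
`S` of `ℝⁿ`, and `(det S)²` is the Gram determinant. -/
theorem euclideanHausdorffMeasure_image_graphLin (A : Space n →L[ℝ] Space n) (s : Set (Space n)) :
    Measure.euclideanHausdorffMeasure n (graphLin A '' s) = ENNReal.ofReal (jac A) * volume s := by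
  obtain ⟨S, ι, hιS⟩ := exists_isometry_comp_eq_graphLin A
  have himg : graphLin A '' s = ι '' (S '' s) := by
    rw [Set.image_image]
    exact Set.image_congr fun x _ => (hιS x).symm
  rw [himg, ι.isometry.euclideanHausdorffMeasure_image,
    EuclideanSpace.euclideanHausdorffMeasure_eq_volume, Measure.addHaar_image_linearMap]
  congr 2
  have hdet : LinearMap.det S ^ 2 = (Matrix.gram ℝ (tangents A)).det := by
    let e := EuclideanSpace.basisFun (Fin n) ℝ
    have h1 : Matrix.gram ℝ (tangents A)
        = (LinearMap.toMatrix e.toBasis e.toBasis S).transpose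
          * LinearMap.toMatrix e.toBasis e.toBasis S := by
      ext i j
      have h2 : ∀ i, tangents A i = ι (S (stdVec i)) := fun i => by
        rw [hιS, graphLin_apply]; rfl
      rw [Matrix.gram_apply, h2, h2, ι.inner_map_map, Matrix.mul_apply, PiLp.inner_apply]
      refine Finset.sum_congr rfl fun k _ => ?_
      have h3 : ∀ i, LinearMap.toMatrix e.toBasis e.toBasis S k i = S (stdVec i) k := fun i => by
        rw [LinearMap.toMatrix_apply]; simp [e]
      rw [Matrix.transpose_apply, h3, h3]
      simp [mul_comm]
    rw [h1, Matrix.det_mul, Matrix.det_transpose, LinearMap.det_toMatrix, sq]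
  rw [jac, simpleVectorNorm, ← hdet, Real.sqrt_sq_eq_abs]

theorem one_le_jac (A : Space n →L[ℝ] Space n) : 1 ≤ jac A := by
  have h1 := euclideanHausdorffMeasure_image_graphLin A (Metric.ball 0 1)
  have h2 := euclideanHausdorffMeasure_image_le n (f := id) (g := graphLin A)
    (s := Metric.ball 0 1) (K := 1) fun x _ y _ => by
      rw [ENNReal.coe_one, one_mul, edist_dist, edist_dist, dist_eq_norm, dist_eq_norm,
        ← map_sub, id, id]
      exact ENNReal.ofReal_le_ofReal (norm_le_norm_graphLin A _)
  rw [h1, Set.image_id, EuclideanSpace.euclideanHausdorffMeasure_eq_volume, ENNReal.coe_one,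
    one_pow, one_mul] at h2
  have h0 : volume (Metric.ball (0 : Space n) 1) ≠ 0 := (Metric.measure_ball_pos _ _ one_pos).ne'
  have h3 : volume (Metric.ball (0 : Space n) 1) ≠ ⊤ := measure_ball_lt_top.ne
  by_contra hlt
  push Not at hlt
  refine absurd h2 (not_le.2 ?_)
  calc _ < 1 * volume (Metric.ball (0 : Space n) 1) :=
        ENNReal.mul_lt_mul_left h0 h3 (by
          rw [← ENNReal.ofReal_one]; exact (ENNReal.ofReal_lt_ofReal_iff one_pos).2 hlt)
    _ = _ := one_mul _

theorem jac_pos (A : Space n →L[ℝ] Space n) : 0 < jac A := one_pos.trans_le (one_le_jac A)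

/-- The image of a set under `x ↦ (x, g(x))`. -/
def graphOver (g : Space n → Space n) (s : Set (Space n)) : Set (Prd n) :=
  (fun x => pt x (g x)) '' s

theorem graphOver_eq (g : Space n → Space n) (s : Set (Space n)) :
    graphOver g s = {p | xPart p ∈ s ∧ yPart p = g (xPart p)} := by
  ext p
  constructor
  · rintro ⟨x, hx, rfl⟩
    exact ⟨hx, rfl⟩
  · rintro ⟨h1, h2⟩
    exact ⟨xPart p, h1, by simp only [← h2, pt_xPart_yPart]⟩

theorem measurableSet_graphOver {g : Space n → Space n} (hg : Measurable g) {s : Set (Space n)}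
    (hs : MeasurableSet s) : MeasurableSet (graphOver g s) := by
  rw [graphOver_eq]
  exact (continuous_xPart.measurable hs).inter
    (measurableSet_eq_fun continuous_yPart.measurable (hg.comp continuous_xPart.measurable))

theorem measurable_graph {g : Space n → Space n} (hg : Measurable g) :
    Measurable fun x => pt x (g x) :=
  continuous_pt.measurable.comp (measurable_id.prodMk hg)

open scoped NNReal in
/-- The graph of a Lipschitz function over a Lebesgue null set is `𝓗ⁿ`-null. -/
theorem euclideanHausdorffMeasure_graphOver_eq_zero {g : Space n → Space n} {s : Set (Space n)}
    {K : ℝ≥0} (hg : LipschitzOnWith K g s) (hs : volume s = 0) :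
    Measure.euclideanHausdorffMeasure n (graphOver g s) = 0 := by
  have h := euclideanHausdorffMeasure_image_le n (f := fun x => pt x (g x)) (g := id)
    (s := s) (K := 1 + K) fun x hx y hy => by
      have h1 := hg.dist_le_mul x hx y hy
      rw [id, id, edist_dist, edist_dist, ← ENNReal.ofReal_coe_nnreal,
        ← ENNReal.ofReal_mul (NNReal.coe_nonneg _)]
      refine ENNReal.ofReal_le_ofReal ?_
      rw [dist_eq_norm, pt_sub_pt]
      refine (norm_pt_le _ _).trans ?_
      rw [dist_eq_norm] at h1
      push_cast
      rw [add_mul, one_mul, dist_eq_norm]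
      gcongr
      simpa [dist_eq_norm] using h1
  rw [Set.image_id, EuclideanSpace.euclideanHausdorffMeasure_eq_volume, hs, mul_zero] at h
  exact le_antisymm h zero_le

open scoped NNReal in
theorem euclideanHausdorffMeasure_graphOver_bounds {g : Space n → Space n}
    {A : Space n →L[ℝ] Space n} {s : Set (Space n)} {c : ℝ≥0} (hc : c < 1)
    (h : ApproximatesLinearOn g A s c) :
    Measure.euclideanHausdorffMeasure n (graphOver g s)
        ≤ ((1 + c : ℝ≥0) : ℝ≥0∞) ^ n * (ENNReal.ofReal (jac A) * volume s) ∧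
      ENNReal.ofReal (jac A) * volume s
        ≤ (((1 - c)⁻¹ : ℝ≥0) : ℝ≥0∞) ^ n * Measure.euclideanHausdorffMeasure n (graphOver g s) := by
  have key : ∀ x ∈ s, ∀ y ∈ s,
      ‖(pt x (g x) - pt y (g y)) - (graphLin A x - graphLin A y)‖
        ≤ c * ‖graphLin A x - graphLin A y‖ := by
    intro x hx y hy
    have h1 := h x hx y hy
    have h2 : (pt x (g x) - pt y (g y)) - (graphLin A x - graphLin A y)
        = pt 0 (g x - g y - A (x - y)) := by
      rw [← map_sub, graphLin_apply, pt_sub_pt, pt_sub_pt, sub_self]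
    rw [h2, norm_pt_zero_left, ← map_sub]
    exact h1.trans (by gcongr; exact norm_le_norm_graphLin A _)
  rw [← euclideanHausdorffMeasure_image_graphLin]
  have hc1 : (0 : ℝ) < 1 - c := by
    have : (c : ℝ) < 1 := by exact_mod_cast hc
    linarith
  constructor
  · refine euclideanHausdorffMeasure_image_le n fun x hx y hy => ?_
    rw [edist_dist, edist_dist, ← ENNReal.ofReal_coe_nnreal,
        ← ENNReal.ofReal_mul (NNReal.coe_nonneg _), dist_eq_norm, dist_eq_norm]
    refine ENNReal.ofReal_le_ofReal ?_
    have h1 := key x hx y hy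
    have h2 := norm_le_insert' (pt x (g x) - pt y (g y)) (graphLin A x - graphLin A y)
    push_cast
    linarith
  · refine euclideanHausdorffMeasure_image_le n fun x hx y hy => ?_
    rw [edist_dist, edist_dist, ← ENNReal.ofReal_coe_nnreal,
        ← ENNReal.ofReal_mul (NNReal.coe_nonneg _), dist_eq_norm, dist_eq_norm]
    refine ENNReal.ofReal_le_ofReal ?_
    have h1 := key x hx y hy
    have h2 := norm_le_insert (pt x (g x) - pt y (g y)) (graphLin A x - graphLin A y)
    rw [NNReal.coe_inv, NNReal.coe_sub hc.le, NNReal.coe_one, inv_mul_eq_div, le_div_iff₀ hc1]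
    linarith

open scoped NNReal in
/-- For every `t > 1` all distortions in the area formula stay below `t` on sets where `g` is close
enough to a linear map. -/
theorem exists_delta_jac (A : Space n →L[ℝ] Space n) {t : ℝ≥0} (ht : 1 < t) :
    ∃ c : ℝ≥0, c ≠ 0 ∧ c < 1 ∧ (1 + c) ^ n ≤ t ∧ ((1 - c)⁻¹) ^ n ≤ t ∧
      ∀ B : Space n →L[ℝ] Space n, ‖B - A‖₊ ≤ c → jac B ≤ t * jac A ∧ jac A ≤ t * jac B := by
  have htR : (1 : ℝ) < t := by exact_mod_cast ht
  have hJ : ∀ᶠ B in 𝓝 A, jac B < t * jac A ∧ jac A < t * jac B := by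
    refine Eventually.and ?_ ?_
    · exact continuous_jac.continuousAt.eventually_lt continuousAt_const
        (by nlinarith [jac_pos A])
    · exact continuousAt_const.eventually_lt (continuous_const.mul continuous_jac).continuousAt
        (by nlinarith [jac_pos A])
  obtain ⟨ε, hε, hB⟩ := Metric.eventually_nhds_iff.1 hJ
  have h1 : ∀ᶠ c : ℝ≥0 in 𝓝 0, (1 + c) ^ n < t := by
    have : ContinuousAt (fun c : ℝ≥0 => (1 + c) ^ n) 0 := by fun_prop
    exact this.eventually_lt continuousAt_const (by simpa using ht)
  have h2 : ∀ᶠ c : ℝ≥0 in 𝓝 0, ((1 - c)⁻¹) ^ n < t := by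
    have : ContinuousAt (fun c : ℝ≥0 => ((1 - c)⁻¹) ^ n) 0 := by
      refine ContinuousAt.pow (ContinuousAt.inv₀ ?_ (by simp)) n
      exact (continuous_const.sub continuous_id).continuousAt
    exact this.eventually_lt continuousAt_const (by simpa using ht)
  have h3 : ∀ᶠ c : ℝ≥0 in 𝓝 0, c < 1 := Iio_mem_nhds one_pos
  have h4 : ∀ᶠ c : ℝ≥0 in 𝓝 0, c < ε.toNNReal := Iio_mem_nhds (by simpa using hε)
  have h5 := ((h1.and h2).and (h3.and h4)).filter_mono (nhdsWithin_le_nhds (s := Set.Ioi 0))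
  obtain ⟨c, ⟨⟨c1, c2⟩, c3, c4⟩, c5⟩ := (h5.and self_mem_nhdsWithin).exists
  refine ⟨c, ne_of_gt c5, c3, c1.le, c2.le, fun B hBA => ?_⟩
  have : dist B A < ε := by
    rw [dist_eq_norm]
    calc ‖B - A‖ ≤ c := hBA
      _ < ε.toNNReal := by exact_mod_cast c4
      _ = ε := Real.coe_toNNReal _ hε.le
  exact ⟨(hB this).1.le, (hB this).2.le⟩

open scoped NNReal in
/-- The area formula up to the factor `t²`: `s` is cut into countably many pieces on which `g` is
close to a linear map, one factor `t` accounts for the distortion on a piece and the other for the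
oscillation of the Jacobian. -/
theorem graphOver_area_aux {g : Space n → Space n} (hg : Measurable g) {s : Set (Space n)}
    (hs : MeasurableSet s) {g' : Space n → Space n →L[ℝ] Space n}
    (hg' : ∀ x ∈ s, HasFDerivWithinAt g (g' x) s x) {t : ℝ≥0} (ht : 1 < t) :
    Measure.euclideanHausdorffMeasure n (graphOver g s)
        ≤ ((t * t : ℝ≥0) : ℝ≥0∞) * ∫⁻ x in s, ENNReal.ofReal (jac (g' x)) ∧
      ∫⁻ x in s, ENNReal.ofReal (jac (g' x))
        ≤ ((t * t : ℝ≥0) : ℝ≥0∞) * Measure.euclideanHausdorffMeasure n (graphOver g s) := by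
  choose c hc0 hc1 hct hct' hcJ using fun A : Space n →L[ℝ] Space n => exists_delta_jac A ht
  obtain ⟨T, A, hTd, hTm, hTs, hTA, -⟩ :=
    exists_partition_approximatesLinearOn_of_hasFDerivWithinAt g s g' hg' c hc0
  have hsT : s = ⋃ k, s ∩ T k := by
    rw [← Set.inter_iUnion, Set.inter_eq_self_of_subset_left hTs]
  have hdisj : Pairwise (Function.onFun Disjoint fun k => s ∩ T k) :=
    fun i j hij => (hTd hij).mono Set.inter_subset_right Set.inter_subset_right
  have hmeas : ∀ k, MeasurableSet (s ∩ T k) := fun k => hs.inter (hTm k)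
  have hint : ∫⁻ x in s, ENNReal.ofReal (jac (g' x))
      = ∑' k, ∫⁻ x in s ∩ T k, ENNReal.ofReal (jac (g' x)) := by
    conv_lhs => rw [hsT]
    exact lintegral_iUnion hmeas hdisj _
  have hH : Measure.euclideanHausdorffMeasure n (graphOver g s)
      = ∑' k, Measure.euclideanHausdorffMeasure n (graphOver g (s ∩ T k)) := by
    have : graphOver g s = ⋃ k, graphOver g (s ∩ T k) := by
      conv_lhs => rw [hsT]
      exact Set.image_iUnion
    rw [this]
    refine measure_iUnion (fun i j hij => ?_) fun k => measurableSet_graphOver hg (hmeas k)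
    have := hdisj hij
    rw [Function.onFun, Set.disjoint_left] at this ⊢
    intro p hp hp'
    rw [graphOver_eq] at hp hp'
    exact this hp.1 hp'.1
  have hclose : ∀ k, ∀ᵐ x ∂volume.restrict (s ∩ T k), ‖g' x - A k‖₊ ≤ c (A k) := fun k =>
    (hTA k).norm_fderiv_sub_le volume (hmeas k) g' fun x hx =>
      (hg' x hx.1).mono Set.inter_subset_left
  have hconst : ∀ k, ENNReal.ofReal (jac (A k)) * volume (s ∩ T k)
      = ∫⁻ _ in s ∩ T k, ENNReal.ofReal (jac (A k)) := fun k => by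
    rw [setLIntegral_const]
  have ht0 : (t : ℝ≥0∞) ≠ ⊤ := ENNReal.coe_ne_top
  have hmulJ : ∀ B : Space n →L[ℝ] Space n,
      (t : ℝ≥0∞) * ENNReal.ofReal (jac B) = ENNReal.ofReal (t * jac B) := fun B => by
    rw [ENNReal.ofReal_mul (NNReal.coe_nonneg _), ENNReal.ofReal_coe_nnreal]
  have hup : ∀ k, ENNReal.ofReal (jac (A k)) * volume (s ∩ T k)
      ≤ t * ∫⁻ x in s ∩ T k, ENNReal.ofReal (jac (g' x)) := fun k => by
    rw [hconst, ← lintegral_const_mul' _ _ ht0]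
    refine lintegral_mono_ae ?_
    filter_upwards [hclose k] with x hx
    rw [hmulJ]
    exact ENNReal.ofReal_le_ofReal (hcJ _ _ hx).2
  have hlow : ∀ k, ∫⁻ x in s ∩ T k, ENNReal.ofReal (jac (g' x))
      ≤ t * (ENNReal.ofReal (jac (A k)) * volume (s ∩ T k)) := fun k => by
    rw [hconst, ← lintegral_const_mul' _ _ ht0]
    refine lintegral_mono_ae ?_
    filter_upwards [hclose k] with x hx
    rw [hmulJ]
    exact ENNReal.ofReal_le_ofReal (hcJ _ _ hx).1
  constructor
  · rw [hH, hint, ← ENNReal.tsum_mul_left]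
    refine ENNReal.tsum_le_tsum fun k => ?_
    refine (euclideanHausdorffMeasure_graphOver_bounds (hc1 _) (hTA k)).1.trans ?_
    rw [ENNReal.coe_mul, mul_assoc]
    exact mul_le_mul' (by exact_mod_cast hct (A k)) (hup k)
  · rw [hH, hint, ← ENNReal.tsum_mul_left]
    refine ENNReal.tsum_le_tsum fun k => ?_
    refine (hlow k).trans ?_
    rw [ENNReal.coe_mul, mul_assoc]
    refine mul_le_mul' le_rfl ?_
    refine (euclideanHausdorffMeasure_graphOver_bounds (hc1 _) (hTA k)).2.trans ?_
    exact mul_le_mul' (by exact_mod_cast hct' (A k)) le_rfl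

theorem le_of_forall_le_sq_mul {a b : ℝ≥0∞}
    (h : ∀ t : NNReal, 1 < t → a ≤ ((t * t : NNReal) : ℝ≥0∞) * b) : a ≤ b := by
  have h1 : Tendsto (fun t : NNReal => ((t * t : NNReal) : ℝ≥0∞) * b) (𝓝[>] 1)
      (𝓝 (((1 * 1 : NNReal) : ℝ≥0∞) * b)) := by
    refine ENNReal.Tendsto.mul_const ?_ (Or.inl (by simp))
    refine (ENNReal.tendsto_coe.2 ?_).mono_left nhdsWithin_le_nhds
    exact (continuous_id.mul continuous_id).tendsto 1
  rw [mul_one, ENNReal.coe_one, one_mul] at h1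
  exact ge_of_tendsto h1 (eventually_nhdsWithin_of_forall fun t ht => h t ht)

/-- The area formula for the graph of a function that is differentiable along a measurable set. -/
theorem euclideanHausdorffMeasure_graphOver {g : Space n → Space n} (hg : Measurable g)
    {s : Set (Space n)} (hs : MeasurableSet s) {g' : Space n → Space n →L[ℝ] Space n}
    (hg' : ∀ x ∈ s, HasFDerivWithinAt g (g' x) s x) :
    Measure.euclideanHausdorffMeasure n (graphOver g s)
      = ∫⁻ x in s, ENNReal.ofReal (jac (g' x)) :=
  le_antisymm (le_of_forall_le_sq_mul fun _ ht => (graphOver_area_aux hg hs hg' ht).1)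
    (le_of_forall_le_sq_mul fun _ ht => (graphOver_area_aux hg hs hg' ht).2)

end

section

variable {n : ℕ}

/-! ### Approximate differentiability -/

theorem volume_ball_mul (x z : Space n) {a r : ℝ} (ha : 0 < a) :
    volume (Metric.ball z (a * r)) = ENNReal.ofReal (a ^ n) * volume (Metric.ball x r) := by
  rw [Measure.addHaar_ball_mul_of_pos _ _ ha, finrank_euclideanSpace_fin,
    Measure.addHaar_ball_center volume x r]

theorem volume_ball_ne_zero (x : Space n) {r : ℝ} (hr : 0 < r) :
    volume (Metric.ball x r) ≠ 0 := (Metric.measure_ball_pos _ _ hr).ne'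

theorem volume_ball_ne_top (x : Space n) (r : ℝ) : volume (Metric.ball x r) ≠ ⊤ :=
  measure_ball_lt_top.ne

theorem volume_closedBall_eq (x : Space n) {r : ℝ} (hr : 0 < r) :
    volume (Metric.closedBall x r) = volume (Metric.ball x r) := by
  rw [Measure.addHaar_closedBall _ _ hr.le, Measure.addHaar_ball_of_pos _ _ hr]

/-- If the approximate differentials `L ≠ L'` both existed, one of the two exceptional sets would
contain half of a cone on which `‖(L - L') w‖ > 2 ε ‖w‖`, in measure. -/
theorem HasApproxDerivAt.unique {u : Space n → Space n} {L L' : Space n →L[ℝ] Space n}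
    {x : Space n} (h : HasApproxDerivAt u L x) (h' : HasApproxDerivAt u L' x) : L = L' := by
  by_contra hne
  obtain ⟨v, hv⟩ : ∃ v, (L - L') v ≠ 0 := by
    by_contra! hall
    exact hne (ContinuousLinearMap.ext fun v => sub_eq_zero.1 (hall v))
  have hv0 : 0 < ‖(L - L') v‖ := norm_pos_iff.2 hv
  set ε : ℝ := ‖(L - L') v‖ / (4 * (‖v‖ + 1)) with hε
  have hvn := norm_nonneg v
  have hε0 : 0 < ε := by positivity
  have hvU : 2 * ε * ‖v‖ < ‖(L - L') v‖ := by
    have : ‖(L - L') v‖ = ε * (4 * (‖v‖ + 1)) := by rw [hε]; field_simp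
    rw [this]; nlinarith
  have hU : IsOpen {w | 2 * ε * ‖w‖ < ‖(L - L') w‖} :=
    isOpen_lt (by fun_prop) (by fun_prop)
  obtain ⟨ρ, hρ, hball⟩ := Metric.isOpen_iff.1 hU v hvU
  set R := ‖v‖ + ρ with hR
  have hR0 : 0 < R := by positivity
  have hsum := (h ε hε0).add (h' ε hε0)
  rw [add_zero] at hsum
  have hc : 0 < ENNReal.ofReal ((ρ / R) ^ n) := ENNReal.ofReal_pos.2 (by positivity)
  obtain ⟨r, hlt, hr⟩ := ((hsum.eventually (Iio_mem_nhds hc)).and self_mem_nhdsWithin).exists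
  have hr : 0 < r := hr
  refine absurd hlt (not_lt.2 ?_)
  rw [← ENNReal.add_div, ENNReal.le_div_iff_mul_le (Or.inl (volume_ball_ne_zero x hr))
    (Or.inl (volume_ball_ne_top x r)), ← volume_ball_mul x (x + (r / R) • v) (by positivity)]
  refine le_trans (measure_mono ?_) (measure_union_le _ _)
  intro y hy
  have ht : 0 < r / R := by positivity
  obtain ⟨w, hw, rfl⟩ : ∃ w ∈ Metric.ball v ρ, y = x + (r / R) • w := by
    refine ⟨(r / R)⁻¹ • (y - x), ?_, ?_⟩
    · rw [mem_ball_iff_norm] at hy ⊢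
      have h1 : (r / R)⁻¹ • (y - x) - v = (r / R)⁻¹ • (y - (x + (r / R) • v)) := by
        rw [← sub_sub, smul_sub _ (y - x), smul_smul, inv_mul_cancel₀ ht.ne', one_smul]
      rw [h1, norm_smul, Real.norm_of_nonneg (inv_nonneg.2 ht.le), inv_mul_lt_iff₀ ht]
      calc _ < ρ / R * r := hy
        _ = _ := by ring
    · rw [smul_smul, mul_inv_cancel₀ ht.ne', one_smul, add_sub_cancel]
  have hwU := hball hw
  have hyx : x + (r / R) • w - x = (r / R) • w := by abel
  have hyr : x + (r / R) • w ∈ Metric.ball x r := by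
    rw [mem_ball_iff_norm, hyx, norm_smul, Real.norm_of_nonneg ht.le, div_mul_eq_mul_div,
      div_lt_iff₀ hR0]
    have : ‖w‖ < R := by
      have := norm_le_insert' w v
      rw [mem_ball_iff_norm] at hw
      linarith
    gcongr
  by_contra hcon
  rw [Set.mem_union, not_or] at hcon
  have h1 : ¬ ε * ‖x + (r / R) • w - x‖ < _ := fun hlt => hcon.1 ⟨hlt, hyr⟩
  have h2 : ¬ ε * ‖x + (r / R) • w - x‖ < _ := fun hlt => hcon.2 ⟨hlt, hyr⟩
  rw [not_lt, hyx] at h1 h2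
  have h3 : (L - L') ((r / R) • w)
      = (u (x + (r / R) • w) - u x - L' ((r / R) • w))
        - (u (x + (r / R) • w) - u x - L ((r / R) • w)) := by
    rw [_root_.sub_apply]; abel
  have h4 : ‖(L - L') ((r / R) • w)‖ ≤ 2 * ε * ‖(r / R) • w‖ := by
    rw [h3]
    exact (norm_sub_le _ _).trans (by linarith)
  rw [map_smul, norm_smul, norm_smul] at h4
  have hwU' : 2 * ε * ‖w‖ < ‖(L - L') w‖ := hwU
  have h5 : 0 < ‖r / R‖ := norm_pos_iff.2 ht.ne'
  nlinarith

theorem HasApproxDerivAt.approxDeriv_eq {u : Space n → Space n} {L : Space n →L[ℝ] Space n}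
    {x : Space n} (h : HasApproxDerivAt u L x) : approxDeriv u x = L := by
  have hex : ∃ L, HasApproxDerivAt u L x := ⟨L, h⟩
  rw [approxDeriv, dif_pos hex]
  exact hex.choose_spec.unique h

/-- A map that agrees with a differentiable map up to a set of density zero is approximately
differentiable. -/
theorem hasApproxDerivAt_of_hasFDerivAt {u g : Space n → Space n} {L : Space n →L[ℝ] Space n}
    {x : Space n} (hg : HasFDerivAt g L x) (hx : u x = g x)
    (hd : Tendsto (fun r : ℝ => volume ({y | u y ≠ g y} ∩ Metric.ball x r)
      / volume (Metric.ball x r)) (𝓝[>] 0) (𝓝 0)) : HasApproxDerivAt u L x := by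
  intro ε hε
  obtain ⟨δ, hδ, hball⟩ := Metric.eventually_nhds_iff.1 (hg.isLittleO.def hε)
  refine tendsto_of_tendsto_of_tendsto_of_le_of_le' tendsto_const_nhds hd
    (Eventually.of_forall fun _ => zero_le) ?_
  filter_upwards [mem_nhdsWithin_of_mem_nhds (Iio_mem_nhds hδ)] with r hr
  refine ENNReal.div_le_div_right (measure_mono ?_) _
  rintro y ⟨hy1, hy2⟩
  refine ⟨fun hug => ?_, hy2⟩
  have hlt : dist y x < δ := lt_trans (Metric.mem_ball.1 hy2) hr
  have := hball hlt
  rw [Set.mem_ofPred_eq, hug, hx] at hy1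
  linarith

/-- Points at which the set `{y | ‖u y - u x‖ > k ‖y - x‖}` has small relative volume in all small
balls. The threshold is half the volume of a ball of radius `r / 2` relative to one of radius `r`:
the exceptional sets of two points at distance `r` do not fill the ball of radius `r / 2` around
their midpoint. -/
def slowSet (u : Space n → Space n) (k : ℕ) : Set (Space n) :=
  {x | ∀ r : ℝ, 0 < r → r < 1 / (k + 1) →
    volume ({y | k * ‖y - x‖ < ‖u y - u x‖} ∩ Metric.ball x r)
      < ENNReal.ofReal ((1 / 2) ^ n / 2) * volume (Metric.ball x r)}

theorem HasApproxDerivAt.exists_mem_slowSet {u : Space n → Space n} {L : Space n →L[ℝ] Space n}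
    {x : Space n} (h : HasApproxDerivAt u L x) : ∃ k, x ∈ slowSet u k := by
  have hc : 0 < ENNReal.ofReal ((1 / 2) ^ n / 2) := ENNReal.ofReal_pos.2 (by positivity)
  obtain ⟨δ, hδ, hsub⟩ := Metric.mem_nhdsWithin_iff.1 ((h 1 one_pos).eventually (Iio_mem_nhds hc))
  obtain ⟨k1, hk1⟩ := exists_nat_ge (1 + ‖L‖)
  obtain ⟨k2, hk2⟩ := exists_nat_one_div_lt hδ
  refine ⟨max k1 k2, fun r hr hrk => ?_⟩
  have hrδ : r < δ := by
    refine hrk.trans (lt_of_le_of_lt ?_ hk2)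
    gcongr
    exact le_max_right _ _
  have h1 := hsub ⟨by simpa [abs_of_pos hr] using hrδ, Set.mem_Ioi.2 hr⟩
  have h2 : volume ({y | 1 * ‖y - x‖ < ‖u y - u x - L (y - x)‖} ∩ Metric.ball x r)
      / volume (Metric.ball x r) < ENNReal.ofReal ((1 / 2) ^ n / 2) := h1
  rw [ENNReal.div_lt_iff (Or.inl (volume_ball_ne_zero x hr))
    (Or.inl (volume_ball_ne_top x r))] at h2
  refine lt_of_le_of_lt (measure_mono ?_) h2
  refine Set.inter_subset_inter_left _ fun y hy => ?_
  rw [Set.mem_ofPred_eq] at hy ⊢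
  have h3 : ‖L (y - x)‖ ≤ ‖L‖ * ‖y - x‖ := L.le_opNorm _
  have h4 : ‖u y - u x‖ ≤ ‖u y - u x - L (y - x)‖ + ‖L (y - x)‖ := by
    simpa using norm_add_le (u y - u x - L (y - x)) (L (y - x))
  have h5 : (1 + ‖L‖) * ‖y - x‖ ≤ (max k1 k2 : ℕ) * ‖y - x‖ := by
    gcongr
    exact hk1.trans (by exact_mod_cast le_max_left _ _)
  linarith

/-- Two close points of `slowSet u k` have a common good neighbour near their midpoint. -/
theorem norm_sub_le_of_mem_slowSet {u : Space n → Space n} {k : ℕ} {x x' : Space n}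
    (hx : x ∈ slowSet u k) (hx' : x' ∈ slowSet u k) (hd : dist x x' < 1 / (k + 1)) :
    dist (u x) (u x') ≤ 2 * k * dist x x' := by
  rcases eq_or_ne x x' with rfl | hne
  · simp
  set d := dist x x' with hdd
  have hd0 : 0 < d := dist_pos.2 hne
  have h1 := hx d hd0 hd
  have h2 := hx' d hd0 hd
  set z := midpoint ℝ x x'
  have hzx : dist z x = 1 / 2 * d := by rw [dist_midpoint_left]; simp [hdd]
  have hzx' : dist z x' = 1 / 2 * d := by rw [dist_midpoint_right]; simp [hdd]
  have hvol : volume (Metric.ball z (1 / 2 * d))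
      = ENNReal.ofReal ((1 / 2) ^ n / 2) * volume (Metric.ball x d)
        + ENNReal.ofReal ((1 / 2) ^ n / 2) * volume (Metric.ball x' d) := by
    rw [Measure.addHaar_ball_center volume x, Measure.addHaar_ball_center volume x', ← add_mul,
      ← ENNReal.ofReal_add (by positivity) (by positivity), add_halves,
      volume_ball_mul 0 z (by norm_num)]
  have h3 := ENNReal.add_lt_add h1 h2
  rw [← hvol] at h3
  obtain ⟨y, hyz, hy⟩ : ∃ y ∈ Metric.ball z (1 / 2 * d),
      y ∉ ({y | k * ‖y - x‖ < ‖u y - u x‖} ∩ Metric.ball x d)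
        ∪ ({y | k * ‖y - x'‖ < ‖u y - u x'‖} ∩ Metric.ball x' d) := by
    by_contra! hall
    exact absurd ((measure_mono hall).trans (measure_union_le _ _)) (not_le.2 h3)
  rw [Metric.mem_ball] at hyz
  have hyx : dist y x < d := by
    have := dist_triangle y z x
    linarith
  have hyx' : dist y x' < d := by
    have := dist_triangle y z x'
    linarith
  rw [Set.mem_union, not_or] at hy
  have h4 : ¬ (k * ‖y - x‖ < ‖u y - u x‖) := fun hlt => hy.1 ⟨hlt, Metric.mem_ball.2 hyx⟩
  have h5 : ¬ (k * ‖y - x'‖ < ‖u y - u x'‖) := fun hlt => hy.2 ⟨hlt, Metric.mem_ball.2 hyx'⟩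
  rw [not_lt, ← dist_eq_norm, ← dist_eq_norm] at h4 h5
  have h6 : (k : ℝ) * dist y x ≤ k * d := by gcongr
  have h7 : (k : ℝ) * dist y x' ≤ k * d := by gcongr
  have h8 := dist_triangle_left (u x) (u x') (u y)
  linarith

open scoped NNReal in
/-- The set of points of approximate differentiability is a countable union of sets on which the
map is Lipschitz. -/
theorem exists_lipschitz_cover (u : Space n → Space n) :
    ∃ (S : ℕ → Set (Space n)) (K : ℕ → ℝ≥0), (∀ k, LipschitzOnWith (K k) u (S k)) ∧
      {x | ∃ L, HasApproxDerivAt u L x} ⊆ ⋃ k, S k := by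
  let c := TopologicalSpace.denseSeq (Space n)
  let S : ℕ × ℕ → Set (Space n) := fun q =>
    slowSet u q.1 ∩ Metric.ball (c q.2) (1 / (q.1 + 1) / 2)
  have hS : ∀ q, LipschitzOnWith (2 * q.1) u (S q) := by
    intro q
    refine LipschitzOnWith.of_dist_le_mul fun x hx y hy => ?_
    have hd : dist x y < 1 / (q.1 + 1) := by
      have h1 := Metric.mem_ball.1 hx.2
      have h2 := Metric.mem_ball.1 hy.2
      have := dist_triangle_right x y (c q.2)
      linarith
    have := norm_sub_le_of_mem_slowSet hx.1 hy.1 hd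
    exact_mod_cast this
  let e := (Denumerable.eqv (ℕ × ℕ)).symm
  refine ⟨fun k => S (e k), fun k => 2 * (e k).1, fun k => hS _, ?_⟩
  rintro x ⟨L, hL⟩
  obtain ⟨k, hk⟩ := hL.exists_mem_slowSet
  have hpos : (0 : ℝ) < 1 / (k + 1) / 2 := by positivity
  obtain ⟨j, hj⟩ := (TopologicalSpace.denseRange_denseSeq (Space n)).exists_dist_lt x hpos
  refine Set.mem_iUnion.2 ⟨e.symm (k, j), ?_⟩
  simp only [Equiv.apply_symm_apply]
  exact ⟨hk, Metric.mem_ball.2 hj⟩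

/-- The Lusin property of the graph: it has no mass over null sets. -/
theorem euclideanHausdorffMeasure_graphOver_of_null {u : Space n → Space n} {N : Set (Space n)}
    (hN : N ⊆ {x | ∃ L, HasApproxDerivAt u L x}) (h0 : volume N = 0) :
    Measure.euclideanHausdorffMeasure n (graphOver u N) = 0 := by
  obtain ⟨S, K, hS, hcov⟩ := exists_lipschitz_cover u
  have hsub : graphOver u N ⊆ ⋃ k, graphOver u (N ∩ S k) := by
    rintro _ ⟨x, hx, rfl⟩
    obtain ⟨k, hk⟩ := Set.mem_iUnion.1 (hcov (hN hx))
    exact Set.mem_iUnion.2 ⟨k, x, ⟨hx, hk⟩, rfl⟩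
  refine measure_mono_null hsub (measure_iUnion_null fun k => ?_)
  exact euclideanHausdorffMeasure_graphOver_eq_zero ((hS k).mono Set.inter_subset_right)
    (measure_mono_null Set.inter_subset_left h0)

/-! ### The graph measure as an image of Lebesgue measure -/

theorem graphSet_eq_graphOver (Ω : Set (Space n)) (u : Space n → Space n) :
    graphSet Ω u = graphOver u (Ω ∩ {x | ∃ L, HasApproxDerivAt u L x}) := by
  rw [graphOver_eq]
  ext p
  simp only [graphSet, Set.mem_ofPred_eq, Set.mem_inter_iff, and_assoc]

/-- At almost every point where a Lipschitz map `g` agrees with `u`, the differential of `g` is the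
approximate differential of `u`. -/
theorem ae_hasFDerivAt_of_eq {Ω : Set (Space n)} (hΩ : IsOpen Ω) {u ũ : Space n → Space n}
    (hũ : Measurable ũ) (huũ : ∀ᵐ x ∂volume.restrict Ω, u x = ũ x)
    {A : Space n → Space n →L[ℝ] Space n}
    (hA : ∀ᵐ x ∂volume.restrict Ω, HasApproxDerivAt u (A x) x)
    {g : Space n → Space n} {K : NNReal} (hg : LipschitzWith K g) :
    ∀ᵐ x ∂volume.restrict Ω, ũ x = g x → HasFDerivAt g (A x) x := by
  set C : Set (Space n) := {x | ũ x = g x}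
  have hC : MeasurableSet C := measurableSet_eq_fun hũ hg.continuous.measurable
  have hdens := ae_restrict_of_ae (s := Ω)
    (Besicovitch.ae_tendsto_measure_inter_div_of_measurableSet volume hC.compl)
  have hdiff := ae_restrict_of_ae (s := Ω) (hg.ae_differentiableAt (μ := volume))
  filter_upwards [hdens, hdiff, huũ, hA, ae_restrict_mem hΩ.measurableSet] with x h1 h2 h3 h4 hxΩ hx
  have hind : Set.indicator Cᶜ (1 : Space n → ℝ≥0∞) x = 0 :=
    Set.indicator_of_notMem (fun hc : x ∉ C => hc hx) _
  rw [hind] at h1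
  have h5 : HasApproxDerivAt u (fderiv ℝ g x) x := by
    refine hasApproxDerivAt_of_hasFDerivAt h2.hasFDerivAt (h3.trans hx) ?_
    obtain ⟨δ, hδ, hball⟩ := Metric.isOpen_iff.1 hΩ x hxΩ
    refine tendsto_of_tendsto_of_tendsto_of_le_of_le' tendsto_const_nhds h1
      (Eventually.of_forall fun _ => zero_le) ?_
    filter_upwards [mem_nhdsWithin_of_mem_nhds (Iio_mem_nhds hδ), self_mem_nhdsWithin]
      with r hr hr0
    rw [volume_closedBall_eq x hr0]
    refine ENNReal.div_le_div_right ?_ _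
    have hnull : volume ({y | u y ≠ ũ y} ∩ Ω) = 0 := by
      have := ae_iff.1 huũ
      rwa [Measure.restrict_apply₀' hΩ.measurableSet.nullMeasurableSet] at this
    calc _ ≤ volume ((Cᶜ ∩ Metric.closedBall x r) ∪ ({y | u y ≠ ũ y} ∩ Ω)) := by
          refine measure_mono ?_
          rintro y ⟨hy1, hy2⟩
          by_cases hy : u y = ũ y
          · exact Or.inl ⟨fun hc => hy1 (hy.trans hc), Metric.ball_subset_closedBall hy2⟩
          · exact Or.inr ⟨hy, hball (Metric.ball_subset_ball (le_of_lt hr) hy2)⟩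
      _ ≤ _ := measure_union_le _ _
      _ = _ := by rw [hnull, add_zero]
  rw [← h5.unique h4]
  exact h2.hasFDerivAt

/-- The area formula: `𝓗ⁿ` on the graph of an almost everywhere approximately differentiable map is
the image of Lebesgue measure with the Jacobian as density. The map `ũ` is a Borel representative of
`u`; changing `u` on a null set does not affect the measure of the graph, by
`euclideanHausdorffMeasure_graphOver_of_null`. -/
theorem graphMeasure_eq_map {Ω : Set (Space n)} (hΩ : IsOpen Ω) {u ũ : Space n → Space n}
    (hũ : Measurable ũ) (huũ : ∀ᵐ x ∂volume.restrict Ω, u x = ũ x)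
    {A : Space n → Space n →L[ℝ] Space n}
    (hA : ∀ᵐ x ∂volume.restrict Ω, HasApproxDerivAt u (A x) x) :
    graphMeasure Ω u = Measure.map (fun x => pt x (ũ x))
      ((volume.restrict Ω).withDensity fun x => ENNReal.ofReal (jac (A x))) := by
  obtain ⟨S, K, hS, hcov⟩ := exists_lipschitz_cover u
  choose g hgL hgS using fun k => (hS k).extend_finite_dimension
  have hgd : ∀ᵐ x ∂volume.restrict Ω, ∀ k, ũ x = g k x → HasFDerivAt (g k) (A x) x :=
    ae_all_iff.2 fun k => ae_hasFDerivAt_of_eq hΩ hũ huũ hA (hgL k)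
  -- a Borel set of full measure on which everything holds pointwise
  obtain ⟨N, hNsub, hNm, hN0⟩ := exists_measurable_superset_of_null
    (ae_iff.1 (hgd.and (huũ.and hA)))
  have hgood : ∀ x ∉ N, (∀ k, ũ x = g k x → HasFDerivAt (g k) (A x) x) ∧ u x = ũ x ∧
      HasApproxDerivAt u (A x) x := fun x hx => not_not.1 fun hcon => hx (hNsub hcon)
  set B : Set (Space n) := Ω \ N
  have hBm : MeasurableSet B := hΩ.measurableSet.diff hNm
  have hΩB : volume (Ω \ B) = 0 := by
    rw [Set.sdiff_sdiff_right_self, Set.inter_comm, ← Measure.restrict_apply hNm]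
    exact hN0
  set C : ℕ → Set (Space n) := fun k => {x | ũ x = g k x}
  have hCm : ∀ k, MeasurableSet (C k) := fun k =>
    measurableSet_eq_fun hũ (hgL k).continuous.measurable
  have hBC : B ⊆ ⋃ k, C k := by
    rintro x ⟨_, hxN⟩
    obtain ⟨-, h2, h3⟩ := hgood x hxN
    obtain ⟨k, hk⟩ := Set.mem_iUnion.1 (hcov ⟨_, h3⟩)
    exact Set.mem_iUnion.2 ⟨k, (h2.symm.trans (hgS k hk) : ũ x = g k x)⟩
  -- the graph is the graph over `B`, up to a null set
  have hset : graphSet Ω u =ᵐ[Measure.euclideanHausdorffMeasure n] graphOver ũ B := by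
    have h1 : graphOver ũ B = graphOver u B :=
      Set.image_congr fun x hx => by rw [(hgood x hx.2).2.1]
    have h2 : graphSet Ω u
        = graphOver u B ∪ graphOver u ((Ω ∩ {x | ∃ L, HasApproxDerivAt u L x}) \ B) := by
      rw [graphSet_eq_graphOver, graphOver, graphOver, graphOver, ← Set.image_union,
        Set.union_sdiff_self, Set.union_eq_self_of_subset_left]
      exact fun x hx => ⟨hx.1, _, (hgood x hx.2).2.2⟩
    have h3 := euclideanHausdorffMeasure_graphOver_of_null
      (u := u) (N := (Ω ∩ {x | ∃ L, HasApproxDerivAt u L x}) \ B) (fun x hx => hx.1.2)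
      (measure_mono_null (Set.sdiff_subset_sdiff_left Set.inter_subset_left) hΩB)
    rw [h2, h1]
    exact union_ae_eq_left_of_ae_eq_empty (ae_eq_empty.2 h3)
  rw [graphMeasure, Measure.restrict_congr_set hset]
  ext T hT
  have hΦ := measurable_graph hũ
  have hΦT := hΦ hT
  rw [Measure.restrict_apply hT, Measure.map_apply hΦ hT, withDensity_apply _ hΦT,
    Measure.restrict_restrict hΦT]
  set P : Set (Space n) := (fun x => pt x (ũ x)) ⁻¹' T
  set D : ℕ → Set (Space n) := fun k => (B ∩ P) ∩ disjointed C k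
  have hDm : ∀ k, MeasurableSet (D k) := fun k =>
    (hBm.inter hΦT).inter (MeasurableSet.disjointed hCm k)
  have hDd : Pairwise (Function.onFun Disjoint D) := fun i j hij =>
    (disjoint_disjointed C hij).mono Set.inter_subset_right Set.inter_subset_right
  have hD : B ∩ P = ⋃ k, D k := by
    rw [← Set.inter_iUnion, iUnion_disjointed,
      Set.inter_eq_self_of_subset_left (Set.inter_subset_left.trans hBC)]
  have hgD : ∀ k, graphOver ũ (D k) = graphOver (g k) (D k) := fun k =>
    Set.image_congr fun x hx => by
      rw [show ũ x = g k x from disjointed_subset C k hx.2]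
  have hgraph : T ∩ graphOver ũ B = ⋃ k, graphOver (g k) (D k) := by
    rw [← Set.iUnion_congr hgD, graphOver, Set.inter_comm, ← Set.image_inter_preimage]
    change _ '' (B ∩ P) = _
    rw [hD, Set.image_iUnion]
    rfl
  rw [hgraph, measure_iUnion]
  · have h1 : ∀ k, Measure.euclideanHausdorffMeasure n (graphOver (g k) (D k))
        = ∫⁻ x in D k, ENNReal.ofReal (jac (A x)) := fun k =>
      euclideanHausdorffMeasure_graphOver (hgL k).continuous.measurable (hDm k) fun x hx =>
        ((hgood x hx.1.1.2).1 k (disjointed_subset C k hx.2)).hasFDerivWithinAt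
    rw [tsum_congr h1, ← lintegral_iUnion hDm hDd, ← hD]
    have h2 : (B ∩ P : Set (Space n)) =ᵐ[volume] (P ∩ Ω : Set (Space n)) := by
      rw [Set.inter_comm]
      refine (ae_eq_refl P).inter ?_
      refine (ae_le_set.2 ?_).antisymm (ae_le_set.2 hΩB)
      rw [Set.sdiff_eq_empty.2 Set.sdiff_subset, measure_empty]
    rw [Measure.restrict_congr_set h2]
  · intro i j hij
    have := hDd hij
    rw [Function.onFun, Set.disjoint_left] at this ⊢
    intro p hp hp'
    rw [graphOver_eq] at hp hp'
    exact this hp.1 hp'.1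
  · exact fun k => measurableSet_graphOver (hgL k).continuous.measurable (hDm k)

end

section

/-! ### Mollification -/

section Mollification

variable {ι : Type*} [Fintype ι] {E : Type*} [NormedAddCommGroup E] [NormedSpace ℝ E]

/-- A bump function supported in the ball of radius `1 / (k + 1)` around the origin. -/
def bump (ι : Type*) [Fintype ι] (k : ℕ) : ContDiffBump (0 : EuclideanSpace ℝ ι) where
  rIn := 1 / (2 * (k + 1))
  rOut := 1 / (k + 1)
  rIn_pos := by positivity
  rIn_lt_rOut := by
    apply one_div_lt_one_div_of_lt <;> linarith [(Nat.cast_nonneg k : (0 : ℝ) ≤ k)]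

/-- The standard mollifier with support in the ball of radius `1 / (k + 1)`. -/
def mollifier (ι : Type*) [Fintype ι] (k : ℕ) : EuclideanSpace ℝ ι → ℝ :=
  (bump ι k).normed volume

/-- The mollification of `f` at scale `1 / (k + 1)`. -/
def mollify (k : ℕ) (f : EuclideanSpace ℝ ι → E) : EuclideanSpace ℝ ι → E :=
  convolution (mollifier ι k) f (ContinuousLinearMap.lsmul ℝ ℝ) volume

theorem tendsto_rOut_bump : Tendsto (fun k => (bump ι k).rOut) atTop (𝓝 0) :=
  tendsto_one_div_add_atTop_nhds_zero_nat

theorem rOut_bump_le (k : ℕ) : (bump ι k).rOut ≤ 2 * (bump ι k).rIn := by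
  change (1 : ℝ) / (k + 1) ≤ 2 * (1 / (2 * (k + 1)))
  have : (0 : ℝ) < k + 1 := by positivity
  field_simp; rfl

theorem mollifier_nonneg (k : ℕ) (x : EuclideanSpace ℝ ι) : 0 ≤ mollifier ι k x :=
  (bump ι k).nonneg_normed x

theorem integrable_mollifier (k : ℕ) : Integrable (mollifier ι k) := (bump ι k).integrable_normed

theorem integral_mollifier (k : ℕ) : ∫ x, mollifier ι k x = 1 := (bump ι k).integral_normed

theorem contDiff_mollifier (k : ℕ) : ContDiff ℝ ∞ (mollifier ι k) := (bump ι k).contDiff_normed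

theorem hasCompactSupport_mollifier (k : ℕ) : HasCompactSupport (mollifier ι k) :=
  (bump ι k).hasCompactSupport_normed

theorem tsupport_mollifier (k : ℕ) :
    tsupport (mollifier ι k) = Metric.closedBall 0 (1 / (k + 1)) :=
  (bump ι k).tsupport_normed_eq

theorem norm_le_of_mollifier_ne_zero {k : ℕ} {t : EuclideanSpace ℝ ι}
    (h : mollifier ι k t ≠ 0) : ‖t‖ ≤ 1 / (k + 1) := by
  have h1 : t ∈ tsupport (mollifier ι k) := subset_tsupport _ h
  rw [tsupport_mollifier] at h1
  simpa using h1

theorem lintegral_mollifier (k : ℕ) : ∫⁻ x, ‖mollifier ι k x‖ₑ = 1 := by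
  have h := ofReal_integral_eq_lintegral_ofReal (integrable_mollifier (ι := ι) k)
    (Eventually.of_forall fun x => mollifier_nonneg k x)
  rw [integral_mollifier, ENNReal.ofReal_one] at h
  rw [h]
  exact lintegral_congr fun x => Real.enorm_of_nonneg (mollifier_nonneg k x)

theorem mollify_apply (k : ℕ) (f : EuclideanSpace ℝ ι → E) (x : EuclideanSpace ℝ ι) :
    mollify k f x = ∫ t, mollifier ι k t • f (x - t) := rfl

theorem mollify_apply_swap (k : ℕ) (f : EuclideanSpace ℝ ι → E) (x : EuclideanSpace ℝ ι) :
    mollify k f x = ∫ t, mollifier ι k (x - t) • f t := by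
  rw [mollify, convolution_eq_swap]; rfl

theorem mollify_convolutionExists (k : ℕ) {f : EuclideanSpace ℝ ι → E}
    (hf : LocallyIntegrable f) :
    ConvolutionExists (mollifier ι k) f (ContinuousLinearMap.lsmul ℝ ℝ) volume :=
  (hasCompactSupport_mollifier k).convolutionExists_left _ (contDiff_mollifier k).continuous hf

theorem integrable_mollifier_smul (k : ℕ) {f : EuclideanSpace ℝ ι → E}
    (hf : LocallyIntegrable f) (x : EuclideanSpace ℝ ι) :
    Integrable fun t => mollifier ι k t • f (x - t) :=
  mollify_convolutionExists k hf x

theorem integrable_mollifier_smul_swap (k : ℕ) {f : EuclideanSpace ℝ ι → E}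
    (hf : LocallyIntegrable f) (x : EuclideanSpace ℝ ι) :
    Integrable fun t => mollifier ι k (x - t) • f t :=
  (mollify_convolutionExists k hf x).integrable_swap

theorem contDiff_mollify (k : ℕ) {f : EuclideanSpace ℝ ι → E} (hf : LocallyIntegrable f) :
    ContDiff ℝ ∞ (mollify k f) :=
  (hasCompactSupport_mollifier k).contDiff_convolution_left _ (contDiff_mollifier k) hf

theorem ae_tendsto_mollify [CompleteSpace E] {f : EuclideanSpace ℝ ι → E}
    (hf : LocallyIntegrable f) :
    ∀ᵐ x, Tendsto (fun k => mollify k f x) atTop (𝓝 (f x)) := by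
  unfold mollify mollifier
  exact ContDiffBump.ae_convolution_tendsto_right_of_locallyIntegrable (φ := fun k => bump ι k)
    (K := 2) tendsto_rOut_bump (Eventually.of_forall rOut_bump_le) hf

theorem tendsto_mollify_of_continuous [CompleteSpace E] {f : EuclideanSpace ℝ ι → E}
    (hf : Continuous f) (x : EuclideanSpace ℝ ι) :
    Tendsto (fun k => mollify k f x) atTop (𝓝 (f x)) := by
  unfold mollify mollifier
  exact ContDiffBump.convolution_tendsto_right_of_continuous (φ := fun k => bump ι k)
    (μ := volume) (g := f) tendsto_rOut_bump hf x

theorem enorm_mollify_sub_le [CompleteSpace E] (k : ℕ) {f : EuclideanSpace ℝ ι → E}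
    (hf : LocallyIntegrable f) (x : EuclideanSpace ℝ ι) (a : E) :
    ‖mollify k f x - a‖ₑ ≤ ∫⁻ t, ‖mollifier ι k t‖ₑ * ‖f (x - t) - a‖ₑ := by
  have h : mollify k f x - a = ∫ t, mollifier ι k t • (f (x - t) - a) := by
    simp_rw [smul_sub]
    rw [integral_sub (integrable_mollifier_smul k hf x) ((integrable_mollifier k).smul_const a),
      integral_smul_const, integral_mollifier, one_smul]
    rfl
  rw [h]
  refine (enorm_integral_le_lintegral_enorm _).trans_eq ?_
  simp_rw [enorm_smul]

theorem norm_mollify_le (k : ℕ) {f : EuclideanSpace ℝ ι → E} {C : ℝ} (hC : ∀ x, ‖f x‖ ≤ C)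
    (x : EuclideanSpace ℝ ι) : ‖mollify k f x‖ ≤ C := by
  rw [mollify_apply]
  refine (norm_integral_le_of_norm_le ((integrable_mollifier k).mul_const C)
    (Eventually.of_forall fun t => ?_)).trans_eq ?_
  · rw [norm_smul, Real.norm_of_nonneg (mollifier_nonneg k t)]
    exact mul_le_mul_of_nonneg_left (hC _) (mollifier_nonneg k t)
  · rw [integral_mul_const, integral_mollifier, one_mul]

/-- Derivatives commute with mollification. -/
theorem hasFDerivAt_mollify (k : ℕ) {f : EuclideanSpace ℝ ι → E} (hf : ContDiff ℝ 1 f)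
    (hfc : HasCompactSupport f) (x : EuclideanSpace ℝ ι) :
    HasFDerivAt (mollify k f) (mollify k (fderiv ℝ f) x) x :=
  hfc.hasFDerivAt_convolution_right (ContinuousLinearMap.lsmul ℝ ℝ)
    (contDiff_mollifier k).continuous.locallyIntegrable hf x

theorem support_mollify_subset (k : ℕ) (f : EuclideanSpace ℝ ι → E) :
    Function.support (mollify k f) ⊆ Metric.cthickening (1 / (k + 1)) (tsupport f) := by
  intro x hx
  by_contra hcon
  refine hx ?_
  rw [mollify_apply]
  refine integral_eq_zero_of_ae (Eventually.of_forall fun t => ?_)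
  by_cases ht : mollifier ι k t = 0
  · simp [ht]
  · have h1 := norm_le_of_mollifier_ne_zero ht
    have h2 : f (x - t) = 0 := by
      by_contra hne
      refine hcon (Metric.mem_cthickening_of_dist_le x (x - t) _ _ (subset_tsupport _ hne) ?_)
      rwa [dist_eq_norm, sub_sub_cancel]
    simp [h2]

theorem integrable_fderiv_mollifier_smul (k : ℕ) {f : EuclideanSpace ℝ ι → E}
    (hf : LocallyIntegrable f) (x v : EuclideanSpace ℝ ι) :
    Integrable fun t => fderiv ℝ (mollifier ι k) (x - t) v • f t := by
  have hc : Continuous fun t => fderiv ℝ (mollifier ι k) t v :=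
    ((contDiff_mollifier k).continuous_fderiv (by simp)).clm_apply continuous_const
  have hs : HasCompactSupport fun t => fderiv ℝ (mollifier ι k) t v :=
    (hasCompactSupport_mollifier k).fderiv_apply ℝ v
  exact (hs.convolutionExists_left (ContinuousLinearMap.lsmul ℝ ℝ) hc hf x).integrable_swap

theorem exists_hasFDerivAt_mollify [CompleteSpace E] (k : ℕ) {f : EuclideanSpace ℝ ι → E}
    (hf : LocallyIntegrable f) (x : EuclideanSpace ℝ ι) :
    ∃ L : EuclideanSpace ℝ ι →L[ℝ] E, HasFDerivAt (mollify k f) L x ∧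
      ∀ v, L v = ∫ t, fderiv ℝ (mollifier ι k) (x - t) v • f t := by
  have h1 := (hasCompactSupport_mollifier (ι := ι) k).hasFDerivAt_convolution_left
    (ContinuousLinearMap.lsmul ℝ ℝ : ℝ →L[ℝ] E →L[ℝ] E)
    ((contDiff_mollifier k).of_le (by simp)) hf x
  refine ⟨_, h1, fun v => ?_⟩
  have hex := (((hasCompactSupport_mollifier (ι := ι) k).fderiv ℝ).convolutionExists_left
      ((ContinuousLinearMap.lsmul ℝ ℝ : ℝ →L[ℝ] E →L[ℝ] E).precompL (EuclideanSpace ℝ ι))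
      ((contDiff_mollifier k).continuous_fderiv (by simp)) hf x).integrable_swap
  rw [convolution_eq_swap, ContinuousLinearMap.integral_apply hex]
  rfl
end Mollification

variable {n : ℕ}

theorem integrable_indicator_of_integrableOn {E : Type*} [NormedAddCommGroup E]
    {Ω : Set (Space n)} (hΩ : IsOpen Ω) {f : Space n → E} (hf : IntegrableOn f Ω) :
    Integrable (Ω.indicator f) :=
  hf.integrable_indicator hΩ.measurableSet

/-- Mollification of a weakly differentiable map, away from the boundary. -/
theorem HasWeakGradient.hasFDerivAt_mollify {Ω : Set (Space n)} (hΩ : IsOpen Ω)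
    {u : Space n → Space n} {Du : Space n → Matrix (Fin n) (Fin n) ℝ}
    (h : HasWeakGradient Ω u Du) (hu : IntegrableOn u Ω)
    (hDu : IntegrableOn (fun x => matCLM (Du x)) Ω) (k : ℕ) {x : Space n}
    (hx : Metric.closedBall x (1 / (k + 1)) ⊆ Ω) :
    HasFDerivAt (mollify k (Ω.indicator u))
      (mollify k (Ω.indicator fun x => matCLM (Du x)) x) x := by
  have hum : LocallyIntegrable (Ω.indicator u) :=
    (integrable_indicator_of_integrableOn hΩ hu).locallyIntegrable
  have hDum : LocallyIntegrable (Ω.indicator fun x => matCLM (Du x)) :=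
    (integrable_indicator_of_integrableOn hΩ hDu).locallyIntegrable
  obtain ⟨L, hL, hLv⟩ := exists_hasFDerivAt_mollify k hum x
  suffices heq : mollify k (Ω.indicator fun x => matCLM (Du x)) x = L by rwa [heq]
  refine ContinuousLinearMap.coe_injective
    ((EuclideanSpace.basisFun (Fin n) ℝ).toBasis.ext fun i => ?_)
  ext j
  simp only [OrthonormalBasis.coe_toBasis, EuclideanSpace.basisFun_apply,
    ContinuousLinearMap.coe_coe]
  -- the test function in the definition of the weak gradient
  let φ : Space n → ℝ := fun t => mollifier (Fin n) k (x - t)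
  have hφs : ContDiff ℝ ∞ φ := (contDiff_mollifier k).comp (contDiff_const.sub contDiff_id)
  have hφsub : tsupport φ ⊆ Metric.closedBall x (1 / (k + 1)) := by
    refine closure_minimal (fun t ht => ?_) Metric.isClosed_closedBall
    have := norm_le_of_mollifier_ne_zero (show mollifier (Fin n) k (x - t) ≠ 0 from ht)
    rwa [Metric.mem_closedBall, dist_comm, dist_eq_norm]
  have hφc : HasCompactSupport φ :=
    HasCompactSupport.of_support_subset_isCompact (isCompact_closedBall x (1 / (k + 1)))
      ((subset_tsupport φ).trans hφsub)
  have hφd : ∀ t, fderiv ℝ φ t (stdVec i)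
      = - fderiv ℝ (mollifier (Fin n) k) (x - t) (stdVec i) := by
    intro t
    have hd : HasFDerivAt φ ((fderiv ℝ (mollifier (Fin n) k) (x - t)).comp
        (-ContinuousLinearMap.id ℝ (Space n))) t :=
      (((contDiff_mollifier k).differentiable (by simp)) (x - t)).hasFDerivAt.comp t
        ((hasFDerivAt_id t).const_sub x)
    rw [hd.fderiv]
    simp
  have hweak := (h i j).2.2 φ hφs hφc (hφsub.trans hx)
  have hl : (mollify k (Ω.indicator fun x => matCLM (Du x)) x (stdVec i)) j
      = ∫ t in Ω, Du t j i * φ t := by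
    have hint := integrable_mollifier_smul_swap k hDum x
    have h2 := (EuclideanSpace.proj j : Space n →L[ℝ] ℝ).integral_comp_comm
      (hint.apply_continuousLinearMap (stdVec i))
    rw [mollify_apply_swap, ContinuousLinearMap.integral_apply hint]
    refine h2.symm.trans ?_
    rw [← integral_indicator hΩ.measurableSet]
    refine integral_congr_ae (Eventually.of_forall fun t => ?_)
    by_cases ht : t ∈ Ω
    · simp only [Set.indicator_of_mem ht]
      rw [_root_.smul_apply, map_smul, PiLp.proj_apply, matCLM_stdVec, smul_eq_mul, mul_comm]
    · simp [Set.indicator_of_notMem ht]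
  have hr : (L (stdVec i)) j = - ∫ t in Ω, u t j * fderiv ℝ φ t (stdVec i) := by
    have hint := integrable_fderiv_mollifier_smul k hum x (stdVec i)
    have h2 := (EuclideanSpace.proj j : Space n →L[ℝ] ℝ).integral_comp_comm hint
    rw [hLv]
    refine h2.symm.trans ?_
    rw [← integral_indicator hΩ.measurableSet, ← integral_neg]
    refine integral_congr_ae (Eventually.of_forall fun t => ?_)
    by_cases ht : t ∈ Ω
    · simp only [Set.indicator_of_mem ht]
      rw [hφd, map_smul, PiLp.proj_apply, smul_eq_mul]
      ring
    · simp [Set.indicator_of_notMem ht]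
  rw [hl, hr, hweak, neg_neg]

end

section

variable {n : ℕ}

/-! ### Almost everywhere approximate differentiability of Sobolev maps -/

/-- Change of variables `y ↦ x + t (y - x)` in a ball. -/
theorem setLIntegral_ball_homothety (F : Space n → ℝ≥0∞) (x : Space n) {t r : ℝ}
    (ht : 0 < t) :
    ENNReal.ofReal (t ^ n) * ∫⁻ y in Metric.ball x r, F (x + t • (y - x))
      = ∫⁻ z in Metric.ball x (t * r), F z := by
  rw [← lintegral_indicator Metric.isOpen_ball.measurableSet,
    ← lintegral_indicator Metric.isOpen_ball.measurableSet]
  set G := (Metric.ball x (t * r)).indicator F with hG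
  have h1 : ∀ y, (Metric.ball x r).indicator (fun y => F (x + t • (y - x))) y
      = G (x + t • (y - x)) := by
    intro y
    have hiff : x + t • (y - x) ∈ Metric.ball x (t * r) ↔ y ∈ Metric.ball x r := by
      rw [mem_ball_iff_norm, mem_ball_iff_norm, add_sub_cancel_left, norm_smul,
        Real.norm_of_nonneg ht.le, mul_lt_mul_iff_right₀ ht]
    by_cases hy : y ∈ Metric.ball x r
    · rw [hG, Set.indicator_of_mem hy, Set.indicator_of_mem (hiff.2 hy)]
    · rw [hG, Set.indicator_of_notMem hy, Set.indicator_of_notMem (fun h => hy (hiff.1 h))]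
  have hmap := Measure.map_addHaar_smul (volume : Measure (Space n)) ht.ne'
  have hemb : MeasurableEmbedding fun y : Space n => t • y :=
    (Homeomorph.smulOfNeZero t ht.ne').measurableEmbedding
  have htn : 0 < t ^ n := pow_pos ht n
  calc ENNReal.ofReal (t ^ n) * ∫⁻ y, (Metric.ball x r).indicator (fun y => F (x + t • (y - x))) y
      = ENNReal.ofReal (t ^ n) * ∫⁻ y, G (x + t • (y - x)) := by simp_rw [h1]
    _ = ENNReal.ofReal (t ^ n) * ∫⁻ y, G (x + t • y) := by
        rw [lintegral_sub_right_eq_self (fun y => G (x + t • y)) x]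
    _ = ENNReal.ofReal (t ^ n) * ∫⁻ y, G (x + y) ∂(Measure.map (t • ·) volume) := by
        rw [hemb.lintegral_map]
    _ = ∫⁻ y, G (x + y) := by
        rw [hmap, lintegral_smul_measure, finrank_euclideanSpace_fin, abs_of_pos (inv_pos.2 htn),
          smul_eq_mul, ← mul_assoc, ← ENNReal.ofReal_mul htn.le, mul_inv_cancel₀ htn.ne',
          ENNReal.ofReal_one, one_mul]
    _ = ∫⁻ y, G y := lintegral_add_left_eq_self G x

/-- The mean deviation of `Dv` from `A` along the segment from `x` to `y`. -/
def segmentDeviation (v : Space n → Space n) (A : Space n →L[ℝ] Space n) (x y : Space n) : ℝ≥0∞ :=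
  ∫⁻ t in Set.Ioc (0 : ℝ) 1, ‖fderiv ℝ v (x + t • (y - x)) - A‖ₑ

theorem enorm_sub_sub_le_segmentDeviation {v : Space n → Space n} (hv : ContDiff ℝ ∞ v)
    (A : Space n →L[ℝ] Space n) (x y : Space n) :
    ‖v y - v x - A (y - x)‖ₑ ≤ segmentDeviation v A x y * ‖y - x‖ₑ := by
  let γ : ℝ → Space n := fun t => v (x + t • (y - x)) - t • A (y - x)
  let γ' : ℝ → Space n := fun t => (fderiv ℝ v (x + t • (y - x)) - A) (y - x)
  have hcont : Continuous fun t : ℝ => fderiv ℝ v (x + t • (y - x)) :=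
    (hv.continuous_fderiv (by simp)).comp (by fun_prop)
  have hγ : ∀ t, HasDerivAt γ (γ' t) t := by
    intro t
    have h1 : HasDerivAt (fun t : ℝ => x + t • (y - x)) (y - x) t := by
      simpa using ((hasDerivAt_id t).smul_const (y - x)).const_add x
    have h2 := ((hv.differentiable (by simp) (x + t • (y - x))).hasFDerivAt.comp_hasDerivAt t h1)
    have h3 : HasDerivAt (fun t : ℝ => t • A (y - x)) (A (y - x)) t := by
      simpa using (hasDerivAt_id t).smul_const (A (y - x))
    exact h2.sub h3
  have hγc : Continuous γ' := (hcont.sub continuous_const).clm_apply continuous_const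
  have hFTC := intervalIntegral.integral_eq_sub_of_hasDerivAt (fun t _ => hγ t)
    (hγc.intervalIntegrable 0 1)
  have h01 : γ 1 - γ 0 = v y - v x - A (y - x) := by
    simp [γ]; abel
  rw [← h01, ← hFTC, intervalIntegral.integral_of_le zero_le_one, segmentDeviation,
    ← lintegral_mul_const' _ _ enorm_ne_top]
  refine (enorm_integral_le_lintegral_enorm _).trans (lintegral_mono fun t => ?_)
  exact ContinuousLinearMap.le_opENorm _ _

theorem measurable_segmentDeviation {v : Space n → Space n} (hv : ContDiff ℝ ∞ v)
    (A : Space n →L[ℝ] Space n) (x : Space n) : Measurable (segmentDeviation v A x) := by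
  have hcont : Continuous fun q : Space n × ℝ => ‖fderiv ℝ v (x + q.2 • (q.1 - x)) - A‖ₑ :=
    (((hv.continuous_fderiv (by simp)).comp (by fun_prop)).sub continuous_const).enorm
  exact hcont.measurable.lintegral_prod_right'

/-- If the mean of `‖Dv - A‖` over all balls `B(x, s)`, `s ≤ r`, is at most `δ`, then so is the mean
of the deviation along segments. -/
theorem lintegral_segmentDeviation_le {v : Space n → Space n} (hv : ContDiff ℝ ∞ v)
    (A : Space n →L[ℝ] Space n) (x : Space n) {r : ℝ} (hr : 0 < r) {δ : ℝ≥0∞}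
    (hδ : ∀ s, 0 < s → s ≤ r → ∫⁻ z in Metric.ball x s, ‖fderiv ℝ v z - A‖ₑ
      ≤ δ * volume (Metric.ball x s)) :
    ∫⁻ y in Metric.ball x r, segmentDeviation v A x y ≤ δ * volume (Metric.ball x r) := by
  have hcont : Continuous fun q : Space n × ℝ => ‖fderiv ℝ v (x + q.2 • (q.1 - x)) - A‖ₑ :=
    (((hv.continuous_fderiv (by simp)).comp (by fun_prop)).sub continuous_const).enorm
  unfold segmentDeviation
  rw [lintegral_lintegral_swap hcont.measurable.aemeasurable]
  have key : ∀ t ∈ Set.Ioc (0 : ℝ) 1, ∫⁻ y in Metric.ball x r, ‖fderiv ℝ v (x + t • (y - x)) - A‖ₑ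
      ≤ δ * volume (Metric.ball x r) := by
    rintro t ⟨ht0, ht1⟩
    have h1 := setLIntegral_ball_homothety (fun z => ‖fderiv ℝ v z - A‖ₑ) x (r := r) ht0
    have h2 := hδ (t * r) (by positivity) (by nlinarith)
    rw [← h1, volume_ball_mul x x ht0, mul_left_comm] at h2
    exact (ENNReal.mul_le_mul_iff_right (ENNReal.ofReal_pos.2 (pow_pos ht0 n)).ne'
      ENNReal.ofReal_ne_top).1 h2
  calc _ ≤ ∫⁻ _ in Set.Ioc (0 : ℝ) 1, δ * volume (Metric.ball x r) :=
        setLIntegral_mono measurable_const key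
    _ = _ := by simp

/-- Mollification at a scale below `r` increases the mean oscillation over small balls around `x`
by at most a dimensional factor. -/
theorem lintegral_enorm_mollify_sub_le {D : Space n → Space n →L[ℝ] Space n}
    (hD : LocallyIntegrable D) (A : Space n →L[ℝ] Space n) (x : Space n) {r : ℝ} {δ : ℝ≥0∞}
    (hδ : ∀ s, 0 < s → s ≤ 2 * r → ∫⁻ z in Metric.closedBall x s, ‖D z - A‖ₑ
      ≤ δ * volume (Metric.ball x s)) {k : ℕ} (hk : 1 / ((k : ℝ) + 1) ≤ r) {s : ℝ} (hs : 0 < s)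
    (hsr : s ≤ r) :
    ∫⁻ z in Metric.ball x s, ‖mollify k D z - A‖ₑ
      ≤ ENNReal.ofReal (4 ^ n) * δ * volume (Metric.ball x s) := by
  set ε : ℝ := 1 / ((k : ℝ) + 1) with hε
  have hε0 : 0 < ε := by positivity
  have hDm : AEStronglyMeasurable D := hD.aestronglyMeasurable
  rcases le_or_gt ε s with hεs | hsε
  · -- Tonelli: average the translates of the ball
    have hmeas : AEMeasurable (Function.uncurry fun (z t : Space n) =>
        ‖mollifier (Fin n) k t‖ₑ * ‖D (z - t) - A‖ₑ)
        ((volume.restrict (Metric.ball x s)).prod volume) := by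
      have hρ : AEMeasurable (fun q : Space n × Space n => ‖mollifier (Fin n) k q.2‖ₑ)
          ((volume.restrict (Metric.ball x s)).prod volume) :=
        ((contDiff_mollifier k).continuous.comp continuous_snd).enorm.measurable.aemeasurable
      have h1 : AEStronglyMeasurable (fun q : Space n × Space n => D (q.1 - q.2))
          (volume.prod volume) :=
        hDm.comp_quasiMeasurePreserving (quasiMeasurePreserving_sub volume volume)
      have h2 : AEStronglyMeasurable (fun q : Space n × Space n => D (q.1 - q.2))
          ((volume.restrict (Metric.ball x s)).prod volume) :=
        h1.mono_measure (Measure.prod_mono Measure.restrict_le_self le_rfl)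
      exact hρ.mul (h2.sub aestronglyMeasurable_const).enorm
    calc ∫⁻ z in Metric.ball x s, ‖mollify k D z - A‖ₑ
        ≤ ∫⁻ z in Metric.ball x s, ∫⁻ t, ‖mollifier (Fin n) k t‖ₑ * ‖D (z - t) - A‖ₑ :=
          lintegral_mono fun z => enorm_mollify_sub_le k hD z A
      _ = ∫⁻ t, ∫⁻ z in Metric.ball x s, ‖mollifier (Fin n) k t‖ₑ * ‖D (z - t) - A‖ₑ :=
          lintegral_lintegral_swap hmeas
      _ ≤ ∫⁻ t, ‖mollifier (Fin n) k t‖ₑ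
            * (ENNReal.ofReal (4 ^ n) * δ * volume (Metric.ball x s)) := by
          refine lintegral_mono fun t => ?_
          simp only
          rw [lintegral_const_mul' _ _ enorm_ne_top]
          by_cases ht : mollifier (Fin n) k t = 0
          · simp [ht]
          gcongr
          have ht1 : ‖t‖ ≤ ε := norm_le_of_mollifier_ne_zero ht
          calc ∫⁻ z in Metric.ball x s, ‖D (z - t) - A‖ₑ
              ≤ ∫⁻ z, (Metric.closedBall x (2 * s)).indicator (fun z => ‖D z - A‖ₑ) (z - t) := by
                rw [← lintegral_indicator Metric.isOpen_ball.measurableSet]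
                refine lintegral_mono fun z => ?_
                by_cases hz : z ∈ Metric.ball x s
                · rw [Set.indicator_of_mem hz, Set.indicator_of_mem]
                  rw [mem_ball_iff_norm] at hz
                  rw [mem_closedBall_iff_norm]
                  have := norm_sub_le (z - x) t
                  rw [show z - t - x = z - x - t by abel]
                  linarith
                · rw [Set.indicator_of_notMem hz]; exact zero_le
            _ = ∫⁻ z in Metric.closedBall x (2 * s), ‖D z - A‖ₑ := by
                rw [lintegral_sub_right_eq_self, lintegral_indicator
                  Metric.isClosed_closedBall.measurableSet]
            _ ≤ δ * volume (Metric.ball x (2 * s)) := hδ _ (by positivity) (by linarith)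
            _ ≤ _ := by
                rw [volume_ball_mul x x two_pos, ← mul_assoc, mul_comm δ]
                gcongr
                norm_num
      _ = _ := by
          rw [lintegral_mul_const _ (contDiff_mollifier k).continuous.enorm.measurable,
            lintegral_mollifier, one_mul]
  · -- the mollifier is bounded by a multiple of the inverse volume of its support
    have hsup : ∀ t, ‖mollifier (Fin n) k t‖ₑ
        ≤ ENNReal.ofReal (2 ^ n) / volume (Metric.ball x ε) := by
      intro t
      have h1 := (bump (Fin n) k).normed_le_div_measure_closedBall_rOut volume 2 (rOut_bump_le k) t
      have hrout : (bump (Fin n) k).rOut = ε := rfl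
      rw [hrout, finrank_euclideanSpace_fin] at h1
      rw [Real.enorm_of_nonneg (mollifier_nonneg k t)]
      refine (ENNReal.ofReal_le_ofReal h1).trans_eq ?_
      have hb : volume (Metric.closedBall (0 : Space n) ε) = volume (Metric.ball x ε) := by
        rw [volume_closedBall_eq _ hε0, Measure.addHaar_ball_center volume x]
      rw [Measure.real, hb, ENNReal.ofReal_div_of_pos (ENNReal.toReal_pos
        (volume_ball_ne_zero x hε0) (volume_ball_ne_top x ε)),
        ENNReal.ofReal_toReal (volume_ball_ne_top x ε)]
    have hpt : ∀ z ∈ Metric.ball x s, ‖mollify k D z - A‖ₑ ≤ ENNReal.ofReal (4 ^ n) * δ := by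
      intro z hz
      refine (enorm_mollify_sub_le k hD z A).trans ?_
      calc ∫⁻ t, ‖mollifier (Fin n) k t‖ₑ * ‖D (z - t) - A‖ₑ
          ≤ ∫⁻ t, ENNReal.ofReal (2 ^ n) / volume (Metric.ball x ε)
              * (Metric.closedBall x (2 * ε)).indicator (fun z => ‖D z - A‖ₑ) (z - t) := by
            refine lintegral_mono fun t => ?_
            by_cases ht : mollifier (Fin n) k t = 0
            · simp [ht]
            have ht1 : ‖t‖ ≤ ε := norm_le_of_mollifier_ne_zero ht
            rw [Set.indicator_of_mem]
            · exact mul_le_mul' (hsup t) le_rfl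
            · rw [mem_ball_iff_norm] at hz
              rw [mem_closedBall_iff_norm]
              have := norm_sub_le (z - x) t
              rw [show z - t - x = z - x - t by abel]
              linarith
        _ = ENNReal.ofReal (2 ^ n) / volume (Metric.ball x ε)
              * ∫⁻ z in Metric.closedBall x (2 * ε), ‖D z - A‖ₑ := by
            rw [lintegral_const_mul' _ _ (ENNReal.div_lt_top ENNReal.ofReal_ne_top
              (volume_ball_ne_zero x hε0)).ne, lintegral_sub_left_eq_self,
              lintegral_indicator Metric.isClosed_closedBall.measurableSet]
        _ ≤ ENNReal.ofReal (2 ^ n) / volume (Metric.ball x ε)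
              * (δ * volume (Metric.ball x (2 * ε))) := by
            gcongr
            exact hδ _ (by positivity) (by linarith)
        _ = ENNReal.ofReal (4 ^ n) * δ := by
            rw [volume_ball_mul x x two_pos, mul_left_comm,
              ← mul_assoc (ENNReal.ofReal (2 ^ n) / _),
              mul_comm (ENNReal.ofReal (2 ^ n) / _), mul_assoc (ENNReal.ofReal (2 ^ n)),
              ENNReal.div_mul_cancel (volume_ball_ne_zero x hε0) (volume_ball_ne_top x ε),
              ← ENNReal.ofReal_mul (by positivity), ← mul_pow, mul_comm δ]
            norm_num
    calc _ ≤ ∫⁻ _ in Metric.ball x s, ENNReal.ofReal (4 ^ n) * δ :=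
          setLIntegral_mono measurable_const hpt
      _ = _ := setLIntegral_const _ _

/-- A map with weak gradient `Du` is approximately differentiable at every point `x` that is a
Lebesgue point of `Du` and at which its mollifications converge; by Fatou's lemma the bounds on
the mollifications in small balls pass to the limit. -/
theorem HasWeakGradient.ae_hasApproxDerivAt {Ω : Set (Space n)} (hΩ : IsOpen Ω)
    {u : Space n → Space n} {Du : Space n → Matrix (Fin n) (Fin n) ℝ}
    (h : HasWeakGradient Ω u Du) (hu : IntegrableOn u Ω)
    (hDu : IntegrableOn (fun x => matCLM (Du x)) Ω) :
    ∀ᵐ x ∂volume.restrict Ω, HasApproxDerivAt u (matCLM (Du x)) x := by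
  set U := Ω.indicator u with hU
  set D := Ω.indicator fun x => matCLM (Du x) with hD
  have hUm : LocallyIntegrable U := (integrable_indicator_of_integrableOn hΩ hu).locallyIntegrable
  have hDm : LocallyIntegrable D := (integrable_indicator_of_integrableOn hΩ hDu).locallyIntegrable
  have hconv := ae_tendsto_mollify hUm
  have hleb := (Besicovitch.vitaliFamily (volume : Measure (Space n))
    ).ae_tendsto_lintegral_enorm_sub_div hDm
  filter_upwards [ae_restrict_of_ae hconv, ae_restrict_of_ae hleb,
    ae_restrict_mem hΩ.measurableSet] with x hx1 hx2 hxΩ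
  set A := matCLM (Du x) with hA
  have hDx : D x = A := Set.indicator_of_mem hxΩ _
  rw [hDx] at hx2
  have hx2 := hx2.comp (Besicovitch.tendsto_filterAt volume x)
  obtain ⟨R, hR, hball⟩ := Metric.isOpen_iff.1 hΩ x hxΩ
  intro ε hε
  refine ENNReal.tendsto_nhds_zero.2 fun η hη => ?_
  have h4 : ENNReal.ofReal (4 ^ n) ≠ 0 := (ENNReal.ofReal_pos.2 (by positivity)).ne'
  have hε' : ENNReal.ofReal ε ≠ 0 := (ENNReal.ofReal_pos.2 hε).ne'
  set δ : ℝ≥0∞ := η * ENNReal.ofReal ε / ENNReal.ofReal (4 ^ n) with hδ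
  have hδ0 : 0 < δ := ENNReal.div_pos (mul_ne_zero hη.ne' hε') ENNReal.ofReal_ne_top
  have h4δ : ENNReal.ofReal (4 ^ n) * δ = η * ENNReal.ofReal ε :=
    ENNReal.mul_div_cancel h4 ENNReal.ofReal_ne_top
  obtain ⟨s₀, hs₀, hsmall⟩ := Metric.mem_nhdsWithin_iff.1 (hx2.eventually (Iio_mem_nhds hδ0))
  have hosc : ∀ s, 0 < s → s < s₀ → ∫⁻ z in Metric.closedBall x s, ‖D z - A‖ₑ
      ≤ δ * volume (Metric.ball x s) := by
    intro s hs hss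
    have h1 : (∫⁻ z in Metric.closedBall x s, ‖D z - A‖ₑ) / volume (Metric.closedBall x s) < δ :=
      hsmall ⟨by simpa [abs_of_pos hs] using hss, Set.mem_Ioi.2 hs⟩
    rw [volume_closedBall_eq x hs] at h1
    exact (ENNReal.div_le_iff (volume_ball_ne_zero x hs) (volume_ball_ne_top x s)).1 h1.le
  filter_upwards [mem_nhdsWithin_of_mem_nhds (Iio_mem_nhds (half_pos hs₀)),
    mem_nhdsWithin_of_mem_nhds (Iio_mem_nhds (half_pos hR)), self_mem_nhdsWithin] with r hr1 hr2 hr0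
  have hr0 : 0 < r := hr0
  have hr1 : r < s₀ / 2 := hr1
  have hr2 : r < R / 2 := hr2
  have hv : ∀ k, ContDiff ℝ ∞ (mollify k U) := fun k => contDiff_mollify k hUm
  -- the bound on the mollifications at scales below `r`
  have hseg : ∀ᶠ k : ℕ in atTop,
      ∫⁻ y in Metric.ball x r, segmentDeviation (mollify k U) A x y
        ≤ η * ENNReal.ofReal ε * volume (Metric.ball x r) := by
    have hk : ∀ᶠ k : ℕ in atTop, 1 / ((k : ℝ) + 1) < r :=
      tendsto_one_div_add_atTop_nhds_zero_nat.eventually (Iio_mem_nhds hr0)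
    filter_upwards [hk] with k hk
    rw [← h4δ]
    refine lintegral_segmentDeviation_le (hv k) A x hr0 fun s hs hsr => ?_
    refine le_trans (le_of_eq ?_) (lintegral_enorm_mollify_sub_le hDm A x (r := r)
      (fun s hs hs2 => hosc s hs (by linarith)) hk.le hs hsr)
    refine setLIntegral_congr_fun Metric.isOpen_ball.measurableSet fun z hz => ?_
    have hsub : Metric.closedBall z (1 / (k + 1)) ⊆ Ω := by
      refine Set.Subset.trans ?_ hball
      intro y hy
      rw [Metric.mem_closedBall] at hy
      rw [Metric.mem_ball] at hz ⊢
      have := dist_triangle y z x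
      linarith
    rw [(h.hasFDerivAt_mollify hΩ hu hDu k hsub).fderiv]
  rw [ENNReal.div_le_iff (volume_ball_ne_zero x hr0) (volume_ball_ne_top x r)]
  set F : Space n → ℝ≥0∞ := fun y =>
    liminf (fun k => segmentDeviation (mollify k U) A x y) atTop with hF
  have hFm : Measurable F := Measurable.liminf fun k => measurable_segmentDeviation (hv k) A x
  have hFint : ∫⁻ y in Metric.ball x r, F y
      ≤ η * ENNReal.ofReal ε * volume (Metric.ball x r) := by
    refine (lintegral_liminf_le fun k => measurable_segmentDeviation (hv k) A x).trans ?_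
    refine (liminf_le_liminf hseg).trans_eq ?_
    exact liminf_const _
  have hbad : ({y | ε * ‖y - x‖ < ‖u y - u x - A (y - x)‖} ∩ Metric.ball x r : Set (Space n))
      ≤ᵐ[volume] ({y | ENNReal.ofReal ε ≤ F y} ∩ Metric.ball x r : Set (Space n)) := by
    filter_upwards [hconv] with y hy
    rintro ⟨hy1, hy2⟩
    refine ⟨?_, hy2⟩
    have hyΩ : y ∈ Ω := hball (Metric.ball_subset_ball (by linarith) hy2)
    have hUy : U y = u y := Set.indicator_of_mem hyΩ _
    have hUx : U x = u x := Set.indicator_of_mem hxΩ _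
    rw [hUy] at hy
    rw [hUx] at hx1
    have hlim : Tendsto (fun k => ‖mollify k U y - mollify k U x - A (y - x)‖) atTop
        (𝓝 ‖u y - u x - A (y - x)‖) := ((hy.sub hx1).sub_const _).norm
    have hyx : y ≠ x := by
      rintro rfl
      simp at hy1
    have hev := hlim.eventually (Ioi_mem_nhds hy1)
    suffices hle : ∀ᶠ k in atTop, ENNReal.ofReal ε ≤ segmentDeviation (mollify k U) A x y from
      le_liminf_of_le (by isBoundedDefault) hle
    filter_upwards [hev] with k hk
    have h1 := enorm_sub_sub_le_segmentDeviation (hv k) A x y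
    have h2 : ENNReal.ofReal ε * ‖y - x‖ₑ ≤ ‖mollify k U y - mollify k U x - A (y - x)‖ₑ := by
      rw [← ofReal_norm, ← ofReal_norm, ← ENNReal.ofReal_mul hε.le]
      exact ENNReal.ofReal_le_ofReal (le_of_lt hk)
    have h3 : ‖y - x‖ₑ ≠ 0 := enorm_ne_zero.2 (sub_ne_zero.2 hyx)
    exact (ENNReal.mul_le_mul_iff_left h3 enorm_ne_top).1 (h2.trans h1)
  refine (measure_mono_ae hbad).trans ?_
  have hmarkov := mul_meas_ge_le_lintegral (μ := volume.restrict (Metric.ball x r)) hFm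
    (ENNReal.ofReal ε)
  rw [Measure.restrict_apply (measurableSet_le measurable_const hFm)] at hmarkov
  have h5 := hmarkov.trans hFint
  rw [mul_comm η, mul_assoc] at h5
  exact (ENNReal.mul_le_mul_iff_right hε' ENNReal.ofReal_ne_top).1 h5

end

section

/-! ### Integration over the graph in the parametrization `x ↦ (x, u(x))` -/

section

variable {n : ℕ} {Ω : Set (Space n)} {u : Space n → Space n}
  {Du : Space n → Matrix (Fin n) (Fin n) ℝ}

theorem measurableEmbedding_graph {g : Space n → Space n} (hg : Measurable g) :
    MeasurableEmbedding fun x => pt x (g x) :=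
  (measurable_graph hg).measurableEmbedding fun x y hxy => by
    have := congrArg xPart hxy
    simpa using this

/-- The Jacobian of the parametrization cancels the normalization of the orienting `n`-vector. -/
theorem jac_smul_graphDensity {x : Space n} {A : Space n →L[ℝ] Space n}
    (hA : HasApproxDerivAt u A x) (η : Prd n → Prd n [⋀^Fin n]→L[ℝ] ℝ) :
    (ENNReal.ofReal (jac A)).toReal • graphDensity u η (pt x (u x))
      = η (pt x (u x)) (tangents A) := by
  rw [ENNReal.toReal_ofReal (jac_pos A).le, graphDensity, xPart_pt, graphTangent_eq,
    hA.approxDeriv_eq, smul_eq_mul]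
  exact mul_div_cancel₀ _ (jac_pos A).ne'

theorem integrable_graphDensity_iff
    (hΩ : IsOpen Ω) (hu : AEStronglyMeasurable u (volume.restrict Ω))
    (hDu : AEStronglyMeasurable (fun x => matCLM (Du x)) (volume.restrict Ω))
    (hA : ∀ᵐ x ∂volume.restrict Ω, HasApproxDerivAt u (matCLM (Du x)) x)
    (η : Prd n → Prd n [⋀^Fin n]→L[ℝ] ℝ) :
    Integrable (graphDensity u η) (graphMeasure Ω u)
      ↔ IntegrableOn (fun x => η (pt x (u x)) (tangents (matCLM (Du x)))) Ω := by
  have hũ := hu.stronglyMeasurable_mk.measurable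
  have hJ : AEMeasurable (fun x => ENNReal.ofReal (jac (matCLM (Du x)))) (volume.restrict Ω) :=
    (continuous_jac.comp_aestronglyMeasurable hDu).aemeasurable.ennreal_ofReal
  rw [graphMeasure_eq_map hΩ hũ hu.ae_eq_mk hA, (measurableEmbedding_graph hũ).integrable_map_iff,
    integrable_withDensity_iff_integrable_smul₀' hJ
      (Eventually.of_forall fun _ => ENNReal.ofReal_lt_top)]
  refine integrable_congr ?_
  filter_upwards [hA, hu.ae_eq_mk] with x hx hux
  rw [Function.comp_apply, ← hux, jac_smul_graphDensity hx]

theorem graphPairing_eq_integral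
    (hΩ : IsOpen Ω) (hu : AEStronglyMeasurable u (volume.restrict Ω))
    (hDu : AEStronglyMeasurable (fun x => matCLM (Du x)) (volume.restrict Ω))
    (hA : ∀ᵐ x ∂volume.restrict Ω, HasApproxDerivAt u (matCLM (Du x)) x)
    (η : Prd n → Prd n [⋀^Fin n]→L[ℝ] ℝ) :
    graphPairing Ω u η = ∫ x in Ω, η (pt x (u x)) (tangents (matCLM (Du x))) := by
  have hũ := hu.stronglyMeasurable_mk.measurable
  have hJ : AEMeasurable (fun x => ENNReal.ofReal (jac (matCLM (Du x)))) (volume.restrict Ω) :=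
    (continuous_jac.comp_aestronglyMeasurable hDu).aemeasurable.ennreal_ofReal
  rw [graphPairing, graphMeasure_eq_map hΩ hũ hu.ae_eq_mk hA,
    (measurableEmbedding_graph hũ).integral_map, integral_withDensity_eq_integral_toReal_smul₀ hJ
      (Eventually.of_forall fun _ => ENNReal.ofReal_lt_top)]
  refine integral_congr_ae ?_
  filter_upwards [hA, hu.ae_eq_mk] with x hx hux
  rw [← hux, jac_smul_graphDensity hx]

end

/-! ### Integrability over the graph -/

variable {m : ℕ} {Ω : Set (Space (m + 1))} {u : Space (m + 1) → Space (m + 1)}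
  {Du : Space (m + 1) → Matrix (Fin (m + 1)) (Fin (m + 1)) ℝ}

/-- The integrability properties of a Sobolev map on which the argument rests. -/
structure Admissible (Ω : Set (Space (m + 1))) (u : Space (m + 1) → Space (m + 1))
    (Du : Space (m + 1) → Matrix (Fin (m + 1)) (Fin (m + 1)) ℝ) : Prop where
  isOpen : IsOpen Ω
  isBounded : Bornology.IsBounded Ω
  weak : HasWeakGradient Ω u Du
  integrable : IntegrableOn u Ω
  integrable_grad : IntegrableOn (fun x => matCLM (Du x)) Ω
  integrable_pow : IntegrableOn (fun x => ‖matCLM (Du x)‖ ^ m) Ω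
  integrable_det : IntegrableOn (fun x => (Du x).det) Ω

theorem matCLM_eq_sum {n : ℕ} (M : Matrix (Fin n) (Fin n) ℝ) :
    matCLM M = ∑ j, ∑ i, M j i • matCLM (Matrix.single j i 1) := by
  conv_lhs => rw [Matrix.matrix_eq_sum_single M]
  simp only [matCLM, map_sum]
  refine Finset.sum_congr rfl fun j _ => Finset.sum_congr rfl fun i _ => ?_
  rw [← map_smul, Matrix.smul_single, smul_eq_mul, mul_one]

theorem memLp_sum_smul {α ι E : Type*} [Fintype ι] [MeasurableSpace α] {μ : Measure α}
    [NormedAddCommGroup E] [NormedSpace ℝ E] {p : ℝ≥0∞} {c : ι → α → ℝ} (e : ι → E)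
    (hc : ∀ i, MemLp (c i) p μ) : MemLp (fun x => ∑ i, c i x • e i) p μ := by
  refine memLp_finsetSum _ fun i _ => ?_
  refine MemLp.of_le_mul (c := ‖e i‖) (hc i) ((hc i).aestronglyMeasurable.smul_const _)
    (Eventually.of_forall fun x => ?_)
  rw [norm_smul, mul_comm]

theorem memLp_matCLM {n : ℕ} {p : ℝ≥0∞} {Ω : Set (Space n)}
    {Du : Space n → Matrix (Fin n) (Fin n) ℝ}
    (h : ∀ i j, MemLp (fun x => Du x j i) p (volume.restrict Ω)) :
    MemLp (fun x => matCLM (Du x)) p (volume.restrict Ω) := by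
  have heq : (fun x => matCLM (Du x)) = fun x => ∑ q : Fin n × Fin n,
      Du x q.1 q.2 • matCLM (Matrix.single q.1 q.2 1) := by
    funext x
    rw [matCLM_eq_sum, ← Fintype.sum_prod_type']
  rw [heq]
  exact memLp_sum_smul (fun q : Fin n × Fin n => matCLM (Matrix.single q.1 q.2 1))
    fun q => h q.2 q.1

theorem admissible_of_memSobolev (hΩ : IsOpen Ω) (hΩb : Bornology.IsBounded Ω)
    (hu : MemSobolev (m : ℝ≥0∞) Ω u Du) (hub : MemLp u ⊤ (volume.restrict Ω))
    (hdet : IntegrableOn (fun x => (Du x).det) Ω) : Admissible Ω u Du := by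
  have : IsFiniteMeasure (volume.restrict Ω) :=
    isFiniteMeasure_restrict.2 hΩb.measure_lt_top.ne
  have hA := memLp_matCLM hu.2.2
  refine ⟨hΩ, hΩb, hu.1, hub.integrable le_top, ?_, ?_, hdet⟩
  · rcases m with - | m
    · -- in dimension one the determinant is the derivative
      have h1 : ∀ i j, MemLp (fun x => Du x j i) 1 (volume.restrict Ω) := fun i j => by
        rw [memLp_one_iff_integrable]
        refine Integrable.congr hdet (Eventually.of_forall fun x => ?_)
        have hj : j = 0 := Fin.eq_zero j
        have hi : i = 0 := Fin.eq_zero i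
        rw [hi, hj]
        exact Matrix.det_fin_one _
      exact (memLp_one_iff_integrable.1 (memLp_matCLM h1))
    · exact hA.integrable (by exact_mod_cast Nat.succ_pos m)
  · rcases m with - | m
    · simp only [pow_zero]
      exact integrable_const _
    · exact hA.integrable_norm_pow (Nat.succ_ne_zero m)

namespace Admissible

theorem isFiniteMeasure (h : Admissible Ω u Du) : IsFiniteMeasure (volume.restrict Ω) :=
  isFiniteMeasure_restrict.2 h.isBounded.measure_lt_top.ne

theorem ae_hasApproxDerivAt (h : Admissible Ω u Du) :
    ∀ᵐ x ∂volume.restrict Ω, HasApproxDerivAt u (matCLM (Du x)) x :=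
  h.weak.ae_hasApproxDerivAt h.isOpen h.integrable h.integrable_grad

theorem graphPairing_eq (h : Admissible Ω u Du)
    (η : Prd (m + 1) → Prd (m + 1) [⋀^Fin (m + 1)]→L[ℝ] ℝ) :
    graphPairing Ω u η = ∫ x in Ω, η (pt x (u x)) (tangents (matCLM (Du x))) :=
  graphPairing_eq_integral h.isOpen h.integrable.aestronglyMeasurable
    h.integrable_grad.aestronglyMeasurable h.ae_hasApproxDerivAt η

theorem integrable_iff (h : Admissible Ω u Du)
    (η : Prd (m + 1) → Prd (m + 1) [⋀^Fin (m + 1)]→L[ℝ] ℝ) :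
    Integrable (graphDensity u η) (graphMeasure Ω u)
      ↔ IntegrableOn (fun x => η (pt x (u x)) (tangents (matCLM (Du x)))) Ω :=
  integrable_graphDensity_iff h.isOpen h.integrable.aestronglyMeasurable
    h.integrable_grad.aestronglyMeasurable h.ae_hasApproxDerivAt η

/-- `(1 + ‖Du‖)^m` is integrable, as `(1 + t)^m ≤ 2^(m-1) (1 + t^m)`. -/
theorem integrable_one_add_pow (h : Admissible Ω u Du) :
    IntegrableOn (fun x => (1 + ‖matCLM (Du x)‖) ^ m) Ω := by
  have := h.isFiniteMeasure
  refine Integrable.mono' (((integrable_const (1 : ℝ)).add h.integrable_pow).const_mul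
    (2 ^ (m - 1))) ?_ (Eventually.of_forall fun x => ?_)
  · exact (aestronglyMeasurable_const.add h.integrable_grad.aestronglyMeasurable.norm).pow m
  · rw [Real.norm_of_nonneg (by positivity)]
    have := add_pow_le zero_le_one (norm_nonneg (matCLM (Du x))) m
    simpa using this

end Admissible

theorem continuous_tangents {n : ℕ} : Continuous (tangents (n := n)) := by
  refine continuous_pi fun i => ?_
  unfold tangents
  exact continuous_pt.comp (continuous_const.prodMk (continuous_id.clm_apply continuous_const))

theorem continuous_form_tangents {n : ℕ} {η : Prd n → Prd n [⋀^Fin n]→L[ℝ] ℝ}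
    (hη : Continuous η) :
    Continuous fun q : (Space n × Space n) × (Space n →L[ℝ] Space n) =>
      η (pt q.1.1 q.1.2) (tangents q.2) := by
  have h1 : Continuous fun q : (Space n × Space n) × (Space n →L[ℝ] Space n) =>
      η (pt q.1.1 q.1.2) := hη.comp (continuous_pt.comp continuous_fst)
  have h2 : Continuous fun q : (Space n × Space n) × (Space n →L[ℝ] Space n) => tangents q.2 :=
    continuous_tangents.comp continuous_snd
  exact h1.eval h2

theorem abs_form_stdVec_le {n : ℕ} (θ : Prd n [⋀^Fin n]→L[ℝ] ℝ) :
    |θ fun i => pt 0 (stdVec i)| ≤ ‖θ‖ := by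
  refine (θ.le_opNorm _).trans_eq ?_
  simp [norm_pt_zero_left]

theorem abs_form_tangents_le {θ : Prd (m + 1) [⋀^Fin (m + 1)]→L[ℝ] ℝ} {C : ℝ} (hC : ‖θ‖ ≤ C)
    (M : Matrix (Fin (m + 1)) (Fin (m + 1)) ℝ) :
    |θ (tangents (matCLM M))| ≤ |M.det| * C + 2 ^ (m + 1) * C * (1 + ‖matCLM M‖) ^ m := by
  have h1 := abs_form_tangents_sub_le θ (matCLM M)
  rw [det_matCLM] at h1
  have h2 : |M.det * θ fun i => pt 0 (stdVec i)| ≤ |M.det| * C := by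
    rw [abs_mul]
    gcongr
    exact (abs_form_stdVec_le θ).trans hC
  have h3 : 2 ^ (m + 1) * ‖θ‖ * (1 + ‖matCLM M‖) ^ m
      ≤ 2 ^ (m + 1) * C * (1 + ‖matCLM M‖) ^ m := by
    gcongr
  have h4 := abs_sub_abs_le_abs_sub (θ (tangents (matCLM M)))
    (M.det * θ fun i => pt 0 (stdVec i))
  linarith

theorem exists_norm_le_of_hasCompactSupport {X E : Type*} [TopologicalSpace X]
    [NormedAddCommGroup E] {f : X → E} (hf : Continuous f) (hfc : HasCompactSupport f) :
    ∃ C, 0 ≤ C ∧ ∀ x, ‖f x‖ ≤ C := by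
  obtain ⟨C, hC⟩ := hfc.exists_bound_of_continuous hf
  exact ⟨max C 0, le_max_right _ _, fun x => (hC x).trans (le_max_left _ _)⟩

namespace Admissible

/-- The `n × n` minor of `Du` enters the pairing only through the purely vertical part of the form;
it is integrable by assumption, and all other minors have order at most `n - 1`. -/
theorem integrableOn_form_tangents (h : Admissible Ω u Du)
    {η : Prd (m + 1) → Prd (m + 1) [⋀^Fin (m + 1)]→L[ℝ] ℝ} (hη : Continuous η)
    (hηc : HasCompactSupport η) :
    IntegrableOn (fun x => η (pt x (u x)) (tangents (matCLM (Du x)))) Ω := by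
  obtain ⟨C, hC0, hC⟩ := exists_norm_le_of_hasCompactSupport hη hηc
  refine Integrable.mono' ((h.integrable_det.norm.mul_const C).add
    (h.integrable_one_add_pow.const_mul (2 ^ (m + 1) * C))) ?_ (Eventually.of_forall fun x => ?_)
  · exact (continuous_form_tangents hη).comp_aestronglyMeasurable
      ((aestronglyMeasurable_id.prodMk h.integrable.aestronglyMeasurable).prodMk
        h.integrable_grad.aestronglyMeasurable)
  · rw [Real.norm_eq_abs]
    exact abs_form_tangents_le (hC _) _

theorem graphIntegrable (h : Admissible Ω u Du) : GraphIntegrable Ω u := fun η =>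
  (h.integrable_iff _).2 (h.integrableOn_form_tangents η.2.1.continuous η.2.2.1)

theorem graphCurrent_apply (h : Admissible Ω u Du) (η : testForms (cylinder Ω) (m + 1)) :
    graphCurrent Ω u η = graphPairing Ω u (η : Prd (m + 1) → _) := by
  rw [graphCurrent, dif_pos h.graphIntegrable]
  rfl

theorem boundary_apply (h : Admissible Ω u Du) (η : testForms (cylinder Ω) m) :
    (graphCurrent Ω u).boundary η
      = ∫ x in Ω, extDeriv (η : Prd (m + 1) → Prd (m + 1) [⋀^Fin m]→L[ℝ] ℝ) (pt x (u x))
          (tangents (matCLM (Du x))) := by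
  rw [← h.graphPairing_eq]
  exact h.graphCurrent_apply _

end Admissible

theorem contDiff_verticalForm {r : WithTop ℕ∞} {f : Prd (m + 1) → Space (m + 1)}
    (hf : ContDiff ℝ r f) : ContDiff ℝ r (verticalForm f) := by
  unfold verticalForm
  refine ContDiff.sum fun j _ => ContDiff.fun_smul ?_ contDiff_const
  exact contDiff_const.mul ((EuclideanSpace.proj j : Space (m + 1) →L[ℝ] ℝ).contDiff.comp hf)

theorem support_verticalForm_subset (f : Prd (m + 1) → Space (m + 1)) :
    Function.support (verticalForm f) ⊆ Function.support f := by
  intro p hp hf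
  refine hp ?_
  simp [verticalForm, hf]

theorem hasCompactSupport_verticalForm {f : Prd (m + 1) → Space (m + 1)}
    (hf : HasCompactSupport f) : HasCompactSupport (verticalForm f) :=
  hf.mono (support_verticalForm_subset f)

theorem continuous_extDeriv {n k : ℕ} {η : Prd n → Prd n [⋀^Fin k]→L[ℝ] ℝ} (hη : ContDiff ℝ 1 η) :
    Continuous (extDeriv η) :=
  (ContinuousAlternatingMap.alternatizeUncurryFinCLM ℝ (Prd n) ℝ (n := k)).continuous.comp
    (hη.continuous_fderiv one_ne_zero)

namespace Admissible

theorem energyDensity_eq {f : Prd (m + 1) → Space (m + 1)} (hf : ContDiff ℝ 1 f) :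
    energyDensity u Du f = fun x =>
      extDeriv (verticalForm f) (pt x (u x)) (tangents (matCLM (Du x))) :=
  funext fun x => (extDeriv_verticalForm_tangents u Du x (hf.differentiable one_ne_zero _)).symm

theorem integrableOn_extDeriv_verticalForm (h : Admissible Ω u Du)
    {f : Prd (m + 1) → Space (m + 1)} (hf : IsTestField Ω f) :
    IntegrableOn (fun x => extDeriv (verticalForm f) (pt x (u x)) (tangents (matCLM (Du x)))) Ω :=
  h.integrableOn_form_tangents (continuous_extDeriv (contDiff_verticalForm hf.1))
    ((hasCompactSupport_verticalForm hf.2.1).mono' (support_extDeriv_subset _))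

theorem energyFunctional_eq_graphPairing (h : Admissible Ω u Du)
    {f : Prd (m + 1) → Space (m + 1)} (hf : IsTestField Ω f) :
    energyFunctional Ω u Du f = graphPairing Ω u (extDeriv (verticalForm f)) := by
  rw [h.graphPairing_eq, energyFunctional, energyDensity_eq hf.1]

theorem energyFunctional_eq_boundary (h : Admissible Ω u Du)
    {f : Prd (m + 1) → Space (m + 1)} (hf : IsTestField Ω f)
    (hω : verticalForm f ∈ testForms (cylinder Ω) m) :
    energyFunctional Ω u Du f = (graphCurrent Ω u).boundary ⟨verticalForm f, hω⟩ := by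
  rw [h.boundary_apply, energyFunctional, energyDensity_eq hf.1]

end Admissible

end

section

/-! ### Stokes' theorem on the graph of a smooth map -/

theorem contDiff_form_apply {X E : Type*} [NormedAddCommGroup X] [NormedSpace ℝ X]
    [NormedAddCommGroup E] [NormedSpace ℝ E] {k : ℕ} {r : WithTop ℕ∞}
    {θ : X → E [⋀^Fin k]→L[ℝ] ℝ} {v : Fin k → X → E} (hθ : ContDiff ℝ r θ)
    (hv : ∀ i, ContDiff ℝ r (v i)) : ContDiff ℝ r fun x => θ x fun i => v i x := by
  -- evaluation is analytic, being linear in the form and multilinear in the vectors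
  have h1 : ContDiff ℝ r fun q : (E [⋀^Fin k]→L[ℝ] ℝ) × (Fin k → E) => q.1 q.2 := by
    let J : (E [⋀^Fin k]→L[ℝ] ℝ) →L[ℝ] ContinuousMultilinearMap ℝ (fun _ : Fin k => E) ℝ :=
      ContinuousAlternatingMap.toContinuousMultilinearMapCLM ℝ
    have := (J.analyticOnNhd_uncurry_of_multilinear (s := Set.univ)).analyticOn.contDiffOn
      (n := r) uniqueDiffOn_univ
    exact contDiffOn_univ.1 this
  exact h1.comp (hθ.prodMk (contDiff_pi.2 hv))

theorem integral_fderiv_eq_zero {n : ℕ} {g : Space n → ℝ} (hg : ContDiff ℝ 1 g)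
    (hgc : HasCompactSupport g) (v : Space n) : ∫ x, fderiv ℝ g x v = 0 := by
  have hc : Continuous fun x => fderiv ℝ g x v :=
    (hg.continuous_fderiv one_ne_zero).clm_apply continuous_const
  have hi : Integrable fun x => fderiv ℝ g x v :=
    hc.integrable_of_hasCompactSupport (hgc.fderiv_apply ℝ v)
  have h := integral_mul_fderiv_eq_neg_fderiv_mul_of_integrable (𝕜 := ℝ) (μ := volume)
    (f := fun _ : Space n => (1 : ℝ)) (g := g) (v := v) (by simp) (by simpa using hi)
    (by simpa using hg.continuous.integrable_of_hasCompactSupport hgc)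
    (fun x _ => differentiableAt_const _) (fun x _ => hg.differentiable one_ne_zero x)
  simpa using h

theorem mem_xPart_image_tsupport {n k : ℕ} {η : Prd n → Prd n [⋀^Fin k]→L[ℝ] ℝ} {x y : Space n}
    (h : η (pt x y) ≠ 0) : x ∈ xPart '' tsupport η :=
  ⟨pt x y, subset_tsupport _ h, xPart_pt x y⟩

theorem isCompact_xPart_image_tsupport {n k : ℕ} {η : Prd n → Prd n [⋀^Fin k]→L[ℝ] ℝ}
    (hη : HasCompactSupport η) : IsCompact (xPart '' tsupport η) :=
  IsCompact.image hη continuous_xPart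

theorem hasFDerivAt_graph {n : ℕ} {v : Space n → Space n} {A : Space n →L[ℝ] Space n}
    {x : Space n} (hv : HasFDerivAt v A x) :
    HasFDerivAt (fun x => pt x (v x)) (graphLin A) x := by
  have : (fun x => pt x (v x)) = fun x => xEmb n x + yEmb n (v x) := funext fun x => pt_eq_add _ _
  rw [this]
  exact (xEmb n).hasFDerivAt.add ((yEmb n).hasFDerivAt.comp x hv)

theorem contDiff_graph {n : ℕ} {r : WithTop ℕ∞} {v : Space n → Space n} (hv : ContDiff ℝ r v) :
    ContDiff ℝ r fun x => pt x (v x) := by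
  have : (fun x => pt x (v x)) = fun x => xEmb n x + yEmb n (v x) := funext fun x => pt_eq_add _ _
  rw [this]
  exact (xEmb n).contDiff.add ((yEmb n).contDiff.comp hv)

/-- The graph of a smooth map has no boundary. -/
theorem integral_extDeriv_graph_eq_zero {m : ℕ} {v : Space (m + 1) → Space (m + 1)}
    (hv : ContDiff ℝ ∞ v) {η : Prd (m + 1) → Prd (m + 1) [⋀^Fin m]→L[ℝ] ℝ} (hη : ContDiff ℝ ∞ η)
    (hηc : HasCompactSupport η) :
    ∫ x, extDeriv η (pt x (v x)) (tangents (fderiv ℝ v x)) = 0 := by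
  set Φ : Space (m + 1) → Prd (m + 1) := fun x => pt x (v x)
  have hΦ : ContDiff ℝ ∞ Φ := contDiff_graph hv
  have hΦ' : ContDiff ℝ ∞ (fderiv ℝ Φ) := hΦ.fderiv_right (m := ∞) (by simp)
  have hΦd : ∀ x, fderiv ℝ Φ x = graphLin (fderiv ℝ v x) := fun x =>
    (hasFDerivAt_graph (hv.differentiable (by simp) x).hasFDerivAt).fderiv
  -- the pullback of `η`; its exterior derivative is a divergence in coordinates
  set ζ : Space (m + 1) → Space (m + 1) [⋀^Fin m]→L[ℝ] ℝ :=
    fun x => (η (Φ x)).compContinuousLinearMap (fderiv ℝ Φ x)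
  have hζd : ∀ x, DifferentiableAt ℝ ζ x := fun x =>
    ((hη.comp hΦ).differentiable (by simp) x).continuousAlternatingMapCompContinuousLinearMap
      (hΦ'.differentiable (by simp) x)
  set g : Fin (m + 1) → Space (m + 1) → ℝ := fun i x => ζ x (i.removeNth fun j => stdVec j)
  have hg : ∀ i, ContDiff ℝ 1 (g i) := fun i => by
    have : ContDiff ℝ ∞ (g i) := by
      exact contDiff_form_apply (v := fun j x => fderiv ℝ Φ x (i.removeNth (fun j => stdVec j) j))
        (hη.comp hΦ) fun j => hΦ'.clm_apply contDiff_const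
    exact this.of_le (by simp)
  have hgc : ∀ i, HasCompactSupport (g i) := fun i => by
    refine HasCompactSupport.intro (isCompact_xPart_image_tsupport hηc) fun x hx => ?_
    have : η (Φ x) = 0 := by
      by_contra h
      exact hx (mem_xPart_image_tsupport h)
    simp [g, ζ, this]
  have hpt : ∀ x, extDeriv η (Φ x) (tangents (fderiv ℝ v x))
      = ∑ i : Fin (m + 1), (-1) ^ i.val • fderiv ℝ (g i) x (stdVec i) := fun x => by
    have h1 := extDeriv_pullback (r := ∞) (hη.differentiable (by simp) (Φ x)) hΦ.contDiffAt
      (x := x) (by rw [minSmoothness_of_isRCLikeNormedField]; exact WithTop.coe_le_coe.2 le_top)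
    have h2 := extDeriv_apply (hζd x) fun j => stdVec j
    have h3 : extDeriv ζ x (fun j => stdVec j) = extDeriv η (Φ x) (tangents (fderiv ℝ v x)) := by
      rw [h1, ContinuousAlternatingMap.compContinuousLinearMap_apply, hΦd]
      congr 1
      funext i
      exact graphLin_apply _ _
    rw [← h3, h2]
  have hint : ∀ i, Integrable fun x => fderiv ℝ (g i) x (stdVec i) := fun i =>
    (((hg i).continuous_fderiv one_ne_zero).clm_apply
      continuous_const).integrable_of_hasCompactSupport ((hgc i).fderiv_apply ℝ _)
  change ∫ x, extDeriv η (Φ x) (tangents (fderiv ℝ v x)) = 0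
  simp_rw [hpt, zsmul_eq_mul]
  rw [integral_finsetSum _ fun i _ => (hint i).const_mul _]
  refine Finset.sum_eq_zero fun i _ => ?_
  rw [integral_const_mul, integral_fderiv_eq_zero (hg i) (hgc i), mul_zero]

/-! ### Convergence tools -/

theorem isProbabilityMeasure_mollifier {ι : Type*} [Fintype ι] (k : ℕ) :
    IsProbabilityMeasure (volume.withDensity fun t => ENNReal.ofReal (mollifier ι k t)) :=
  ⟨by
    rw [withDensity_apply _ MeasurableSet.univ, Measure.restrict_univ,
      ← lintegral_mollifier (ι := ι) k]
    exact lintegral_congr fun x => (Real.enorm_of_nonneg (mollifier_nonneg k x)).symm⟩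

/-- Jensen's inequality for the averages `mollify k f`. -/
theorem norm_mollify_pow_le {ι E : Type*} [Fintype ι] [NormedAddCommGroup E] [NormedSpace ℝ E]
    [CompleteSpace E] (k m : ℕ) {f : EuclideanSpace ℝ ι → E} (hf : LocallyIntegrable f)
    (hfm : LocallyIntegrable fun x => ‖f x‖ ^ m) (x : EuclideanSpace ℝ ι) :
    ‖mollify k f x‖ ^ m ≤ mollify k (fun x => ‖f x‖ ^ m) x := by
  have hρ : Measurable fun t => ENNReal.ofReal (mollifier ι k t) :=
    (contDiff_mollifier k).continuous.measurable.ennreal_ofReal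
  have hfin : ∀ᵐ t : EuclideanSpace ℝ ι, ENNReal.ofReal (mollifier ι k t) < ⊤ :=
    Eventually.of_forall fun _ => ENNReal.ofReal_lt_top
  have := isProbabilityMeasure_mollifier (ι := ι) k
  have h1 := (((convexOn_norm convex_univ).pow (fun x _ => norm_nonneg x) m :
    ConvexOn ℝ Set.univ ((norm : E → ℝ) ^ m))).map_integral_le
    (μ := volume.withDensity fun t => ENNReal.ofReal (mollifier ι k t))
    (f := fun t => f (x - t)) (continuous_norm.pow m).continuousOn isClosed_univ
    (Eventually.of_forall fun _ => Set.mem_univ _) ?_ ?_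
  · rw [integral_withDensity_eq_integral_toReal_smul hρ hfin,
      integral_withDensity_eq_integral_toReal_smul hρ hfin] at h1
    simpa [mollify_apply, ENNReal.toReal_ofReal (mollifier_nonneg k _)] using h1
  · rw [integrable_withDensity_iff_integrable_smul' hρ hfin]
    simpa [ENNReal.toReal_ofReal (mollifier_nonneg k _)] using integrable_mollifier_smul k hf x
  · rw [integrable_withDensity_iff_integrable_smul' hρ hfin]
    simpa [ENNReal.toReal_ofReal (mollifier_nonneg k _)] using integrable_mollifier_smul k hfm x

theorem integral_mollify {ι E : Type*} [Fintype ι] [NormedAddCommGroup E] [NormedSpace ℝ E]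
    [CompleteSpace E] (k : ℕ) {f : EuclideanSpace ℝ ι → E} (hf : Integrable f) :
    ∫ x, mollify k f x = ∫ x, f x := by
  unfold mollify
  rw [integral_convolution _ (integrable_mollifier k) hf, integral_mollifier]
  simp

theorem integrable_mollify {ι E : Type*} [Fintype ι] [NormedAddCommGroup E] [NormedSpace ℝ E]
    (k : ℕ) {f : EuclideanSpace ℝ ι → E} (hf : Integrable f) : Integrable (mollify k f) :=
  (integrable_mollifier k).integrable_convolution _ hf

/-- If `T k` has integral zero and is dominated by functions `G k` whose integrals converge to that
of their limit, the limit of `T k` has nonpositive integral: this is Fatou's lemma for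
`G k + T k ≥ 0`. -/
theorem integral_nonpos_of_tendsto {α : Type*} [MeasurableSpace α] {μ : Measure α}
    {T G : ℕ → α → ℝ} {T' G' : α → ℝ} (hT : ∀ k, Integrable (T k) μ)
    (hT0 : ∀ k, ∫ x, T k x ∂μ = 0) (hG : ∀ k, Integrable (G k) μ)
    (hGc : ∀ k, ∫ x, G k x ∂μ = ∫ x, G' x ∂μ) (hTG : ∀ k x, |T k x| ≤ G k x)
    (hT' : Integrable T' μ) (hG' : Integrable G' μ)
    (hTlim : ∀ᵐ x ∂μ, Tendsto (fun k => T k x) atTop (𝓝 (T' x)))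
    (hGlim : ∀ᵐ x ∂μ, Tendsto (fun k => G k x) atTop (𝓝 (G' x))) :
    ∫ x, T' x ∂μ ≤ 0 := by
  have hpos : ∀ k x, 0 ≤ G k x + T k x := fun k x => by
    linarith [neg_abs_le (T k x), hTG k x]
  have hlim : ∀ᵐ x ∂μ, Tendsto (fun k => G k x + T k x) atTop (𝓝 (G' x + T' x)) := by
    filter_upwards [hTlim, hGlim] with x h1 h2 using h2.add h1
  have hpos' : 0 ≤ᵐ[μ] fun x => G' x + T' x := by
    filter_upwards [hlim] with x hx
    exact ge_of_tendsto' hx fun k => hpos k x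
  have hval : ∀ k, ∫⁻ x, ENNReal.ofReal (G k x + T k x) ∂μ
      = ENNReal.ofReal (∫ x, G' x ∂μ) := fun k => by
    rw [← ofReal_integral_eq_lintegral_ofReal (f := fun x => G k x + T k x)
      ((hG k).add (hT k)) (Eventually.of_forall (hpos k)), integral_add (hG k) (hT k), hT0,
      hGc, add_zero]
  have hG0 : 0 ≤ ∫ x, G' x ∂μ := by
    rw [← hGc 0]
    exact integral_nonneg fun x => (abs_nonneg _).trans (hTG 0 x)
  have hfatou : ∫⁻ x, ENNReal.ofReal (G' x + T' x) ∂μ ≤ ENNReal.ofReal (∫ x, G' x ∂μ) := by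
    calc ∫⁻ x, ENNReal.ofReal (G' x + T' x) ∂μ
        = ∫⁻ x, liminf (fun k => ENNReal.ofReal (G k x + T k x)) atTop ∂μ := by
          refine lintegral_congr_ae ?_
          filter_upwards [hlim] with x hx
          exact ((ENNReal.continuous_ofReal.tendsto _).comp hx).liminf_eq.symm
      _ ≤ liminf (fun k => ∫⁻ x, ENNReal.ofReal (G k x + T k x) ∂μ) atTop :=
          lintegral_liminf_le' fun k => ((hG k).add (hT k)).aemeasurable.ennreal_ofReal
      _ = ENNReal.ofReal (∫ x, G' x ∂μ) := by simp_rw [hval]; exact liminf_const _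
  rw [← ofReal_integral_eq_lintegral_ofReal (f := fun x => G' x + T' x) (hG'.add hT') hpos',
    ENNReal.ofReal_le_ofReal_iff hG0,
    integral_add hG' hT'] at hfatou
  linarith

/-! ### The boundary of the graph only sees vertical directions -/

section

variable {m : ℕ}

/-- A form that vanishes on vertical vectors has an exterior derivative that vanishes on vertical
vectors, so that the determinant does not enter its pairing with the graph. -/
theorem extDeriv_vertical_eq_zero {η : Prd (m + 1) → Prd (m + 1) [⋀^Fin m]→L[ℝ] ℝ}
    (hη : Differentiable ℝ η) (hv : ∀ (p : Prd (m + 1)) (w : Fin m → Space (m + 1)),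
      η p (fun i => pt 0 (w i)) = 0) (p : Prd (m + 1)) :
    extDeriv η p (fun i => pt 0 (stdVec i)) = 0 := by
  rw [extDeriv_apply (hη p)]
  refine Finset.sum_eq_zero fun i _ => ?_
  have : (fun q => η q (i.removeNth fun j => pt 0 (stdVec j))) = fun _ => (0 : ℝ) :=
    funext fun q => hv q (i.removeNth fun j => stdVec j)
  rw [this]
  simp

/-- The bound is by a function of `x` and `A` only, of growth `‖A‖^m` instead of `‖A‖^(m + 1)`. -/
theorem exists_abs_extDeriv_tangents_le {η : Prd (m + 1) → Prd (m + 1) [⋀^Fin m]→L[ℝ] ℝ}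
    (hη : ContDiff ℝ ∞ η) (hηc : HasCompactSupport η)
    (hv : ∀ (p : Prd (m + 1)) (w : Fin m → Space (m + 1)),
      η p (fun i => pt 0 (w i)) = 0) :
    ∃ C, 0 ≤ C ∧ ∀ x y A, |extDeriv η (pt x y) (tangents A)|
      ≤ C * ((xPart '' tsupport η).indicator 1 x + ‖A‖ ^ m) := by
  obtain ⟨C, hC0, hC⟩ := exists_norm_le_of_hasCompactSupport
    (continuous_extDeriv (hη.of_le (by simp))) (hηc.mono' (support_extDeriv_subset η))
  refine ⟨2 ^ (m + 1) * C * 2 ^ (m - 1), by positivity, fun x y A => ?_⟩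
  by_cases h0 : extDeriv η (pt x y) = 0
  · rw [h0]
    change |(0 : ℝ)| ≤ _
    rw [abs_zero]
    have : (0 : ℝ) ≤ (xPart '' tsupport η).indicator 1 x :=
      Set.indicator_nonneg (fun _ _ => zero_le_one) x
    positivity
  · have hx : x ∈ xPart '' tsupport η :=
      ⟨pt x y, support_extDeriv_subset η h0, xPart_pt x y⟩
    have h1 := abs_form_tangents_sub_le (extDeriv η (pt x y)) A
    rw [extDeriv_vertical_eq_zero (hη.differentiable (by simp)) hv, mul_zero, sub_zero] at h1
    have h2 := add_pow_le zero_le_one (norm_nonneg A) m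
    rw [Set.indicator_of_mem hx, Pi.one_apply]
    calc _ ≤ 2 ^ (m + 1) * ‖extDeriv η (pt x y)‖ * (1 + ‖A‖) ^ m := h1
      _ ≤ 2 ^ (m + 1) * C * (2 ^ (m - 1) * (1 ^ m + ‖A‖ ^ m)) := by gcongr; exact hC _
      _ = _ := by rw [one_pow]; ring

variable {Ω : Set (Space (m + 1))} {u : Space (m + 1) → Space (m + 1)}
  {Du : Space (m + 1) → Matrix (Fin (m + 1)) (Fin (m + 1)) ℝ}

theorem extDeriv_pt_eq_zero {n k : ℕ} {η : Prd n → Prd n [⋀^Fin k]→L[ℝ] ℝ} {x y : Space n}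
    (hx : x ∉ xPart '' tsupport η) : extDeriv η (pt x y) = 0 := by
  by_contra h
  exact hx ⟨pt x y, support_extDeriv_subset η h, xPart_pt x y⟩

/-- Approximating `u` by its mollifications, whose graphs have no boundary. The integrands are
dominated by `C (1 + ‖D u_k‖^m)`, since the determinant does not enter; by Jensen's inequality and
Fatou's lemma one may pass to the limit. -/
theorem Admissible.integral_extDeriv_nonpos (h : Admissible Ω u Du)
    {η : Prd (m + 1) → Prd (m + 1) [⋀^Fin m]→L[ℝ] ℝ} (hη : η ∈ testForms (cylinder Ω) m)
    (hv : ∀ (p : Prd (m + 1)) (w : Fin m → Space (m + 1)),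
      η p (fun i => pt 0 (w i)) = 0) :
    ∫ x in Ω, extDeriv η (pt x (u x)) (tangents (matCLM (Du x))) ≤ 0 := by
  obtain ⟨hη1, hη2, hη3⟩ := hη
  set K := xPart '' tsupport η with hK_def
  have hK : IsCompact K := isCompact_xPart_image_tsupport hη2
  have hKΩ : K ⊆ Ω := by
    rintro _ ⟨p, hp, rfl⟩
    exact hη3 hp
  obtain ⟨C, hC0, hC⟩ := exists_abs_extDeriv_tangents_le hη1 hη2 hv
  obtain ⟨δ, hδ, hδΩ⟩ := hK.exists_cthickening_subset_open h.isOpen hKΩ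
  obtain ⟨k₀, hk₀⟩ := exists_nat_one_div_lt hδ
  rcases m.eq_zero_or_pos with rfl | hm
  · -- a function that vanishes on the empty family of vertical vectors is zero
    have h0 : η = 0 := by
      funext p
      ext w
      rw [Subsingleton.elim w fun i => pt 0 ((fun _ => 0 : Fin 0 → Space 1) i)]
      exact hv p _
    refine (integral_eq_zero_of_ae (Eventually.of_forall fun x => ?_)).le
    have : (xPart '' tsupport η) = ∅ := by rw [h0]; simp [tsupport]
    change extDeriv η (pt x (u x)) _ = 0
    rw [extDeriv_pt_eq_zero (by simp [this])]
    rfl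
  set U : Space (m + 1) → Space (m + 1) := Ω.indicator u
  set D : Space (m + 1) → Space (m + 1) →L[ℝ] Space (m + 1) := Ω.indicator fun x => matCLM (Du x)
  have hU : Integrable U := integrable_indicator_of_integrableOn h.isOpen h.integrable
  have hD : Integrable D := integrable_indicator_of_integrableOn h.isOpen h.integrable_grad
  have hDm : Integrable fun x => ‖D x‖ ^ m := by
    have : (fun x => ‖D x‖ ^ m) = Ω.indicator fun x => ‖matCLM (Du x)‖ ^ m := by
      funext x
      by_cases hx : x ∈ Ω
      · simp [D, hx]
      · simp [D, hx, hm.ne']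
    rw [this]
    exact integrable_indicator_of_integrableOn h.isOpen h.integrable_pow
  set F : Space (m + 1) → Space (m + 1) → (Space (m + 1) →L[ℝ] Space (m + 1)) → ℝ :=
    fun x y A => extDeriv η (pt x y) (tangents A)
  have hF : Continuous fun q : (Space (m + 1) × Space (m + 1)) ×
      (Space (m + 1) →L[ℝ] Space (m + 1)) => F q.1.1 q.1.2 q.2 :=
    continuous_form_tangents (continuous_extDeriv (hη1.of_le (by simp)))
  have hF0 : ∀ x ∉ K, ∀ y A, F x y A = 0 := fun x hx y A => by
    change extDeriv η (pt x y) _ = 0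
    rw [extDeriv_pt_eq_zero hx]
    rfl
  have hTΩ : (fun x => F x (U x) (D x)) = Ω.indicator fun x => F x (u x) (matCLM (Du x)) := by
    funext x
    by_cases hx : x ∈ Ω
    · simp [U, D, hx]
    · rw [Set.indicator_of_notMem hx, hF0 x fun hxK => hx (hKΩ hxK)]
  have hT' : Integrable fun x => F x (U x) (D x) := by
    rw [hTΩ]
    exact integrable_indicator_of_integrableOn h.isOpen (h.integrableOn_form_tangents
      (continuous_extDeriv (hη1.of_le (by simp))) (hη2.mono' (support_extDeriv_subset η)))
  have hKi : Integrable (K.indicator (1 : Space (m + 1) → ℝ)) :=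
    (integrable_indicator_iff hK.measurableSet).2
      (integrableOn_const hK.measure_lt_top.ne)
  -- from the index `k₀` on, the mollified gradient is the gradient of the mollification on `K`
  have hstokes : ∀ k, ∫ x, F x (mollify (k + k₀) U x) (mollify (k + k₀) D x) = 0 := fun k => by
    rw [← integral_extDeriv_graph_eq_zero (contDiff_mollify (k + k₀) hU.locallyIntegrable) hη1 hη2]
    congr 1
    funext x
    by_cases hx : x ∈ K
    · have hball : Metric.closedBall x (1 / (((k + k₀ : ℕ) : ℝ) + 1)) ⊆ Ω := by
        refine (Metric.closedBall_subset_closedBall ?_).trans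
          ((Metric.closedBall_subset_cthickening hx δ).trans hδΩ)
        refine le_trans ?_ hk₀.le
        push_cast
        gcongr
        linarith [(Nat.cast_nonneg k : (0 : ℝ) ≤ k)]
      rw [(h.weak.hasFDerivAt_mollify h.isOpen h.integrable h.integrable_grad (k + k₀)
        hball).fderiv]
    · rw [hF0 x hx]
      exact (hF0 x hx _ _).symm
  have hmU : ∀ k, Continuous (mollify k U) := fun k =>
    (contDiff_mollify k hU.locallyIntegrable).continuous
  have hmD : ∀ k, Continuous (mollify k D) := fun k =>
    (contDiff_mollify k hD.locallyIntegrable).continuous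
  have hle := integral_nonpos_of_tendsto (μ := volume)
    (T := fun k x => F x (mollify (k + k₀) U x) (mollify (k + k₀) D x))
    (G := fun k x => C * (K.indicator 1 x + mollify (k + k₀) (fun x => ‖D x‖ ^ m) x))
    (T' := fun x => F x (U x) (D x)) (G' := fun x => C * (K.indicator 1 x + ‖D x‖ ^ m))
    (fun k => ?_) hstokes (fun k => (hKi.add (integrable_mollify _ hDm)).const_mul C)
    (fun k => ?_) (fun k x => ?_) hT' ((hKi.add hDm).const_mul C) ?_ ?_
  · rwa [hTΩ, integral_indicator h.isOpen.measurableSet] at hle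
  · refine Continuous.integrable_of_hasCompactSupport
      (hF.comp ((continuous_id.prodMk (hmU _)).prodMk (hmD _))) ?_
    exact HasCompactSupport.intro hK fun x hx => hF0 x hx _ _
  · rw [integral_const_mul, integral_const_mul, integral_add hKi (integrable_mollify _ hDm),
      integral_add hKi hDm, integral_mollify _ hDm]
  · refine (hC _ _ _).trans ?_
    gcongr
    exact norm_mollify_pow_le _ m hD.locallyIntegrable hDm.locallyIntegrable x
  · filter_upwards [ae_tendsto_mollify hU.locallyIntegrable,
      ae_tendsto_mollify hD.locallyIntegrable] with x h1 h2
    have h3 := (hF.tendsto ((x, U x), D x)).comp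
      ((tendsto_const_nhds.prodMk_nhds (h1.comp (tendsto_add_atTop_nat k₀))).prodMk_nhds
        (h2.comp (tendsto_add_atTop_nat k₀)))
    exact h3
  · filter_upwards [ae_tendsto_mollify hDm.locallyIntegrable] with x h1
    exact ((h1.comp (tendsto_add_atTop_nat k₀)).const_add _).const_mul C

/-- The boundary of the graph annihilates the forms that vanish on vertical vectors. -/
theorem Admissible.integral_extDeriv_eq_zero (h : Admissible Ω u Du)
    {η : Prd (m + 1) → Prd (m + 1) [⋀^Fin m]→L[ℝ] ℝ} (hη : η ∈ testForms (cylinder Ω) m)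
    (hv : ∀ (p : Prd (m + 1)) (w : Fin m → Space (m + 1)), η p (fun i => pt 0 (w i)) = 0) :
    ∫ x in Ω, extDeriv η (pt x (u x)) (tangents (matCLM (Du x))) = 0 := by
  refine le_antisymm (h.integral_extDeriv_nonpos hη hv) ?_
  have h1 := h.integral_extDeriv_nonpos (neg_mem hη) fun p w => by
    change -(η p _) = 0
    rw [hv, neg_zero]
  have h2 : ∀ p v, extDeriv (-η) p v = -extDeriv η p v := fun p v => by
    have := extDeriv_smul (x := p) (-1 : ℝ) η
    rw [neg_one_smul, neg_one_smul] at this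
    rw [this]
    rfl
  simp_rw [h2] at h1
  rw [integral_neg] at h1
  linarith

end

end

section

variable {m : ℕ}

/-! ### Vertical coefficients of a form -/

/-- An injective map from `m` to `m + 1` elements misses exactly one value. -/
theorem exists_eq_succAbove_comp_perm {J : Fin m → Fin (m + 1)} (hJ : Function.Injective J) :
    ∃ (j : Fin (m + 1)) (σ : Equiv.Perm (Fin m)), J = j.succAbove ∘ σ := by
  have hns : ¬ Function.Surjective J := fun hs => by
    have := Fintype.card_le_of_surjective J hs
    simp at this
  obtain ⟨j, hj⟩ := not_forall.1 hns
  have h1 : ∀ a, ∃ b, j.succAbove b = J a := fun a =>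
    Fin.exists_succAbove_eq fun h => hj ⟨a, h⟩
  choose σ hσ using h1
  have hσi : Function.Injective σ := fun a b hab => hJ (by rw [← hσ, ← hσ, hab])
  exact ⟨j, Equiv.ofBijective σ (Finite.injective_iff_bijective.1 hσi),
    funext fun a => (hσ a).symm⟩

/-- The multi-index of `m` vertical directions obtained from `(y_k)_{k ≠ j}` by the permutation
`σ`. -/
def vertIndex (q : Fin (m + 1) × Equiv.Perm (Fin m)) (a : Fin m) : Fin (m + 1) ⊕ Fin (m + 1) :=
  Sum.inr (q.1.succAbove (q.2 a))

theorem vertIndex_injective : Function.Injective (vertIndex (m := m)) := by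
  rintro ⟨j, σ⟩ ⟨j', σ'⟩ h
  have h1 : ∀ a, j.succAbove (σ a) = j'.succAbove (σ' a) := fun a =>
    Sum.inr_injective (congrFun h a)
  have hj : j = j' := by
    by_contra hne
    obtain ⟨b, hb⟩ := Fin.exists_succAbove_eq hne
    have := h1 (σ'.symm b)
    rw [Equiv.apply_symm_apply, hb] at this
    exact Fin.succAbove_ne _ _ this
  subst hj
  have : σ = σ' := Equiv.ext fun a => Fin.succAbove_right_injective (h1 a)
  rw [this]

/-- `vertIndex` as an embedding. -/
def vertIndexEmb (m : ℕ) :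
    (Fin (m + 1) × Equiv.Perm (Fin m)) ↪ (Fin m → Fin (m + 1) ⊕ Fin (m + 1)) :=
  ⟨vertIndex, vertIndex_injective⟩

/-- The coefficients of the form in the directions `(y_k)_{k ≠ j}`, with the signs of `ω_f`. -/
def vertPart (θ : Prd (m + 1) [⋀^Fin m]→L[ℝ] ℝ) : Space (m + 1) :=
  WithLp.toLp 2 fun j => (-1 : ℝ) ^ (j : ℕ) * θ fun a => pt 0 (stdVec (j.succAbove a))

theorem vertPart_apply (θ : Prd (m + 1) [⋀^Fin m]→L[ℝ] ℝ) (j : Fin (m + 1)) :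
    vertPart θ j = (-1 : ℝ) ^ (j : ℕ) * θ fun a => pt 0 (stdVec (j.succAbove a)) := rfl

theorem single_inr {n : ℕ} (j : Fin n) :
    (EuclideanSpace.single (Sum.inr j) 1 : Prd n) = pt 0 (stdVec j) := by
  ext (i | i) <;> simp [pt]

theorem neg_one_pow_mul_sq (k : ℕ) (x : ℝ) : ((-1) ^ k * x) ^ 2 = x ^ 2 := by
  rw [mul_pow, ← pow_mul, mul_comm k, pow_mul]; simp

theorem sq_form_vertIndex (θ : Prd (m + 1) [⋀^Fin m]→L[ℝ] ℝ)
    (q : Fin (m + 1) × Equiv.Perm (Fin m)) :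
    θ (fun a => EuclideanSpace.single (vertIndex q a) 1) ^ 2 = vertPart θ q.1 ^ 2 := by
  have h : (fun a => (EuclideanSpace.single (vertIndex q a) 1 : Prd (m + 1)))
      = (fun a => pt 0 (stdVec (q.1.succAbove a))) ∘ q.2 := by
    funext a
    exact single_inr _
  have h2 := θ.toAlternatingMap.map_perm (fun a => pt 0 (stdVec (q.1.succAbove a))) q.2
  have h3 : θ (fun a => EuclideanSpace.single (vertIndex q a) 1)
      = Equiv.Perm.sign q.2 • θ fun a => pt 0 (stdVec (q.1.succAbove a)) := by
    rw [h]; exact h2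
  rw [h3, vertPart_apply, neg_one_pow_mul_sq]
  rcases Int.units_eq_one_or (Equiv.Perm.sign q.2) with h | h <;> rw [h] <;> simp

/-- Each vertical coefficient occurs `m!` times, once for every order of its directions. -/
theorem sum_sq_form_vertIndex (θ : Prd (m + 1) [⋀^Fin m]→L[ℝ] ℝ) :
    ∑ I ∈ Finset.univ.map (vertIndexEmb m), θ (fun a => EuclideanSpace.single (I a) 1) ^ 2
      = ‖vertPart θ‖ ^ 2 * m.factorial := by
  rw [Finset.sum_map]
  change ∑ q, θ (fun a => EuclideanSpace.single (vertIndex q a) 1) ^ 2 = _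
  simp_rw [sq_form_vertIndex]
  rw [Fintype.sum_prod_type, EuclideanSpace.norm_sq_eq, Finset.sum_mul]
  refine Finset.sum_congr rfl fun j _ => ?_
  simp [Fintype.card_perm, mul_comm]

/-- The vertical coefficients are among the coefficients of the form. -/
theorem norm_vertPart_le (θ : Prd (m + 1) [⋀^Fin m]→L[ℝ] ℝ) : ‖vertPart θ‖ ≤ covectorNorm θ := by
  have hm : (0 : ℝ) < m.factorial := by exact_mod_cast m.factorial_pos
  refine Real.le_sqrt_of_sq_le ?_
  rw [le_div_iff₀ hm, ← sum_sq_form_vertIndex]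
  exact Finset.sum_le_univ_sum_of_nonneg fun I => sq_nonneg _

theorem dyHat_vert (j k : Fin (m + 1)) :
    dyHat k (fun a => pt 0 (stdVec (j.succAbove a))) = if k = j then 1 else 0 := by
  rw [dyHat_apply]
  split_ifs with h
  · subst h
    rw [← Matrix.det_one (n := Fin m)]
    congr 1
    ext a b
    simp [Matrix.one_apply, eq_comm]
  · obtain ⟨a, ha⟩ := Fin.exists_succAbove_eq h
    refine Matrix.det_eq_zero_of_row_eq_zero a fun b => ?_
    simp [ha, Fin.succAbove_ne]

theorem vertPart_verticalForm (f : Prd (m + 1) → Space (m + 1)) (p : Prd (m + 1)) :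
    vertPart (verticalForm f p) = f p := by
  ext j
  rw [vertPart_apply, verticalForm, ContinuousAlternatingMap.sum_apply]
  simp only [ContinuousAlternatingMap.smul_apply, dyHat_vert, smul_eq_mul, mul_ite, mul_one,
    mul_zero, Finset.sum_ite_eq', Finset.mem_univ, if_true]
  rw [← mul_assoc, ← mul_pow]
  simp

/-- The only nonzero coefficients of `ω_f` are those with index `vertIndex`. -/
theorem covectorNorm_verticalForm (f : Prd (m + 1) → Space (m + 1)) (p : Prd (m + 1)) :
    covectorNorm (verticalForm f p) = ‖f p‖ := by
  have hm : (0 : ℝ) < m.factorial := by exact_mod_cast m.factorial_pos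
  set θ := verticalForm f p with hθ
  have hsum : ∑ I : Fin m → Fin (m + 1) ⊕ Fin (m + 1),
      θ (fun a => EuclideanSpace.single (I a) 1) ^ 2
      = ∑ I ∈ Finset.univ.map (vertIndexEmb m),
        θ (fun a => EuclideanSpace.single (I a) 1) ^ 2 := by
    refine (Finset.sum_subset (Finset.subset_univ _) fun I _ hI => ?_).symm
    by_contra hne
    have hne' : θ (fun a => EuclideanSpace.single (I a) 1) ≠ 0 := fun h0 => hne (by simp [h0])
    have hinr : ∀ a, ∃ b, I a = Sum.inr b := fun a => by
      rcases hIa : I a with i | b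
      · refine absurd ?_ hne'
        rw [hθ, verticalForm, ContinuousAlternatingMap.sum_apply]
        refine Finset.sum_eq_zero fun k _ => ?_
        rw [ContinuousAlternatingMap.smul_apply, dyHat_apply,
          Matrix.det_eq_zero_of_row_eq_zero a fun b => by simp [hIa], smul_zero]
      · exact ⟨b, rfl⟩
    choose J hJ using hinr
    have hJi : Function.Injective J := fun a b hab => by
      by_contra hab'
      exact hne' (θ.map_eq_zero_of_eq _ (by rw [hJ, hJ, hab]) hab')
    obtain ⟨j, σ, rfl⟩ := exists_eq_succAbove_comp_perm hJi
    refine hI (Finset.mem_map.2 ⟨(j, σ), Finset.mem_univ _, ?_⟩)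
    funext a
    exact (hJ a).symm
  rw [covectorNorm, hsum, sum_sq_form_vertIndex, mul_div_cancel_right₀ _ hm.ne',
    Real.sqrt_sq (norm_nonneg _), hθ, vertPart_verticalForm]

/-- A form without vertical coefficients vanishes on vertical vectors. -/
theorem form_vertical_eq_zero {θ : Prd (m + 1) [⋀^Fin m]→L[ℝ] ℝ} (hθ : vertPart θ = 0)
    (w : Fin m → Space (m + 1)) : θ (fun i => pt 0 (w i)) = 0 := by
  let e := (EuclideanSpace.basisFun (Fin (m + 1)) ℝ).toBasis
  have he : ∀ i, e i = stdVec i := fun i => by simp [e]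
  have h : (θ.compContinuousLinearMap (yEmb (m + 1))).toAlternatingMap = 0 := by
    refine e.ext_alternating fun J hJ => ?_
    obtain ⟨j, σ, rfl⟩ := exists_eq_succAbove_comp_perm hJ
    have h1 := sq_form_vertIndex θ (j, σ)
    rw [hθ] at h1
    have h2 : θ (fun a => EuclideanSpace.single (vertIndex (j, σ) a) 1) = 0 := by
      simpa using h1
    simp only [vertIndex, single_inr] at h2
    simpa [he, Function.comp_def] using h2
  exact congrArg (fun g => g w) h

theorem vertPart_sub (θ θ' : Prd (m + 1) [⋀^Fin m]→L[ℝ] ℝ) :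
    vertPart (θ - θ') = vertPart θ - vertPart θ' := by
  ext j
  simp only [vertPart_apply, PiLp.sub_apply, ContinuousAlternatingMap.sub_apply]
  ring

theorem contDiff_vertPart {r : WithTop ℕ∞} {η : Prd (m + 1) → Prd (m + 1) [⋀^Fin m]→L[ℝ] ℝ}
    (hη : ContDiff ℝ r η) : ContDiff ℝ r fun p => vertPart (η p) := by
  rw [contDiff_euclidean]
  intro j
  simp only [vertPart_apply]
  exact contDiff_const.mul (contDiff_form_apply hη fun _ => contDiff_const)

theorem support_vertPart_subset (η : Prd (m + 1) → Prd (m + 1) [⋀^Fin m]→L[ℝ] ℝ) :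
    (Function.support fun p => vertPart (η p)) ⊆ Function.support η := by
  intro p hp h0
  refine hp ?_
  ext j
  simp [vertPart_apply, h0]

/-! ### Smooth test fields suffice -/

theorem verticalForm_mem_testForms {Ω : Set (Space (m + 1))} {f : Prd (m + 1) → Space (m + 1)}
    (hf : IsTestField Ω f) (hf' : ContDiff ℝ ∞ f) :
    verticalForm f ∈ testForms (cylinder Ω) m :=
  ⟨contDiff_verticalForm hf', hasCompactSupport_verticalForm hf.2.1,
    (closure_mono (support_verticalForm_subset f)).trans hf.2.2⟩

/-- The linear map `y ↦ ∑_j (-1)^j y_j dyHat j`, so that `ω_f` is its composition with `f`. -/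
def vertCLM (m : ℕ) : Space (m + 1) →L[ℝ] Prd (m + 1) [⋀^Fin m]→L[ℝ] ℝ :=
  ∑ j : Fin (m + 1), ((-1 : ℝ) ^ (j : ℕ) •
    (EuclideanSpace.proj j : Space (m + 1) →L[ℝ] ℝ)).smulRight (dyHat j)

/-- The exterior derivative of `ω_f` as a function of the derivative of `f`. -/
def extDerivVertCLM (m : ℕ) :
    (Prd (m + 1) →L[ℝ] Space (m + 1)) →L[ℝ] Prd (m + 1) [⋀^Fin (m + 1)]→L[ℝ] ℝ :=
  (ContinuousAlternatingMap.alternatizeUncurryFinCLM ℝ (Prd (m + 1)) ℝ (n := m)).comp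
    (ContinuousLinearMap.compL ℝ (Prd (m + 1)) (Space (m + 1))
      (Prd (m + 1) [⋀^Fin m]→L[ℝ] ℝ) (vertCLM m))

theorem extDeriv_verticalForm {f : Prd (m + 1) → Space (m + 1)} {p : Prd (m + 1)}
    (hf : DifferentiableAt ℝ f p) :
    extDeriv (verticalForm f) p = extDerivVertCLM m (fderiv ℝ f p) := by
  rw [extDeriv, (hasFDerivAt_verticalForm hf).fderiv]
  change _ = ContinuousAlternatingMap.alternatizeUncurryFin ((vertCLM m).comp (fderiv ℝ f p))
  congr 1
  ext1 v
  simp [vertCLM]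

variable {Ω : Set (Space (m + 1))} {u : Space (m + 1) → Space (m + 1)}
  {Du : Space (m + 1) → Matrix (Fin (m + 1)) (Fin (m + 1)) ℝ}

theorem eventually_isTestField_mollify (hΩ : IsOpen Ω) {f : Prd (m + 1) → Space (m + 1)}
    (hf : IsTestField Ω f) : ∀ᶠ k : ℕ in atTop, IsTestField Ω (mollify k f) := by
  obtain ⟨δ, hδ, hδΩ⟩ :=
    IsCompact.exists_cthickening_subset_open hf.2.1 (isOpen_cylinder hΩ) hf.2.2
  obtain ⟨k₀, hk₀⟩ := exists_nat_one_div_lt hδ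
  filter_upwards [eventually_ge_atTop k₀] with k hk
  have hsub : Function.support (mollify k f) ⊆ Metric.cthickening δ (tsupport f) := by
    refine (support_mollify_subset k f).trans (Metric.cthickening_mono ?_ _)
    refine le_trans ?_ hk₀.le
    gcongr
  exact ⟨(contDiff_mollify k hf.1.continuous.locallyIntegrable).of_le (by simp),
    HasCompactSupport.of_support_subset_isCompact (IsCompact.cthickening hf.2.1) hsub,
    (closure_minimal hsub Metric.isClosed_cthickening).trans hδΩ⟩

theorem Admissible.tendsto_energyFunctional_mollify (h : Admissible Ω u Du)
    {f : Prd (m + 1) → Space (m + 1)} (hf : IsTestField Ω f) :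
    Tendsto (fun k => energyFunctional Ω u Du (mollify k f)) atTop
      (𝓝 (energyFunctional Ω u Du f)) := by
  have hf' : Continuous (fderiv ℝ f) := hf.1.continuous_fderiv one_ne_zero
  obtain ⟨C, hC0, hC⟩ := exists_norm_le_of_hasCompactSupport hf' (hf.2.1.fderiv ℝ)
  have hsm : ∀ k, ContDiff ℝ 1 (mollify k f) := fun k =>
    (contDiff_mollify k hf.1.continuous.locallyIntegrable).of_le (by simp)
  have hd : ∀ k p, extDeriv (verticalForm (mollify k f)) p
      = extDerivVertCLM m (mollify k (fderiv ℝ f) p) := fun k p => by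
    rw [extDeriv_verticalForm ((hsm k).differentiable one_ne_zero p),
      (hasFDerivAt_mollify k hf.1 hf.2.1 p).fderiv]
  set B := ‖extDerivVertCLM m‖ * C
  have hB : ∀ k p, ‖extDeriv (verticalForm (mollify k f)) p‖ ≤ B := fun k p => by
    rw [hd]
    refine ((extDerivVertCLM m).le_opNorm _).trans ?_
    exact mul_le_mul_of_nonneg_left (norm_mollify_le k hC p) (norm_nonneg _)
  unfold energyFunctional
  rw [energyDensity_eq hf.1]
  simp_rw [energyDensity_eq (hsm _)]
  refine tendsto_integral_of_dominated_convergence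
    (fun x => |(Du x).det| * B + 2 ^ (m + 1) * B * (1 + ‖matCLM (Du x)‖) ^ m)
    (fun k => ?_) ((h.integrable_det.norm.mul_const B).add
      (h.integrable_one_add_pow.const_mul (2 ^ (m + 1) * B)))
    (fun k => Eventually.of_forall fun x => ?_) (Eventually.of_forall fun x => ?_)
  · exact (continuous_form_tangents (continuous_extDeriv
      (contDiff_verticalForm (hsm k)))).comp_aestronglyMeasurable
      ((aestronglyMeasurable_id.prodMk h.integrable.aestronglyMeasurable).prodMk
        h.integrable_grad.aestronglyMeasurable)
  · rw [Real.norm_eq_abs]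
    exact abs_form_tangents_le (hB k _) _
  · have h1 : Tendsto (fun k => extDeriv (verticalForm (mollify k f)) (pt x (u x))) atTop
        (𝓝 (extDeriv (verticalForm f) (pt x (u x)))) := by
      simp_rw [hd]
      rw [extDeriv_verticalForm (hf.1.differentiable one_ne_zero _)]
      exact ((extDerivVertCLM m).continuous.tendsto _).comp
        (tendsto_mollify_of_continuous hf' _)
    exact ((ContinuousAlternatingMap.apply ℝ _ _ _).continuous.tendsto _).comp h1

/-! ### The surface energy and the mass of the boundary -/

/-- For smooth `f` the form `ω_f` is admissible in the definition of the mass. -/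
theorem Admissible.energyFunctional_le_mass_of_contDiff (h : Admissible Ω u Du)
    {f : Prd (m + 1) → Space (m + 1)} (hf : IsTestField Ω f) (hf' : ContDiff ℝ ∞ f)
    (hf1 : ∀ p, ‖f p‖ ≤ 1) :
    (energyFunctional Ω u Du f : EReal) ≤ (graphCurrent Ω u).boundary.mass := by
  rw [h.energyFunctional_eq_boundary hf (verticalForm_mem_testForms hf hf')]
  refine le_iSup₂_of_le ⟨verticalForm f, verticalForm_mem_testForms hf hf'⟩ (fun p => ?_) le_rfl
  exact (covectorNorm_verticalForm f p).trans_le (hf1 p)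

theorem Admissible.surfaceEnergy_le_mass (h : Admissible Ω u Du) :
    surfaceEnergy Ω u Du ≤ (graphCurrent Ω u).boundary.mass := by
  refine iSup_le fun f => iSup₂_le fun hf hf1 => ?_
  refine le_of_tendsto ((continuous_coe_real_ereal.tendsto _).comp
    (h.tendsto_energyFunctional_mollify hf)) ?_
  filter_upwards [eventually_isTestField_mollify h.isOpen hf] with k hk
  exact h.energyFunctional_le_mass_of_contDiff hk
    (contDiff_mollify k hf.1.continuous.locallyIntegrable) (norm_mollify_le k hf1)

/-- The boundary of the graph current depends on a form only through its vertical part. -/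
theorem Admissible.boundary_eq_energyFunctional (h : Admissible Ω u Du)
    (η : testForms (cylinder Ω) m) :
    IsTestField Ω (fun p => vertPart ((η : Prd (m + 1) → _) p)) ∧
      (graphCurrent Ω u).boundary η
        = energyFunctional Ω u Du fun p => vertPart ((η : Prd (m + 1) → _) p) := by
  obtain ⟨η, hη⟩ := η
  set f : Prd (m + 1) → Space (m + 1) := fun p => vertPart (η p)
  have hfs : ContDiff ℝ ∞ f := contDiff_vertPart hη.1
  have hf : IsTestField Ω f := ⟨hfs.of_le (by simp), hη.2.1.mono (support_vertPart_subset η),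
    (closure_mono (support_vertPart_subset η)).trans hη.2.2⟩
  refine ⟨hf, ?_⟩
  have hω := verticalForm_mem_testForms hf hfs
  rw [h.energyFunctional_eq_boundary hf hω, ← sub_eq_zero, ← map_sub, h.boundary_apply]
  refine h.integral_extDeriv_eq_zero (sub_mem hη hω) fun p w => ?_
  refine form_vertical_eq_zero ?_ w
  change vertPart (η p - verticalForm f p) = 0
  rw [vertPart_sub, vertPart_verticalForm, sub_self]

theorem Admissible.mass_le_surfaceEnergy (h : Admissible Ω u Du) :
    (graphCurrent Ω u).boundary.mass ≤ surfaceEnergy Ω u Du := by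
  refine iSup₂_le fun η hη => ?_
  obtain ⟨hf, heq⟩ := h.boundary_eq_energyFunctional η
  rw [heq]
  exact le_iSup_of_le _ (le_iSup₂_of_le hf (fun p => (norm_vertPart_le _).trans (hη p)) le_rfl)

end

end GraphCurrents

end

theorem mainTheorem4 (m : ℕ) (Ω : Set (GraphCurrents.Space (m + 1)))
    (hΩ_open : IsOpen Ω) (hΩ_bdd : Bornology.IsBounded Ω)
    (u : GraphCurrents.Space (m + 1) → GraphCurrents.Space (m + 1))
    (Du : GraphCurrents.Space (m + 1) → Matrix (Fin (m + 1)) (Fin (m + 1)) ℝ)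
    (hu : GraphCurrents.MemSobolev (m : ℝ≥0∞) Ω u Du)
    (hu_bdd : MemLp u ∞ (volume.restrict Ω))
    (hdet : IntegrableOn (fun x => (Du x).det) Ω) :
    -- the graph current is well defined
    GraphCurrents.GraphIntegrable Ω u ∧
    -- the identity for `C¹` fields, with `⟨∂G_u, ω_f⟩ = ⟨G_u, dω_f⟩` as an integral over the graph
    (∀ f : GraphCurrents.Prd (m + 1) → GraphCurrents.Space (m + 1),
      GraphCurrents.IsTestField Ω f →
        IntegrableOn (GraphCurrents.energyDensity u Du f) Ω ∧
        Integrable (GraphCurrents.graphDensity u (extDeriv (GraphCurrents.verticalForm f)))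
          (GraphCurrents.graphMeasure Ω u) ∧
        GraphCurrents.energyFunctional Ω u Du f
          = GraphCurrents.graphPairing Ω u (extDeriv (GraphCurrents.verticalForm f)) ∧
        -- if `ω_f` is smooth, this is the value of the current `∂G_u` on `ω_f`
        ∀ hf : GraphCurrents.verticalForm f
            ∈ GraphCurrents.testForms (GraphCurrents.cylinder Ω) m,
          GraphCurrents.energyFunctional Ω u Du f
            = (GraphCurrents.graphCurrent Ω u).boundary ⟨GraphCurrents.verticalForm f, hf⟩) ∧
    -- the surface energy is the mass of the boundary of the graph current
    GraphCurrents.surfaceEnergy Ω u Du = (GraphCurrents.graphCurrent Ω u).boundary.mass := by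
  have h := GraphCurrents.admissible_of_memSobolev hΩ_open hΩ_bdd hu hu_bdd hdet
  refine ⟨h.graphIntegrable, fun f hf => ⟨?_, ?_, h.energyFunctional_eq_graphPairing hf,
    h.energyFunctional_eq_boundary hf⟩, le_antisymm h.surfaceEnergy_le_mass h.mass_le_surfaceEnergy⟩
  · rw [GraphCurrents.Admissible.energyDensity_eq hf.1]
    exact h.integrableOn_extDeriv_verticalForm hf
  · exact (h.integrable_iff _).2 (h.integrableOn_extDeriv_verticalForm hf)
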